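/- **Setting.** For $Q\in\mathbb Z[x,y]$ and $a\ge 1$ let $\rho_Q(a)$ be the number of $(x,y)\in(\mathbb Z/a\mathbb Z)^2$ with $Q(x,y)\equiv 0 \bmod a$. For a prime $p$ and $k\ge1$ call a solution modulo $p^k$ *smooth* if the partial derivatives $\partial_xQ,\partial_yQ$ do not both vanish modulo $p$ there, and say that it *has a lift* if it is the reduction of a solution modulo $p^{k+1}$. Let $\widetilde\rho_Q(p^k)$ be the number of solutions modulo $p^k$ which are smooth or have no lift, and extend $\widetilde\rho_Q$ to a multiplicative function on $\mathbb N$. Write $p\mid Q$ if $p$ divides all coefficients of $Q$, and let $\deg Q$ be the total degree. A bounded convex domain $\mathscr E\subset\mathbb R^2$ with nonempty interior is $C^2$ if its boundary is a regular simple closed twice continuously differentiable curve; $A(\mathscr E)$ is its area and $R_{\max}=R_{\max}(\mathscr E)$ the maximal radius of curvature of its boundary ($\infty$ if it is unbounded). For $C_l,\theta_l>0$ let $\mathcal L(C_l,\theta_l)$ be the class of $C^2$ convex planar domains $\mathscr E$ such that for all integers $a\ge1$ with $a^2\le A(\mathscr E)$ and all $(x_0,y_0)\in\mathbb Z^2$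 $$\left|\#\left(a^{-1}(\mathscr E-(x_0,y_0))\cap\mathbb Z^2\right)-a^{-2}A(\mathscr E)\right|\le C_l\left(R_{\max}(\mathscr E)/a\right)^{\theta_l}.$$ For $A\ge1$ and $B,\varepsilon>0$ let $\mathcal M(A,B,\varepsilon)$ be the class of nonnegative multiplicative functions $f$ on the positive integers with $f(n)\le\min(A^{\Omega(n)},Bn^{\varepsilon})$ for all $n\ge1$, where $\Omega(n)$ is the number of prime factors of $n$ counted with multiplicity. **Theorem 8.5.** Let $C_l,\theta_l>0$, $0<\eta<1/2$, $C>0$, $0<r\le1$, $\delta>0$, $A\ge1$, $B>0$ and $0<\varepsilon<\min\{r,\eta r/(4\delta)\}$. Let $\mathscr E$ be a domain of class $\mathcal L(C_l,\theta_l)$ with $R_{\max}^{\theta_l}\le A(\mathscr E)^{1-3\eta}$. Let $Q\in\mathbb Z[x,y]$ satisfy $\widetilde\rho_Q(p^k)\le Cp^{k(2-r)}$ for all primes $p$ and all $k\ge1$. Let $X\ge1$ be a real number with $$\max\left\{|Q(x,y)| : (x,y)\in\mathscr E\cap\mathbb Z^2\right\}\le X\le A(\mathscr E)^{\delta}.$$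 Let $f\in\mathcal M(A,B,\varepsilon)$. Then $$\sum_{\substack{(x,y)\in\mathscr E\cap\mathbb Z^2\\ Q(x,y)\ne0}} f\left(|Q(x,y)|\right)\ll A(\mathscr E)\prod_{\substack{\deg Q<p\le X\\ p\nmid Q}}\left(1-\frac{\rho_Q(p)}{p^2}\right)\sum_{1\le a\le X}\frac{f(a)\widetilde\rho_Q(a)}{a^2},$$ where the product is over primes $p$, and the implicit constant depends only on $C_l,A,B,\varepsilon,\deg Q,C,r,\eta,\delta$. -/

import Mathlib

open MeasureTheory
open scoped ENNReal

namespace PlaneSieve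

/-! ### Points on the plane curve `Q = 0` over `ℤ/n` -/

/-- `Q(x, y) = 0` in `ℤ/n`, for `v = (x, y)`: a `ℤ/n`-point of the curve cut out by `Q`. -/
def IsPoint (Q : MvPolynomial (Fin 2) ℤ) (n : ℕ) (v : ZMod n × ZMod n) : Prop :=
  MvPolynomial.aeval ![v.1, v.2] Q = 0

/-- `ρ_Q(n)`, the number of `ℤ/n`-points of the curve (used for `n ≥ 1`). -/
noncomputable def rho (Q : MvPolynomial (Fin 2) ℤ) (n : ℕ) : ℕ :=
  Nat.card {v : ZMod n × ZMod n // IsPoint Q n v}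

/-- Jacobian criterion: one of the partial derivatives of `Q` at `v` is a unit. If `n = p ^ k`
with `k ≥ 1` this says that the gradient of `Q` at `v` does not vanish modulo `p`. -/
def IsSmoothAt (Q : MvPolynomial (Fin 2) ℤ) (n : ℕ) (v : ZMod n × ZMod n) : Prop :=
  ∃ i : Fin 2, IsUnit (MvPolynomial.aeval ![v.1, v.2] (MvPolynomial.pderiv i Q))

/-- The point `v` modulo `p ^ k` lifts to a point of the curve modulo `p ^ (k + 1)`. -/
def HasLift (Q : MvPolynomial (Fin 2) ℤ) (p k : ℕ) (v : ZMod (p ^ k) × ZMod (p ^ k)) : Prop :=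
  ∃ w : ZMod (p ^ (k + 1)) × ZMod (p ^ (k + 1)), IsPoint Q (p ^ (k + 1)) w ∧
    ZMod.castHom (pow_dvd_pow p k.le_succ) (ZMod (p ^ k)) w.1 = v.1 ∧
    ZMod.castHom (pow_dvd_pow p k.le_succ) (ZMod (p ^ k)) w.2 = v.2

/-- `ρ̃_Q(p ^ k)`, for `p` prime and `k ≥ 1`: the number of points modulo `p ^ k` that are smooth
or have no lift. -/
noncomputable def rhoTildePrimePow (Q : MvPolynomial (Fin 2) ℤ) (p k : ℕ) : ℕ :=
  Nat.card {v : ZMod (p ^ k) × ZMod (p ^ k) //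
    IsPoint Q (p ^ k) v ∧ (IsSmoothAt Q (p ^ k) v ∨ ¬ HasLift Q p k v)}

/-- The multiplicative extension of `ρ̃_Q` to the positive integers. -/
noncomputable def rhoTilde (Q : MvPolynomial (Fin 2) ℤ) (a : ℕ) : ℕ :=
  ∏ p ∈ a.primeFactors, rhoTildePrimePow Q p (a.factorization p)

open Classical in
/-- The product of `1 - ρ_Q(p) / p ^ 2` over the primes `deg Q < p ≤ X` not dividing `Q`,
i.e. not dividing all the coefficients of `Q`. -/
noncomputable def sieveProduct (Q : MvPolynomial (Fin 2) ℤ) (X : ℝ) : ℝ :=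
  ∏ p ∈ (Finset.Ioc Q.totalDegree ⌊X⌋₊).filter
      (fun p : ℕ => p.Prime ∧ ¬ (MvPolynomial.C (p : ℤ) ∣ Q)),
    (1 - (rho Q p : ℝ) / (p : ℝ) ^ 2)

/-- `Q(x, y)` for an integral point `(x, y)`. -/
noncomputable def value (Q : MvPolynomial (Fin 2) ℤ) (v : ℤ × ℤ) : ℤ :=
  MvPolynomial.eval ![v.1, v.2] Q

/-! ### Convex domains with twice continuously differentiable boundary -/

/-- `γ` is a regular, simple, closed, twice continuously differentiable parametrization
(of period `1`) of the boundary of `E`. -/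
structure IsC2BoundaryParam (γ : ℝ → ℝ × ℝ) (E : Set (ℝ × ℝ)) : Prop where
  contDiff : ContDiff ℝ 2 γ
  regular : ∀ t, deriv γ t ≠ 0
  periodic : Function.Periodic γ 1
  injOn : Set.InjOn γ (Set.Ico 0 1)
  range_eq : Set.range γ = frontier E

/-- A (bounded, nondegenerate) convex planar domain whose boundary is a `C²` curve. Nothing is
assumed on which of its boundary points belong to `E`. -/
structure IsC2ConvexDomain (E : Set (ℝ × ℝ)) : Prop where
  convex : Convex ℝ E
  bounded : Bornology.IsBounded E
  interior_nonempty : (interior E).Nonempty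
  boundary : ∃ γ : ℝ → ℝ × ℝ, IsC2BoundaryParam γ E

/-- The radius of curvature `(x' ^ 2 + y' ^ 2) ^ (3 / 2) / |x' y'' - y' x''|` of the regular
curve `γ = (x, y)` at the parameter `t`; it is `∞` where the curvature vanishes. -/
noncomputable def radiusOfCurvature (γ : ℝ → ℝ × ℝ) (t : ℝ) : ℝ≥0∞ :=
  ENNReal.ofReal (((deriv γ t).1 ^ 2 + (deriv γ t).2 ^ 2) ^ (3 / 2 : ℝ)) /
    ENNReal.ofReal |(deriv γ t).1 * (deriv (deriv γ) t).2 -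
      (deriv γ t).2 * (deriv (deriv γ) t).1|

/-- The maximal radius of curvature of the boundary of `E`. (The radius of curvature at a boundary
point does not depend on the parametrization, so the first supremum is over equal values.) -/
noncomputable def Rmax (E : Set (ℝ × ℝ)) : ℝ≥0∞ :=
  ⨆ (γ : ℝ → ℝ × ℝ) (_ : IsC2BoundaryParam γ E) (t : ℝ), radiusOfCurvature γ t

/-- The area of `E`. -/
noncomputable def area (E : Set (ℝ × ℝ)) : ℝ := volume.real E

/-- The integral points of `E`. -/
def latticePoints (E : Set (ℝ × ℝ)) : Set (ℤ × ℤ) := {v | ((v.1 : ℝ), (v.2 : ℝ)) ∈ E}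

/-- The set `a⁻¹ (E - (x₀, y₀))`. -/
def rescale (E : Set (ℝ × ℝ)) (a : ℕ) (v₀ : ℤ × ℤ) : Set (ℝ × ℝ) :=
  (fun v : ℝ × ℝ => (a : ℝ)⁻¹ • (v - ((v₀.1 : ℝ), (v₀.2 : ℝ)))) '' E

/-- The class of `C²` convex planar domains with lattice point discrepancy controlled by
`Cl` and `θ`. -/
structure IsOfClassL (Cl θ : ℝ) (E : Set (ℝ × ℝ)) : Prop where
  isC2ConvexDomain : IsC2ConvexDomain E
  discrepancy : ∀ (a : ℕ) (v₀ : ℤ × ℤ), 0 < a → (a : ℝ) ^ 2 ≤ area E →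
    ENNReal.ofReal |((latticePoints (rescale E a v₀)).ncard : ℝ) - area E / (a : ℝ) ^ 2| ≤
      ENNReal.ofReal Cl * (Rmax E / (a : ℝ≥0∞)) ^ θ

/-! ### Multiplicative functions -/

/-- The class of nonnegative multiplicative functions with `f(n) ≤ min(A ^ Ω(n), B n ^ ε)`. -/
structure IsOfClassM (A B ε : ℝ) (f : ArithmeticFunction ℝ) : Prop where
  isMultiplicative : f.IsMultiplicative
  nonneg : ∀ n, 0 ≤ f n
  le_min : ∀ n : ℕ, 0 < n →
    f n ≤ min (A ^ ArithmeticFunction.cardFactors n) (B * (n : ℝ) ^ ε)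

end PlaneSieve

/-! This is the method of Shiu and Nair–Tenenbaum. Let `N` be the area and `n = |Q(v)| ≤ X ≤ N ^ δ`.
Multiply the full prime powers of `n` in increasing order of the primes as long as the product stays
below `N ^ (3η/4)`. This gives `n = ab` with `a`, `b` coprime, and every prime of `b` is at least
the prime `q` at which the product would overshoot (`le_or_exists_coprime_mul`). The divisor `a` is
small enough for equidistribution modulo `a`. If `q ≥ N ^ t`, then `b` has at most `δ/t` prime
factors, so `f(b) ≤ A ^ (δ/t)` and `f(n)` is controlled by `f(a)`.

For fixed `a`, the points `v` of which `a` is a unitary divisor lie in at most `ρ̃_Q(a)` classes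
modulo `a`: when `p ^ k` divides `Q(v)` exactly, Taylor expansion forces `v` modulo `p ^ k` to be
smooth or without a lift (`smooth_or_not_hasLift`, `card_image_red_le`). In each class Selberg's
sieve removes the `v` for which a prime `p ≤ w` not dividing `a` divides `Q(v)`
(`exists_sieve_bound`, `exists_card_sifted_class_le`). The result is `N / a ^ 2` times the sieve
product, up to a factor over the primes dividing `a` that is harmless on average. Summing `f(a)
ρ̃_Q(a) / a ^ 2` over `a` then gives the desired right-hand side.

The difficulty is small `q`, where `A ^ (δ/t)` is large. `IsSieveSetting.cases` distinguishes four
possibilities. If `q > N ^ τ`, or `n` itself is small, the loss is a constant. If a prime power `q ^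
e > N ^ (3η/8)` with `q ≤ N ^ τ` divides `n`, or if `a` is large with all its primes below a
constant, then `v` belongs to a set so sparse that the trivial bound `f ≪ N ^ (δε)` suffices
(`exists_card_primePow_le`, `exists_card_smooth_le`). Otherwise `N ^ (τ/2^(j+1)) < q ≤ N ^ (τ/2^j)`
for some `j`, while `a > N ^ (3η/8)` has only primes below `q`. Rankin's trick then saves an
exponential in `2 ^ j` that beats `A ^ (δ 2^(j+1)/τ)`, leaving `exp(-2^j)`. Sieving only up to `N ^
(τ/2^(j+1))` costs `Λ ^ j`, and `∑ Λ ^ j exp(-2^j)` converges (`exists_sum_carried_le`,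
`exists_sum_le`).

Two inputs make the sums over `a` tractable. The weight is tame, with `g(p ^ k)` bounded by a
constant times both `1/p` and `p ^ (-(r-ε)k)` (`exists_tame_weight`). For tame functions, Euler
products up to `X` and sums up to `X` are comparable (`NonnegMul.sum_le_eulerProd`,
`exists_eulerProd_le_sum`). -/

namespace PlaneSieve

/-! ### Chebyshev-type bounds for sums over primes -/

/-- The primes `p` with `⌊w⌋ < p ≤ X`. -/
noncomputable def primesIoc (w X : ℝ) : Finset ℕ :=
  (Finset.Ioc ⌊w⌋₊ ⌊X⌋₊).filter Nat.Prime

lemma mem_primesIoc {w X : ℝ} (hw : 0 ≤ w) {p : ℕ} :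
    p ∈ primesIoc w X ↔ p.Prime ∧ w < p ∧ (p : ℝ) ≤ X := by
  unfold primesIoc
  rw [Finset.mem_filter, Finset.mem_Ioc, Nat.floor_lt hw]
  constructor
  · rintro ⟨⟨h1, h2⟩, h3⟩
    exact ⟨h3, h1, (Nat.le_floor_iff' h3.ne_zero).1 h2⟩
  · rintro ⟨h3, h1, h2⟩
    exact ⟨⟨h1, (Nat.le_floor_iff' h3.ne_zero).2 h2⟩, h3⟩

/-- The first term of Legendre's formula gives `p ^ ⌊n/p⌋ ∣ n!`, and these powers are coprime for
distinct primes. -/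
lemma sum_div_mul_log_le_log_factorial (n : ℕ) :
    ∑ p ∈ (Finset.Ioc 0 n).filter Nat.Prime, ((n / p : ℕ) : ℝ) * Real.log p ≤
      Real.log (n.factorial : ℝ) := by
  have hdvd : ∏ p ∈ (Finset.Ioc 0 n).filter Nat.Prime, p ^ (n / p) ∣ n.factorial := by
    apply Finset.prod_dvd_of_isRelPrime
    · intro p hp q hq hpq
      have hp' := (Finset.mem_filter.1 hp).2
      have hq' := (Finset.mem_filter.1 hq).2
      exact Nat.coprime_iff_isRelPrime.1 (Nat.Coprime.pow _ _ ((Nat.coprime_primes hp' hq').2 hpq))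
    · intro p hp
      have hp' := (Finset.mem_filter.1 hp).2
      rw [hp'.pow_dvd_iff_le_factorization (Nat.factorial_ne_zero n),
        Nat.factorization_factorial hp' (b := Nat.log p n + 2) (by omega)]
      have h1 : (1 : ℕ) ∈ Finset.Ico 1 (Nat.log p n + 2) := by simp
      have := Finset.single_le_sum (f := fun i => n / p ^ i) (fun i _ => Nat.zero_le _) h1
      simpa using this
  have hle := Nat.le_of_dvd (Nat.factorial_pos n) hdvd
  have hpos : ∀ p ∈ (Finset.Ioc 0 n).filter Nat.Prime, ((p : ℝ) ^ (n / p)) ≠ 0 := by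
    intro p hp
    have hp' := (Finset.mem_filter.1 hp).2
    exact pow_ne_zero _ (by exact_mod_cast hp'.ne_zero)
  have h2 : Real.log (∏ p ∈ (Finset.Ioc 0 n).filter Nat.Prime, (p : ℝ) ^ (n / p)) ≤
      Real.log (n.factorial : ℝ) := by
    apply Real.log_le_log
    · apply Finset.prod_pos
      intro p hp
      have hp' := (Finset.mem_filter.1 hp).2
      exact pow_pos (by exact_mod_cast hp'.pos) _
    · exact_mod_cast hle
  rw [Real.log_prod hpos] at h2
  simpa [Real.log_pow] using h2

/-- Replacing `⌊n/p⌋` by `n/p` costs at most `log p` for each prime, altogether `θ(n) ≤ n log 4`. -/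
lemma sum_log_div_le (n : ℕ) (hn : 1 ≤ n) :
    ∑ p ∈ (Finset.Ioc 0 n).filter Nat.Prime, Real.log p / p ≤ Real.log n + Real.log 4 := by
  have h1 := sum_div_mul_log_le_log_factorial n
  have h2 : Real.log (n.factorial : ℝ) ≤ n * Real.log n := by
    rw [← Real.log_pow]
    apply Real.log_le_log (by exact_mod_cast Nat.factorial_pos n)
    exact_mod_cast Nat.factorial_le_pow n
  have h3 : ∑ p ∈ (Finset.Ioc 0 n).filter Nat.Prime, Real.log p ≤ Real.log 4 * n := by
    have := Chebyshev.theta_le_log4_mul_x (x := (n : ℝ)) (by positivity)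
    rw [Chebyshev.theta, Nat.floor_natCast] at this
    exact this
  have hn0 : (0 : ℝ) < n := by exact_mod_cast hn
  have h4 : ∑ p ∈ (Finset.Ioc 0 n).filter Nat.Prime, (n * (Real.log p / p)) ≤
      ∑ p ∈ (Finset.Ioc 0 n).filter Nat.Prime, (((n / p : ℕ) : ℝ) * Real.log p + Real.log p) := by
    apply Finset.sum_le_sum
    intro p hp
    have hp' := (Finset.mem_filter.1 hp).2
    have hlog : 0 ≤ Real.log p := Real.log_natCast_nonneg p
    have h5 : (n : ℝ) / p ≤ ((n / p : ℕ) : ℝ) + 1 := by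
      have h6 : n < p * (n / p + 1) := Nat.lt_mul_div_succ n hp'.pos
      rw [div_le_iff₀ (by exact_mod_cast hp'.pos)]
      have : (n : ℝ) < p * ((n / p : ℕ) + 1) := by exact_mod_cast h6
      linarith
    calc (n : ℝ) * (Real.log p / p) = (n / p) * Real.log p := by ring
      _ ≤ (((n / p : ℕ) : ℝ) + 1) * Real.log p := by gcongr
      _ = _ := by ring
  rw [← Finset.mul_sum, Finset.sum_add_distrib] at h4
  have h5 : n * ∑ p ∈ (Finset.Ioc 0 n).filter Nat.Prime, Real.log p / p ≤
      n * (Real.log n + Real.log 4) := by linarith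
  exact le_of_mul_le_mul_left h5 hn0

lemma exists_sum_one_add_log_div_le :
    ∃ K : ℝ, 0 < K ∧ ∀ y : ℝ, 1 ≤ y →
      ∑ p ∈ primesIoc 0 y, (1 + Real.log p) / p ≤ K * (1 + Real.log y) := by
  have hl2 : 0 < Real.log 2 := Real.log_pos (by norm_num)
  have hl4 : 0 < Real.log 4 := Real.log_pos (by norm_num)
  refine ⟨(1 / Real.log 2 + 1) * (1 + Real.log 4), by positivity, fun y hy => ?_⟩
  have hfl : 1 ≤ ⌊y⌋₊ := Nat.one_le_floor_iff y |>.2 hy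
  have hly : 0 ≤ Real.log y := Real.log_nonneg hy
  have h1 : ∑ p ∈ primesIoc 0 y, (1 + Real.log p) / p ≤
      ∑ p ∈ primesIoc 0 y, (1 / Real.log 2 + 1) * (Real.log p / p) := by
    apply Finset.sum_le_sum
    intro p hp
    have hp' := ((mem_primesIoc le_rfl).1 hp).1
    have : Real.log 2 ≤ Real.log p :=
      Real.log_le_log (by norm_num) (by exact_mod_cast hp'.two_le)
    rw [← mul_div_assoc]
    have hpp : (0 : ℝ) < p := by exact_mod_cast hp'.pos
    gcongr
    have : 1 ≤ 1 / Real.log 2 * Real.log p := by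
      rw [div_mul_eq_mul_div, one_mul, one_le_div hl2]; exact this
    linarith
  rw [← Finset.mul_sum] at h1
  refine h1.trans ?_
  rw [mul_assoc]
  gcongr
  have h2 := sum_log_div_le ⌊y⌋₊ hfl
  have h3 : Real.log (⌊y⌋₊ : ℝ) ≤ Real.log y :=
    Real.log_le_log (by exact_mod_cast hfl) (Nat.floor_le (by linarith))
  have h4 : ∑ p ∈ primesIoc 0 y, Real.log p / p ≤ Real.log y + Real.log 4 := by
    unfold primesIoc
    rw [Nat.floor_zero]
    linarith
  nlinarith

lemma primesIoc_subset_union (w w' X : ℝ) :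
    primesIoc w X ⊆ primesIoc w w' ∪ primesIoc w' X := by
  intro p
  simp only [primesIoc, Finset.mem_filter, Finset.mem_Ioc, Finset.mem_union]
  rintro ⟨⟨h1, h2⟩, h3⟩
  by_cases h : p ≤ ⌊w'⌋₊
  · exact Or.inl ⟨⟨h1, h⟩, h3⟩
  · exact Or.inr ⟨⟨by omega, h2⟩, h3⟩

/-- Each doubling of `1 + log w` costs a bounded amount. Counting doublings by an integer `i`
replaces the iterated logarithm, and `i` becomes the exponent of `Λ` in all later comparisons of
sieve levels. -/
lemma exists_sum_inv_le :
    ∃ K : ℝ, 0 < K ∧ ∀ (i : ℕ) (w X : ℝ), 1 ≤ w → 1 ≤ X →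
      1 + Real.log X ≤ 2 ^ i * (1 + Real.log w) →
      ∑ p ∈ primesIoc w X, (1 : ℝ) / p ≤ K * i := by
  obtain ⟨K, hK, h⟩ := exists_sum_one_add_log_div_le
  refine ⟨2 * K, by positivity, fun i => ?_⟩
  have base : ∀ w X : ℝ, 1 ≤ w → 1 ≤ X → 1 + Real.log X ≤ 2 * (1 + Real.log w) →
      ∑ p ∈ primesIoc w X, (1 : ℝ) / p ≤ 2 * K := by
    intro w X hw hX hwX
    have hlw : 0 ≤ Real.log w := Real.log_nonneg hw
    have h1 : (1 + Real.log w) * ∑ p ∈ primesIoc w X, (1 : ℝ) / p ≤ K * (1 + Real.log X) := by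
      refine le_trans ?_ (h X hX)
      rw [Finset.mul_sum]
      refine le_trans (Finset.sum_le_sum (g := fun p : ℕ => (1 + Real.log p) / (p : ℝ)) ?_) ?_
      · intro p hp
        obtain ⟨hp', hwp, -⟩ := (mem_primesIoc (by linarith)).1 hp
        have : Real.log w ≤ Real.log p := Real.log_le_log (by linarith) hwp.le
        rw [mul_one_div]
        gcongr
      · apply Finset.sum_le_sum_of_subset_of_nonneg
        · intro p hp
          obtain ⟨hp', hwp, hpX⟩ := (mem_primesIoc (by linarith)).1 hp
          exact (mem_primesIoc le_rfl).2 ⟨hp', by linarith, hpX⟩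
        · intro p _ _
          have := Real.log_natCast_nonneg p
          positivity
    have h2 : (1 + Real.log w) * ∑ p ∈ primesIoc w X, (1 : ℝ) / p ≤ (1 + Real.log w) * (2 * K) := by
      nlinarith
    exact le_of_mul_le_mul_left h2 (by linarith)
  induction i with
  | zero =>
    intro w X hw hX hwX
    have hXw : X ≤ w := by
      rw [pow_zero, one_mul] at hwX
      exact (Real.log_le_log_iff (by linarith) (by linarith)).1 (by linarith)
    have : primesIoc w X = ∅ := by
      rw [Finset.eq_empty_iff_forall_notMem]
      intro p hp
      obtain ⟨-, h1, h2⟩ := (mem_primesIoc (by linarith)).1 hp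
      linarith
    simp [this]
  | succ i ih =>
    intro w X hw hX hwX
    have hlw : 0 ≤ Real.log w := Real.log_nonneg hw
    -- Chosen so that `1 + log w'` is exactly twice `1 + log w`.
    set w' := Real.exp 1 * w ^ 2 with hw'
    have hlw' : 1 + Real.log w' = 2 * (1 + Real.log w) := by
      rw [hw', Real.log_mul (Real.exp_ne_zero _) (by positivity), Real.log_exp, Real.log_pow]
      push_cast; ring
    have hw'1 : 1 ≤ w' := by
      have := Real.one_le_exp (x := 1) (by norm_num)
      nlinarith
    have h1 := base w w' hw hw'1 hlw'.le
    have h2 := ih w' X hw'1 hX (by rw [hlw', ← mul_assoc, ← pow_succ]; exact hwX)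
    calc ∑ p ∈ primesIoc w X, (1 : ℝ) / p
        ≤ ∑ p ∈ primesIoc w w' ∪ primesIoc w' X, (1 : ℝ) / p :=
          Finset.sum_le_sum_of_subset_of_nonneg (primesIoc_subset_union _ _ _)
            (fun _ _ _ => by positivity)
      _ ≤ ∑ p ∈ primesIoc w w', (1 : ℝ) / p + ∑ p ∈ primesIoc w' X, (1 : ℝ) / p := by
          rw [← Finset.sum_union_inter]
          have : 0 ≤ ∑ p ∈ primesIoc w w' ∩ primesIoc w' X, (1 : ℝ) / p :=
            Finset.sum_nonneg (fun _ _ => by positivity)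
          linarith
      _ ≤ _ := by push_cast; linarith

/-- A weak form of Mertens' third theorem. -/
lemma exists_prod_one_add_div_le (c : ℝ) (hc : 0 ≤ c) :
    ∃ Λ : ℝ, 1 ≤ Λ ∧ ∀ (i : ℕ) (w X : ℝ), 1 ≤ w → 1 ≤ X →
      1 + Real.log X ≤ 2 ^ i * (1 + Real.log w) →
      ∏ p ∈ primesIoc w X, (1 + c / p) ≤ Λ ^ i := by
  obtain ⟨K, hK, h⟩ := exists_sum_inv_le
  refine ⟨Real.exp (c * K), Real.one_le_exp (by positivity), fun i w X hw hX hwX => ?_⟩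
  calc ∏ p ∈ primesIoc w X, (1 + c / p) ≤ ∏ p ∈ primesIoc w X, Real.exp (c / p) := by
        apply Finset.prod_le_prod
        · intro p _; positivity
        · intro p _; linarith [Real.add_one_le_exp (c / (p : ℝ))]
    _ = Real.exp (c * ∑ p ∈ primesIoc w X, (1 : ℝ) / p) := by
        rw [← Real.exp_sum, Finset.mul_sum]
        congr 1
        exact Finset.sum_congr rfl fun p _ => by ring
    _ ≤ Real.exp (c * (K * i)) := by
        gcongr
        exact h i w X hw hX hwX
    _ = _ := by rw [← Real.exp_nat_mul]; congr 1; ring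

/-! ### Multiplicative functions of bounded average on the primes -/

/-- Nonnegative multiplicative functions (on the positive integers). -/
structure NonnegMul (g : ℕ → ℝ) : Prop where
  one : g 1 = 1
  nonneg : ∀ n, 0 ≤ g n
  mul : ∀ m n : ℕ, m.Coprime n → g (m * n) = g m * g n

/-- Nonnegative multiplicative functions with `g(p ^ k) ≤ c min(1 / p, p ^ (-γ k))`. -/
structure Tame (c γ : ℝ) (g : ℕ → ℝ) : Prop extends NonnegMul g where
  le_inv : ∀ p k : ℕ, p.Prime → 1 ≤ k → g (p ^ k) ≤ c / p
  le_rpow : ∀ p k : ℕ, p.Prime → 1 ≤ k → g (p ^ k) ≤ c * (p : ℝ) ^ (-(γ * k))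

/-- The Euler product of `g` over the primes `p ≤ y`. -/
noncomputable def eulerProd (g : ℕ → ℝ) (y : ℝ) : ℝ :=
  ∏ p ∈ primesIoc 0 y, ∑' k : ℕ, g (p ^ k)

lemma NonnegMul.hasSum_eulerProd {g : ℕ → ℝ} (hg : NonnegMul g) {y : ℝ}
    (hs : ∀ p ∈ primesIoc 0 y, Summable fun k : ℕ => g (p ^ k)) :
    HasSum (fun m : Nat.factoredNumbers (primesIoc 0 y) => g m) (eulerProd g y) := by
  have hfac : ∀ m ∈ Nat.factoredNumbers (primesIoc 0 y), ∀ p, p.Prime → p ∣ m →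
      p ∈ primesIoc 0 y := fun m hm => Nat.mem_factoredNumbers'.1 hm
  classical
  -- replace `g` by a function that vanishes at the powers of the primes `p > y`
  set G : ℕ → ℝ := fun m => if m ∈ Nat.factoredNumbers (primesIoc 0 y) then g m else 0 with hG
  have hmem1 : 1 ∈ Nat.factoredNumbers (primesIoc 0 y) := by
    rw [Nat.mem_factoredNumbers']
    intro p hp hp1
    exact absurd (Nat.dvd_one.1 hp1) hp.ne_one
  have hmulmem : ∀ m n : ℕ, m * n ∈ Nat.factoredNumbers (primesIoc 0 y) ↔
      m ∈ Nat.factoredNumbers (primesIoc 0 y) ∧ n ∈ Nat.factoredNumbers (primesIoc 0 y) := by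
    intro m n
    simp only [Nat.mem_factoredNumbers']
    constructor
    · intro h
      exact ⟨fun p hp hpm => h p hp (hpm.mul_right n), fun p hp hpn => h p hp (hpn.mul_left m)⟩
    · rintro ⟨h1, h2⟩ p hp hpmn
      rcases hp.dvd_mul.1 hpmn with h | h
      exacts [h1 p hp h, h2 p hp h]
  have hG1 : G 1 = 1 := by simp only [hG, if_pos hmem1, hg.one]
  have hGmul : ∀ {m n : ℕ}, m.Coprime n → G (m * n) = G m * G n := by
    intro m n hmn
    simp only [hG, hmulmem m n, hg.mul m n hmn]
    by_cases h1 : m ∈ Nat.factoredNumbers (primesIoc 0 y) <;>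
      by_cases h2 : n ∈ Nat.factoredNumbers (primesIoc 0 y) <;> simp [h1, h2]
  have hpow : ∀ p ∈ primesIoc 0 y, ∀ k : ℕ, G (p ^ k) = g (p ^ k) := by
    intro p hp k
    have : p ^ k ∈ Nat.factoredNumbers (primesIoc 0 y) := by
      rw [Nat.mem_factoredNumbers']
      intro q hq hqp
      rwa [(Nat.prime_dvd_prime_iff_eq hq ((mem_primesIoc le_rfl).1 hp).1).1
        (hq.dvd_of_dvd_pow hqp)]
    simp only [hG, if_pos this]
  have hsum : ∀ {p : ℕ}, p.Prime → Summable (fun n : ℕ => ‖G (p ^ n)‖) := by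
    intro p hp
    by_cases hpy : p ∈ primesIoc 0 y
    · simp only [hpow p hpy, Real.norm_eq_abs, abs_of_nonneg (hg.nonneg _)]
      exact hs p hpy
    · apply summable_of_ne_finset_zero (s := {0})
      intro k hk
      have hk0 : k ≠ 0 := by simpa using hk
      have : p ^ k ∉ Nat.factoredNumbers (primesIoc 0 y) := fun h =>
        hpy (hfac _ h p hp (dvd_pow_self p hk0))
      simp only [hG, if_neg this, norm_zero]
  have h := (EulerProduct.summable_and_hasSum_factoredNumbers_prod_filter_prime_tsum hG1 hGmul
    hsum (primesIoc 0 y)).2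
  have hfil : (primesIoc 0 y).filter Nat.Prime = primesIoc 0 y := by
    apply Finset.filter_true_of_mem
    intro p hp
    exact ((mem_primesIoc le_rfl).1 hp).1
  rw [hfil, Finset.prod_congr rfl (fun p hp => tsum_congr (hpow p hp))] at h
  have hfun : (fun m : Nat.factoredNumbers (primesIoc 0 y) => G m) =
      fun m : Nat.factoredNumbers (primesIoc 0 y) => g m := by
    funext m
    simp only [hG, if_pos m.2]
  rwa [hfun] at h

lemma NonnegMul.sum_le_eulerProd {g : ℕ → ℝ} (hg : NonnegMul g) {y : ℝ}
    (hs : ∀ p ∈ primesIoc 0 y, Summable fun k : ℕ => g (p ^ k)) (S : Finset ℕ)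
    (hS : ∀ a ∈ S, a ≠ 0 ∧ ∀ p : ℕ, p.Prime → p ∣ a → (p : ℝ) ≤ y) :
    ∑ a ∈ S, g a ≤ eulerProd g y := by
  have h := hg.hasSum_eulerProd hs
  have hmem : ∀ a ∈ S, a ∈ Nat.factoredNumbers (primesIoc 0 y) := by
    intro a ha
    rw [Nat.mem_factoredNumbers']
    intro p hp hpa
    exact (mem_primesIoc le_rfl).2 ⟨hp, by exact_mod_cast hp.pos, (hS a ha).2 p hp hpa⟩
  have h2 := sum_le_hasSum (S.attach.map ⟨fun a => (⟨a.1, hmem a.1 a.2⟩ :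
    Nat.factoredNumbers (primesIoc 0 y)), fun a b hab => by
      apply Subtype.ext; exact congrArg (fun z => z.1) hab⟩) (fun _ _ => hg.nonneg _) h
  rw [Finset.sum_map] at h2
  exact (Finset.sum_attach S g).symm.le.trans h2

/-- The function `n ↦ g(n) n ^ β`. -/
noncomputable def twist (g : ℕ → ℝ) (β : ℝ) (n : ℕ) : ℝ := g n * (n : ℝ) ^ β

lemma NonnegMul.twist {g : ℕ → ℝ} (hg : NonnegMul g) (β : ℝ) : NonnegMul (twist g β) where
  one := by simp [PlaneSieve.twist, hg.one]
  nonneg n := mul_nonneg (hg.nonneg n) (by positivity)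
  mul m n h := by
    unfold PlaneSieve.twist
    rw [hg.mul m n h, Nat.cast_mul, Real.mul_rpow (by positivity) (by positivity)]
    ring

/-- The ratio of the geometric series that bounds the local factors of a tame function. -/
noncomputable def ratio (γ : ℝ) : ℝ := (2 : ℝ) ^ (-(γ / 4))

lemma ratio_pos (γ : ℝ) : 0 < ratio γ := by unfold ratio; positivity

lemma ratio_lt_one {γ : ℝ} (hγ : 0 < γ) : ratio γ < 1 :=
  Real.rpow_lt_one_of_one_lt_of_neg (by norm_num) (by linarith)

lemma Tame.const_nonneg {c γ : ℝ} {g : ℕ → ℝ} (hg : Tame c γ g) : 0 ≤ c := by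
  have h := (hg.nonneg _).trans (hg.le_inv 2 1 Nat.prime_two le_rfl)
  have : (0 : ℝ) < ((2 : ℕ) : ℝ) := by norm_num
  by_contra hc
  have := div_neg_of_neg_of_pos (not_le.1 hc) this
  linarith

/-- For `k ≤ 4/γ` the twist `p ^ (kβ)` is at most `exp(4M/γ)`, and the bound `c/p` is used. For
larger `k`, half of the decay `p ^ (-γk)` absorbs the twist, a quarter supplies the factor `1/p`,
and the last quarter supplies the geometric decay. -/
lemma Tame.twist_prime_pow_le {c γ M β y : ℝ} (hγ : 0 < γ) (hM : 0 ≤ M) {g : ℕ → ℝ}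
    (hg : Tame c γ g) (hβγ : β ≤ γ / 2) (hβ0 : 0 ≤ β) (hβ : β * Real.log y ≤ M) {p k : ℕ}
    (hp : p.Prime) (hpy : (p : ℝ) ≤ y) (hk : 1 ≤ k) :
    twist g β (p ^ k) ≤ 2 * c * Real.exp (4 * M / γ) / p * ratio γ ^ k := by
  have hp0 : (0 : ℝ) < p := by exact_mod_cast hp.pos
  have hp2 : (2 : ℝ) ≤ p := by exact_mod_cast hp.two_le
  have hc := hg.const_nonneg
  have hlog : Real.log p ≤ Real.log y := Real.log_le_log hp0 hpy
  have hpow : ((p ^ k : ℕ) : ℝ) ^ β = (p : ℝ) ^ (k * β) := by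
    push_cast
    rw [← Real.rpow_natCast, ← Real.rpow_mul hp0.le]
  have hratio : ratio γ ^ k = (2 : ℝ) ^ (-(γ / 4 * k)) := by
    unfold ratio
    rw [← Real.rpow_natCast, ← Real.rpow_mul (by norm_num)]
    ring_nf
  have hk0 : (1 : ℝ) ≤ k := by exact_mod_cast hk
  unfold twist
  rw [hpow, hratio]
  by_cases hkγ : (k : ℝ) * γ ≤ 4
  · have h1 : (p : ℝ) ^ (k * β) ≤ Real.exp (4 * M / γ) := by
      rw [Real.rpow_def_of_pos hp0]
      apply Real.exp_le_exp.2
      have : (k : ℝ) ≤ 4 / γ := by rw [le_div_iff₀ hγ]; exact hkγ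
      calc Real.log p * (k * β) = k * (β * Real.log p) := by ring
        _ ≤ k * M := by gcongr; exact (by gcongr : β * Real.log p ≤ β * Real.log y).trans hβ
        _ ≤ 4 / γ * M := by gcongr
        _ = _ := by ring
    have h2 : (1 : ℝ) ≤ 2 * (2 : ℝ) ^ (-(γ / 4 * k)) := by
      have : (2 : ℝ) ^ (-1 : ℝ) ≤ (2 : ℝ) ^ (-(γ / 4 * k)) :=
        Real.rpow_le_rpow_of_exponent_le (by norm_num) (by linarith)
      rw [Real.rpow_neg_one] at this
      linarith
    calc g (p ^ k) * (p : ℝ) ^ (k * β) ≤ c / p * Real.exp (4 * M / γ) :=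
          mul_le_mul (hg.le_inv p k hp hk) h1 (by positivity) (by positivity)
      _ ≤ c / p * Real.exp (4 * M / γ) * (2 * (2 : ℝ) ^ (-(γ / 4 * k))) :=
          le_mul_of_one_le_right (by positivity) h2
      _ = _ := by ring
  · push Not at hkγ
    have hexp : 1 ≤ Real.exp (4 * M / γ) := Real.one_le_exp (by positivity)
    have h1 : (p : ℝ) ^ (-(γ * k)) * (p : ℝ) ^ (k * β) ≤ (p : ℝ) ^ (-1 : ℝ) * (p : ℝ) ^ (-(γ / 4 * k)) := by
      rw [← Real.rpow_add hp0, ← Real.rpow_add hp0]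
      apply Real.rpow_le_rpow_of_exponent_le (by linarith)
      have : (k : ℝ) * β ≤ k * (γ / 2) := by gcongr
      linarith
    have h2 : (p : ℝ) ^ (-(γ / 4 * k)) ≤ (2 : ℝ) ^ (-(γ / 4 * k)) :=
      Real.rpow_le_rpow_of_nonpos (by norm_num) hp2 (by
        have : 0 < γ / 4 * k := by positivity
        linarith)
    calc g (p ^ k) * (p : ℝ) ^ (k * β) ≤ c * (p : ℝ) ^ (-(γ * k)) * (p : ℝ) ^ (k * β) := by
          gcongr; exact hg.le_rpow p k hp hk
      _ = c * ((p : ℝ) ^ (-(γ * k)) * (p : ℝ) ^ (k * β)) := by ring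
      _ ≤ c * ((p : ℝ) ^ (-1 : ℝ) * (2 : ℝ) ^ (-(γ / 4 * k))) := by
          exact mul_le_mul_of_nonneg_left (h1.trans
            (mul_le_mul_of_nonneg_left h2 (by positivity))) hc
      _ = 1 * (c / p) * (2 : ℝ) ^ (-(γ / 4 * k)) := by rw [Real.rpow_neg_one]; ring
      _ ≤ (2 * Real.exp (4 * M / γ)) * (c / p) * (2 : ℝ) ^ (-(γ / 4 * k)) := by
          gcongr; linarith
      _ = _ := by ring

lemma Tame.summable_twist {c γ M β y : ℝ} (hγ : 0 < γ) (hM : 0 ≤ M) {g : ℕ → ℝ}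
    (hg : Tame c γ g) (hβγ : β ≤ γ / 2) (hβ0 : 0 ≤ β) (hβ : β * Real.log y ≤ M) {p : ℕ}
    (hp : p.Prime) (hpy : (p : ℝ) ≤ y) : Summable fun k : ℕ => twist g β (p ^ k) := by
  rw [← summable_nat_add_iff 1]
  have hs := (summable_geometric_of_lt_one (ratio_pos γ).le (ratio_lt_one hγ))
  rw [← summable_nat_add_iff 1] at hs
  exact Summable.of_nonneg_of_le (fun k => (hg.toNonnegMul.twist β).nonneg _)
    (fun k => hg.twist_prime_pow_le hγ hM hβγ hβ0 hβ hp hpy (by omega)) (hs.mul_left _)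

lemma twist_zero (g : ℕ → ℝ) : twist g 0 = g := by
  funext n; simp [twist]

lemma Tame.summable {c γ : ℝ} (hγ : 0 < γ) {g : ℕ → ℝ} (hg : Tame c γ g) {p : ℕ}
    (hp : p.Prime) : Summable fun k : ℕ => g (p ^ k) := by
  have := hg.summable_twist (M := 0) (β := 0) (y := p) hγ le_rfl (by linarith) le_rfl (by simp)
    hp le_rfl
  rwa [twist_zero] at this

lemma Tame.one_le_tsum {c γ : ℝ} (hγ : 0 < γ) {g : ℕ → ℝ} (hg : Tame c γ g) {p : ℕ}
    (hp : p.Prime) : 1 ≤ ∑' k : ℕ, g (p ^ k) := by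
  have := (hg.summable hγ hp).le_tsum 0 (fun _ _ => hg.nonneg _)
  rwa [pow_zero, hg.one] at this

lemma Tame.tsum_le {c γ : ℝ} (hγ : 0 < γ) {g : ℕ → ℝ} (hg : Tame c γ g) {p : ℕ}
    (hp : p.Prime) : ∑' k : ℕ, g (p ^ k) ≤ 1 + 2 * c * (1 - ratio γ)⁻¹ / p := by
  rw [(hg.summable hγ hp).tsum_eq_zero_add, pow_zero, hg.one]
  gcongr
  have hs := (hasSum_geometric_of_lt_one (ratio_pos γ).le (ratio_lt_one hγ))
  have hc := hg.const_nonneg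
  have h2 : ∀ k : ℕ, g (p ^ (k + 1)) ≤ 2 * c / p * ratio γ ^ k := by
    intro k
    have := hg.twist_prime_pow_le (M := 0) (β := 0) (y := p) (k := k + 1) hγ le_rfl (by linarith)
      le_rfl (by simp) hp le_rfl (by omega)
    rw [twist_zero] at this
    simp only [mul_zero, zero_div, Real.exp_zero, mul_one] at this
    refine this.trans ?_
    gcongr ?_ * ?_
    rw [pow_succ]
    exact mul_le_of_le_one_right (pow_nonneg (ratio_pos γ).le _) (ratio_lt_one hγ).le
  have h3 := Summable.tsum_le_tsum h2
    ((summable_nat_add_iff 1).2 (hg.summable hγ hp)) (hs.summable.mul_left _)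
  rw [tsum_mul_left, hs.tsum_eq] at h3
  refine h3.trans (le_of_eq ?_)
  ring

lemma Tame.eulerProd_pos {c γ : ℝ} (hγ : 0 < γ) {g : ℕ → ℝ} (hg : Tame c γ g) (y : ℝ) :
    0 < eulerProd g y :=
  Finset.prod_pos fun _ hp => lt_of_lt_of_le one_pos
    (hg.one_le_tsum hγ ((mem_primesIoc le_rfl).1 hp).1)

/-- Twisting by `n ^ β` with `β ≪ 1 / log y` changes the Euler product up to `y` by a bounded
factor. -/
lemma exists_eulerProd_twist_le (c γ M : ℝ) (hc : 0 ≤ c) (hγ : 0 < γ) (hM : 0 ≤ M) :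
    ∃ K : ℝ, 0 < K ∧ ∀ (g : ℕ → ℝ), Tame c γ g → ∀ (β y : ℝ), 1 ≤ y → 0 ≤ β → β ≤ γ / 2 →
      β * Real.log y ≤ M → eulerProd (twist g β) y ≤ K * eulerProd g y := by
  obtain ⟨K₁, hK₁, h₁⟩ := exists_sum_one_add_log_div_le
  set K₂ := 2 * c * Real.exp (4 * M / γ) with hK₂
  have hK₂0 : 0 ≤ K₂ := by positivity
  have hsum : Summable fun k : ℕ => (k : ℝ) * ratio γ ^ k := by
    have := summable_pow_mul_geometric_of_norm_lt_one (R := ℝ) 1 (r := ratio γ)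
      (by rw [Real.norm_eq_abs, abs_of_pos (ratio_pos γ)]; exact ratio_lt_one hγ)
    simpa using this
  set S := ∑' k : ℕ, (k : ℝ) * ratio γ ^ k with hS
  have hS0 : 0 ≤ S := tsum_nonneg fun k => mul_nonneg (by positivity) (pow_nonneg (ratio_pos γ).le _)
  refine ⟨Real.exp (K₂ * S * (K₁ * (γ / 2 + M))), Real.exp_pos _, ?_⟩
  intro g hg β y hy hβ0 hβγ hβ
  have hloc : ∀ p ∈ primesIoc 0 y, ∑' k : ℕ, twist g β (p ^ k) ≤
      (∑' k : ℕ, g (p ^ k)) * Real.exp (K₂ * S * (β * ((1 + Real.log p) / p))) := by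
    intro p hp
    obtain ⟨hp, -, hpy⟩ := (mem_primesIoc le_rfl).1 hp
    have hp0 : (0 : ℝ) < p := by exact_mod_cast hp.pos
    have hlog : 0 ≤ Real.log p := Real.log_natCast_nonneg p
    have hs1 := hg.summable_twist hγ hM hβγ hβ0 hβ hp hpy
    have hs2 := hg.summable hγ hp
    -- By `e ^ x - 1 ≤ x e ^ x` the twist changes a term by at most `kβ log p` times the twisted
    -- term. The effect is thus linear in `β`, which lets `∑ (log p) / p ≪ 1 + log y` bound the
    -- total.
    have hpt : ∀ k : ℕ, twist g β (p ^ k) ≤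
        g (p ^ k) + K₂ / p * (β * Real.log p) * ((k : ℝ) * ratio γ ^ k) := by
      intro k
      rcases Nat.eq_zero_or_pos k with rfl | hk
      · simp [twist]
      · have h3 := hg.twist_prime_pow_le hγ hM hβγ hβ0 hβ hp hpy hk
        have hx : ((p ^ k : ℕ) : ℝ) ^ β = Real.exp (k * (β * Real.log p)) := by
          push_cast
          rw [← Real.rpow_natCast, ← Real.rpow_mul hp0.le, Real.rpow_def_of_pos hp0]
          ring_nf
        set x := k * (β * Real.log p) with hxdef
        have hx0 : 0 ≤ x := by positivity
        have h4 : Real.exp x - 1 ≤ x * Real.exp x := by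
          have h5 := Real.add_one_le_exp (-x)
          have h6 : Real.exp (-x) * Real.exp x = 1 := by rw [← Real.exp_add]; simp
          nlinarith [Real.exp_pos x]
        have h7 : twist g β (p ^ k) - g (p ^ k) ≤ x * twist g β (p ^ k) := by
          unfold twist
          rw [hx]
          have := hg.nonneg (p ^ k)
          nlinarith
        have h8 : x * twist g β (p ^ k) ≤ x * (K₂ / p * ratio γ ^ k) := by gcongr
        calc twist g β (p ^ k) ≤ g (p ^ k) + x * (K₂ / p * ratio γ ^ k) := by linarith
          _ = _ := by rw [hxdef]; ring
    have h9 := Summable.tsum_le_tsum hpt hs1 (hs2.add (hsum.mul_left _))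
    rw [(hs2.tsum_add (hsum.mul_left _)), tsum_mul_left, ← hS] at h9
    have h10 := hg.one_le_tsum hγ hp
    refine h9.trans ?_
    have h11 : K₂ / p * (β * Real.log p) * S ≤ K₂ * S * (β * ((1 + Real.log p) / p)) := by
      calc K₂ / p * (β * Real.log p) * S = K₂ * S * (β * (Real.log p / p)) := by ring
        _ ≤ _ := by gcongr; linarith
    set u := K₂ * S * (β * ((1 + Real.log p) / p)) with hu
    have hu0 : 0 ≤ u := by positivity
    have h12 := Real.add_one_le_exp u
    nlinarith
  calc eulerProd (twist g β) y ≤ ∏ p ∈ primesIoc 0 y,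
        ((∑' k : ℕ, g (p ^ k)) * Real.exp (K₂ * S * (β * ((1 + Real.log p) / p)))) := by
        apply Finset.prod_le_prod
        · intro _ _
          exact tsum_nonneg fun k => (hg.toNonnegMul.twist β).nonneg _
        · exact hloc
    _ = Real.exp (K₂ * S * (β * ∑ p ∈ primesIoc 0 y, (1 + Real.log p) / p)) * eulerProd g y := by
        rw [Finset.prod_mul_distrib, ← Real.exp_sum, mul_comm]
        congr 2
        rw [Finset.mul_sum, Finset.mul_sum]
    _ ≤ _ := by
        have hE := (hg.eulerProd_pos hγ y).le
        have h2 := h₁ y hy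
        refine mul_le_mul_of_nonneg_right (Real.exp_le_exp.2
          (mul_le_mul_of_nonneg_left ?_ (by positivity))) hE
        calc β * ∑ p ∈ primesIoc 0 y, (1 + Real.log p) / p ≤ β * (K₁ * (1 + Real.log y)) := by gcongr
          _ = K₁ * (β + β * Real.log y) := by ring
          _ ≤ _ := by gcongr

/-- Rankin's trick. -/
lemma exists_sum_le_rankin (c γ M : ℝ) (hc : 0 ≤ c) (hγ : 0 < γ) (hM : 0 ≤ M) :
    ∃ K : ℝ, 0 < K ∧ ∀ (g : ℕ → ℝ), Tame c γ g → ∀ (β y T : ℝ), 1 ≤ y → 0 ≤ β → β ≤ γ / 2 →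
      β * Real.log y ≤ M → 0 < T → ∀ S : Finset ℕ,
      (∀ a ∈ S, a ≠ 0 ∧ T ≤ a ∧ ∀ p : ℕ, p.Prime → p ∣ a → (p : ℝ) ≤ y) →
      ∑ a ∈ S, g a ≤ K * T ^ (-β) * eulerProd g y := by
  obtain ⟨K, hK, h⟩ := exists_eulerProd_twist_le c γ M hc hγ hM
  refine ⟨K, hK, fun g hg β y T hy hβ0 hβγ hβ hT S hS => ?_⟩
  have h1 := h g hg β y hy hβ0 hβγ hβ
  have h2 : ∑ a ∈ S, twist g β a ≤ eulerProd (twist g β) y := by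
    apply (hg.toNonnegMul.twist β).sum_le_eulerProd
    · intro p hp
      obtain ⟨hp, -, hpy⟩ := (mem_primesIoc le_rfl).1 hp
      exact hg.summable_twist hγ hM hβγ hβ0 hβ hp hpy
    · exact fun a ha => ⟨(hS a ha).1, (hS a ha).2.2⟩
  calc ∑ a ∈ S, g a ≤ ∑ a ∈ S, T ^ (-β) * twist g β a := by
        apply Finset.sum_le_sum
        intro a ha
        have h3 : T ^ β ≤ (a : ℝ) ^ β := Real.rpow_le_rpow hT.le (hS a ha).2.1 hβ0
        have h4 : 1 ≤ T ^ (-β) * (a : ℝ) ^ β := by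
          rw [Real.rpow_neg hT.le, inv_mul_eq_div, one_le_div (by positivity)]
          exact h3
        have := hg.nonneg a
        unfold twist
        calc g a = g a * 1 := (mul_one _).symm
          _ ≤ g a * (T ^ (-β) * (a : ℝ) ^ β) := by gcongr
          _ = _ := by ring
    _ = T ^ (-β) * ∑ a ∈ S, twist g β a := by rw [Finset.mul_sum]
    _ ≤ T ^ (-β) * (K * eulerProd g y) := by gcongr; exact h2.trans h1
    _ = _ := by ring

lemma primesIoc_zero_eq_one (X : ℝ) : primesIoc 0 X = primesIoc 1 X := by
  ext p
  rw [mem_primesIoc le_rfl, mem_primesIoc zero_le_one]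
  refine and_congr_right fun hp => and_congr_left fun _ => ?_
  have h1 : (0 : ℝ) < p := by exact_mod_cast hp.pos
  have h2 : (1 : ℝ) < p := by exact_mod_cast hp.one_lt
  exact ⟨fun _ => h2, fun _ => h1⟩

lemma prod_primesIoc_mul_prod {w y X : ℝ} (hw : 0 ≤ w) (hwy : w ≤ y) (hyX : y ≤ X) (F : ℕ → ℝ) :
    (∏ p ∈ primesIoc w y, F p) * ∏ p ∈ primesIoc y X, F p = ∏ p ∈ primesIoc w X, F p := by
  rw [← Finset.prod_union]
  · congr 1
    ext p
    rw [Finset.mem_union, mem_primesIoc hw, mem_primesIoc hw, mem_primesIoc (hw.trans hwy)]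
    constructor
    · rintro (⟨h1, h2, h3⟩ | ⟨h1, h2, h3⟩)
      exacts [⟨h1, h2, h3.trans hyX⟩, ⟨h1, hwy.trans_lt h2, h3⟩]
    · rintro ⟨h1, h2, h3⟩
      by_cases h : (p : ℝ) ≤ y
      exacts [Or.inl ⟨h1, h2, h⟩, Or.inr ⟨h1, not_le.1 h, h3⟩]
  · rw [Finset.disjoint_left]
    intro p hp hp'
    have h1 := ((mem_primesIoc hw).1 hp).2.2
    have h2 := ((mem_primesIoc (hw.trans hwy)).1 hp').2.1
    linarith

lemma Tame.eulerProd_mono {c γ : ℝ} (hγ : 0 < γ) {g : ℕ → ℝ} (hg : Tame c γ g) {y X : ℝ}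
    (hy : 0 ≤ y) (hyX : y ≤ X) : eulerProd g y ≤ eulerProd g X := by
  unfold eulerProd
  rw [← prod_primesIoc_mul_prod le_rfl hy hyX]
  apply le_mul_of_one_le_right (hg.eulerProd_pos hγ y).le
  have : ∏ p ∈ primesIoc y X, (1 : ℝ) ≤ ∏ p ∈ primesIoc y X, ∑' k : ℕ, g (p ^ k) :=
    Finset.prod_le_prod (fun _ _ => zero_le_one)
      (fun p hp => hg.one_le_tsum hγ ((mem_primesIoc hy).1 hp).1)
  simpa using this

/-- The Euler product of a tame function up to `X` is bounded by its sum up to `X`. -/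
lemma exists_eulerProd_le_sum (c γ : ℝ) (hc : 0 ≤ c) (hγ : 0 < γ) :
    ∃ K : ℝ, 0 < K ∧ ∀ (g : ℕ → ℝ), Tame c γ g → ∀ X : ℝ, 1 ≤ X →
      eulerProd g X ≤ K * ∑ a ∈ Finset.Icc 1 ⌊X⌋₊, g a := by
  obtain ⟨K, hK, hK'⟩ := exists_eulerProd_twist_le c γ 1 hc hγ zero_le_one
  have hr : 0 < 1 - ratio γ := by linarith [ratio_lt_one hγ]
  obtain ⟨Λ, hΛ, hΛ'⟩ := exists_prod_one_add_div_le (2 * c * (1 - ratio γ)⁻¹) (by positivity)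
  -- `s` is the ratio `log X / log y`. With `β = 1 / log y` it makes `X ^ (-β) = e ^ (-s) ≤ 1/(2K)`,
  -- so Rankin's bound for the terms beyond `X` is at most half of the Euler product up to `y`.
  obtain ⟨s, hs⟩ := exists_nat_gt (max 1 (2 * K))
  have hs1 : 1 < (s : ℝ) := (le_max_left _ _).trans_lt hs
  have hs2 : 2 * K < s := (le_max_right _ _).trans_lt hs
  have h2s : (s : ℝ) ≤ 2 ^ s := by exact_mod_cast Nat.lt_two_pow_self.le
  -- `i` serves the range of bounded `X`, where `1 / log y ≤ γ/2` would fail. There the whole Euler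
  -- product is bounded and the sum is at least its term at `a = 1`.
  obtain ⟨i, hi⟩ := pow_unbounded_of_one_lt (1 + s * (2 / γ)) (one_lt_two (α := ℝ))
  refine ⟨2 * Λ ^ s + Λ ^ i, by positivity, fun g hg X hX => ?_⟩
  have hlX : 0 ≤ Real.log X := Real.log_nonneg hX
  have hsum1 : 1 ≤ ∑ a ∈ Finset.Icc 1 ⌊X⌋₊, g a := by
    have h1 : 1 ∈ Finset.Icc 1 ⌊X⌋₊ := by
      rw [Finset.mem_Icc]; exact ⟨le_rfl, (Nat.one_le_floor_iff X).2 hX⟩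
    have := Finset.single_le_sum (fun a _ => hg.nonneg a) h1
    rwa [hg.one] at this
  have htail : ∀ y : ℝ, 0 ≤ y → ∏ p ∈ primesIoc y X, ∑' k : ℕ, g (p ^ k) ≤
      ∏ p ∈ primesIoc y X, (1 + 2 * c * (1 - ratio γ)⁻¹ / p) := by
    intro y hy
    apply Finset.prod_le_prod
    · intro p _
      exact tsum_nonneg fun k => hg.nonneg _
    · intro p hp
      exact hg.tsum_le hγ ((mem_primesIoc hy).1 hp).1
  by_cases hlog : s * (2 / γ) ≤ Real.log X
  · set y := Real.exp (Real.log X / s) with hy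
    have hly : Real.log y = Real.log X / s := Real.log_exp _
    have hs0 : (0 : ℝ) < s := by linarith
    have hly0 : 2 / γ ≤ Real.log y := by
      rw [hly, le_div_iff₀ hs0]; linarith
    have hly1 : 0 < Real.log y := lt_of_lt_of_le (by positivity) hly0
    have hy1 : 1 ≤ y := Real.one_le_exp (by positivity)
    have hyX : y ≤ X := by
      rw [← Real.exp_log (by linarith : 0 < X), hy]
      apply Real.exp_le_exp.2
      exact div_le_self hlX hs1.le
    set β := 1 / Real.log y with hβ
    have hβ0 : 0 ≤ β := by positivity
    have hβγ : β ≤ γ / 2 := by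
      rw [hβ, one_div_le hly1 (by positivity), one_div_div]; exact hly0
    have hβ1 : β * Real.log y ≤ 1 := by rw [hβ, one_div_mul_cancel hly1.ne']
    have hXβ : X ^ (-β) ≤ 1 / (2 * K) := by
      rw [Real.rpow_def_of_pos (by linarith)]
      have h1 : Real.log X * -β = -s := by
        rw [hβ, hly]
        have : Real.log X ≠ 0 := by
          intro h0
          rw [hly, h0] at hly1
          simp at hly1
        field_simp
      rw [h1, Real.exp_neg, ← one_div]
      apply one_div_le_one_div_of_le (by positivity)
      linarith [Real.add_one_le_exp (s : ℝ)]
    have hEy : eulerProd g y ≤ 2 * ∑ a ∈ Finset.Icc 1 ⌊X⌋₊, g a := by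
      have htw := hK' g hg β y hy1 hβ0 hβγ hβ1
      have hE0 := hg.eulerProd_pos hγ y
      have hbound : eulerProd g y ≤
          ∑ a ∈ Finset.Icc 1 ⌊X⌋₊, g a + X ^ (-β) * eulerProd (twist g β) y := by
        refine hasSum_le_of_sum_le (hg.toNonnegMul.hasSum_eulerProd
          (fun p hp => hg.summable hγ ((mem_primesIoc le_rfl).1 hp).1)) ?_
        intro S
        have hsplit : ∀ m : Nat.factoredNumbers (primesIoc 0 y), g m ≤
            (if (m : ℕ) ∈ Finset.Icc 1 ⌊X⌋₊ then g m else 0) + X ^ (-β) * twist g β m := by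
          intro m
          have hgm := hg.nonneg m
          have htm := (hg.toNonnegMul.twist β).nonneg m
          have hX0 : 0 ≤ X ^ (-β) := by positivity
          split_ifs with hm
          · have := mul_nonneg hX0 htm
            linarith
          · have hm0 : (m : ℕ) ≠ 0 := Nat.ne_zero_of_mem_factoredNumbers m.2
            rw [Finset.mem_Icc, not_and] at hm
            have hmX : X ≤ (m : ℕ) := by
              have := hm (Nat.one_le_iff_ne_zero.2 hm0)
              exact ((Nat.floor_lt (by linarith)).1 (not_le.1 this)).le
            have h3 : X ^ β ≤ ((m : ℕ) : ℝ) ^ β := Real.rpow_le_rpow (by linarith) hmX hβ0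
            have h4 : 1 ≤ X ^ (-β) * ((m : ℕ) : ℝ) ^ β := by
              rw [Real.rpow_neg (by linarith), inv_mul_eq_div, one_le_div (by positivity)]
              exact h3
            unfold twist
            rw [zero_add]
            calc g m = g m * 1 := (mul_one _).symm
              _ ≤ g m * (X ^ (-β) * ((m : ℕ) : ℝ) ^ β) := by gcongr
              _ = _ := by ring
        refine (Finset.sum_le_sum fun m _ => hsplit m).trans ?_
        rw [Finset.sum_add_distrib, ← Finset.mul_sum]
        have hinj : Function.Injective (fun m : Nat.factoredNumbers (primesIoc 0 y) => (m : ℕ)) :=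
          Subtype.val_injective
        gcongr ?_ + _ * ?_
        · set T : Finset ℕ := S.map ⟨_, hinj⟩ with hT
          have h7 : ∑ m ∈ S, (if (m : ℕ) ∈ Finset.Icc 1 ⌊X⌋₊ then g m else 0) =
              ∑ a ∈ T, (if a ∈ Finset.Icc 1 ⌊X⌋₊ then g a else 0) := by
            rw [hT, Finset.sum_map]; rfl
          rw [h7, ← Finset.sum_filter]
          apply Finset.sum_le_sum_of_subset_of_nonneg
          · exact fun a ha => (Finset.mem_filter.1 ha).2
          · exact fun a _ _ => hg.nonneg a
        · refine sum_le_hasSum _ (fun m _ => (hg.toNonnegMul.twist β).nonneg m)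
            ((hg.toNonnegMul.twist β).hasSum_eulerProd ?_)
          intro p hp
          obtain ⟨hp, -, hpy⟩ := (mem_primesIoc le_rfl).1 hp
          exact hg.summable_twist hγ zero_le_one hβγ hβ0 hβ1 hp hpy
      have h5 : X ^ (-β) * eulerProd (twist g β) y ≤ 1 / (2 * K) * (K * eulerProd g y) :=
        mul_le_mul hXβ htw (Finset.prod_nonneg fun p _ => tsum_nonneg fun k =>
          (hg.toNonnegMul.twist β).nonneg _) (by positivity)
      have h6 : 1 / (2 * K) * (K * eulerProd g y) = eulerProd g y / 2 := by field_simp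
      linarith
    have htl := (htail y (by linarith)).trans (hΛ' s y X hy1 hX (by
      have : Real.log X = s * Real.log y := by rw [hly]; field_simp
      rw [this]
      nlinarith [one_le_pow₀ (one_le_two (α := ℝ)) (n := s)]))
    have hsplit : eulerProd g X = eulerProd g y * ∏ p ∈ primesIoc y X, ∑' k : ℕ, g (p ^ k) :=
      (prod_primesIoc_mul_prod le_rfl (by linarith) hyX _).symm
    rw [hsplit]
    calc eulerProd g y * ∏ p ∈ primesIoc y X, ∑' k : ℕ, g (p ^ k)
        ≤ (2 * ∑ a ∈ Finset.Icc 1 ⌊X⌋₊, g a) * Λ ^ s :=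
          mul_le_mul hEy htl (Finset.prod_nonneg fun p _ => tsum_nonneg fun k => hg.nonneg _)
            (by positivity)
      _ ≤ _ := by
          have : 0 ≤ Λ ^ i * ∑ a ∈ Finset.Icc 1 ⌊X⌋₊, g a := by positivity
          nlinarith
  · push Not at hlog
    have h1 := (htail 1 zero_le_one).trans (hΛ' i 1 X le_rfl hX (by
      rw [Real.log_one, add_zero, mul_one]; linarith))
    rw [← primesIoc_zero_eq_one] at h1
    calc eulerProd g X ≤ Λ ^ i := h1
      _ ≤ (2 * Λ ^ s + Λ ^ i) * 1 := by
          have : 0 ≤ Λ ^ s := by positivity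
          linarith
      _ ≤ _ := by gcongr

/-! ### The correction factor at the primes dividing the modulus -/

/-- The local factor `(1 - d / p)⁻¹` for `p > d`, and `1` otherwise. -/
noncomputable def localFactor (d p : ℕ) : ℝ := if d < p then (1 - (d : ℝ) / p)⁻¹ else 1

lemma one_le_localFactor (d p : ℕ) : 1 ≤ localFactor d p := by
  unfold localFactor
  split_ifs with h
  · have hp : (0 : ℝ) < p := by exact_mod_cast (Nat.zero_le d).trans_lt h
    have h1 : (d : ℝ) / p < 1 := by rw [div_lt_one hp]; exact_mod_cast h
    have h2 : 0 ≤ (d : ℝ) / p := by positivity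
    rw [one_le_inv₀ (by linarith)]
    linarith
  · exact le_rfl

/-- For `p > d` the factor is `1 + d/(p - d)`, and `p ≤ (d + 1)(p - d)`. -/
lemma localFactor_le (d p : ℕ) : localFactor d p ≤ 1 + (d * (d + 1) : ℝ) / p := by
  unfold localFactor
  split_ifs with h
  · have hp : (0 : ℝ) < p := by exact_mod_cast (Nat.zero_le d).trans_lt h
    have hdp : (d : ℝ) + 1 ≤ p := by exact_mod_cast h
    have hd : (0 : ℝ) ≤ d := by positivity
    rw [inv_le_iff_one_le_mul₀ (by rw [sub_pos, div_lt_one hp]; linarith)]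
    rw [← sub_nonneg]
    have : (1 + (d * (d + 1) : ℝ) / p) * (1 - d / p) - 1 = d * (d * (p - (d + 1))) / p ^ 2 := by
      field_simp; ring
    rw [this]
    have : 0 ≤ (p : ℝ) - (d + 1) := by linarith
    positivity
  · have : 0 ≤ (d * (d + 1) : ℝ) / p := by positivity
    linarith

/-- The product of the local factors over the primes dividing `a`. -/
noncomputable def correction (d a : ℕ) : ℝ := ∏ p ∈ a.primeFactors, localFactor d p

lemma correction_nonneg (d a : ℕ) : 0 ≤ correction d a :=
  Finset.prod_nonneg fun p _ => zero_le_one.trans (one_le_localFactor d p)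

lemma correction_prime_pow (d : ℕ) {p k : ℕ} (hp : p.Prime) (hk : k ≠ 0) :
    correction d (p ^ k) = localFactor d p := by
  unfold correction
  rw [Nat.primeFactors_prime_pow hk hp, Finset.prod_singleton]

lemma Tame.mul_correction {c γ : ℝ} {g : ℕ → ℝ} (hg : Tame c γ g) (d : ℕ) :
    Tame (c * (1 + d * (d + 1))) γ (fun n => g n * correction d n) := by
  have hc := hg.const_nonneg
  have hloc : ∀ p : ℕ, p.Prime → localFactor d p ≤ 1 + d * (d + 1) := by
    intro p hp
    refine (localFactor_le d p).trans ?_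
    gcongr
    apply div_le_self (by positivity)
    exact_mod_cast hp.one_le
  have h0 : ∀ p, 0 ≤ localFactor d p := fun p => zero_le_one.trans (one_le_localFactor d p)
  refine ⟨⟨?_, ?_, ?_⟩, ?_, ?_⟩
  · simp [hg.one, correction]
  · exact fun n => mul_nonneg (hg.nonneg n) (correction_nonneg d n)
  · intro m n hmn
    have : correction d (m * n) = correction d m * correction d n := by
      unfold correction
      rw [hmn.primeFactors_mul, Finset.prod_union hmn.disjoint_primeFactors]
    simp only [this, hg.mul m n hmn]
    ring
  · intro p k hp hk
    simp only [correction_prime_pow d hp (by omega : k ≠ 0)]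
    calc g (p ^ k) * localFactor d p ≤ c / p * (1 + d * (d + 1)) :=
          mul_le_mul (hg.le_inv p k hp hk) (hloc p hp) (h0 p) (by positivity)
      _ = _ := by ring
  · intro p k hp hk
    simp only [correction_prime_pow d hp (by omega : k ≠ 0)]
    calc g (p ^ k) * localFactor d p ≤ c * (p : ℝ) ^ (-(γ * k)) * (1 + d * (d + 1)) :=
          mul_le_mul (hg.le_rpow p k hp hk) (hloc p hp) (h0 p) (by positivity)
      _ = _ := by ring

/-- The correction affects only the terms `k ≥ 1` of a local factor. These total `O(1/p)` and change
by a relative `O(1/p)`, so the local factor grows by at most `exp(O(1/p ^ 2))`. -/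
lemma exists_eulerProd_mul_correction_le (c γ : ℝ) (d : ℕ) (hc : 0 ≤ c) (hγ : 0 < γ) :
    ∃ K : ℝ, 0 < K ∧ ∀ (g : ℕ → ℝ), Tame c γ g → ∀ y : ℝ,
      eulerProd (fun n => g n * correction d n) y ≤ K * eulerProd g y := by
  have hr : 0 < 1 - ratio γ := by linarith [ratio_lt_one hγ]
  set e : ℝ := (d * (d + 1)) * (2 * c * (1 - ratio γ)⁻¹) with he
  have he0 : 0 ≤ e := by positivity
  have hs2 : Summable fun n : ℕ => 1 / (n : ℝ) ^ 2 := Real.summable_one_div_nat_pow.2 one_lt_two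
  refine ⟨Real.exp (e * ∑' n : ℕ, 1 / (n : ℝ) ^ 2), Real.exp_pos _, fun g hg y => ?_⟩
  have hloc : ∀ p ∈ primesIoc 0 y, ∑' k : ℕ, g (p ^ k) * correction d (p ^ k) ≤
      (∑' k : ℕ, g (p ^ k)) * Real.exp (e * (1 / (p : ℝ) ^ 2)) := by
    intro p hp
    obtain ⟨hp, -, hpy⟩ := (mem_primesIoc le_rfl).1 hp
    have hp0 : (0 : ℝ) < p := by exact_mod_cast hp.pos
    have h1 := hg.summable hγ hp
    have h2 := (hg.mul_correction d).summable hγ hp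
    have h3 := hg.tsum_le hγ hp
    have h4 := hg.one_le_tsum hγ hp
    rw [h2.tsum_eq_zero_add]
    rw [h1.tsum_eq_zero_add] at h3 h4 ⊢
    simp only [pow_zero, hg.one, correction_prime_pow d hp (Nat.succ_ne_zero _), tsum_mul_right]
      at h3 h4 ⊢
    have h5 : correction d 1 = 1 := by simp [correction]
    rw [h5]
    set t := ∑' k : ℕ, g (p ^ (k + 1)) with ht
    have h6 : t * localFactor d p ≤ t + e * (1 / (p : ℝ) ^ 2) := by
      calc t * localFactor d p ≤ t * (1 + (d * (d + 1) : ℝ) / p) := by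
            apply mul_le_mul_of_nonneg_left (localFactor_le d p); linarith
        _ = t + (d * (d + 1) : ℝ) / p * t := by ring
        _ ≤ t + (d * (d + 1) : ℝ) / p * (2 * c * (1 - ratio γ)⁻¹ / p) := by
            gcongr; linarith
        _ = _ := by rw [he]; field_simp
    have h7 := Real.add_one_le_exp (e * (1 / (p : ℝ) ^ 2))
    have h8 : 0 ≤ e * (1 / (p : ℝ) ^ 2) := by positivity
    nlinarith
  calc eulerProd (fun n => g n * correction d n) y ≤ ∏ p ∈ primesIoc 0 y,
        ((∑' k : ℕ, g (p ^ k)) * Real.exp (e * (1 / (p : ℝ) ^ 2))) := by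
        apply Finset.prod_le_prod
        · intro p _
          exact tsum_nonneg fun k => mul_nonneg (hg.nonneg _) (correction_nonneg d _)
        · exact hloc
    _ = Real.exp (e * ∑ p ∈ primesIoc 0 y, 1 / (p : ℝ) ^ 2) * eulerProd g y := by
        rw [Finset.prod_mul_distrib, ← Real.exp_sum, mul_comm]
        congr 2
        rw [Finset.mul_sum]
    _ ≤ _ := by
        refine mul_le_mul_of_nonneg_right (Real.exp_le_exp.2
          (mul_le_mul_of_nonneg_left ?_ he0)) (hg.eulerProd_pos hγ y).le
        exact hs2.sum_le_tsum _ (fun _ _ => by positivity)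

/-! ### Selberg's sieve -/

section Selberg

variable {α : Type*}

/-- Independent random subsets of `P` containing `p` with probability `g p`. -/
lemma sum_powerset_prod_ite (P : Finset ℕ) (g : ℕ → ℝ) (a b : ℕ → ℝ) :
    ∑ S ∈ P.powerset, ((∏ p ∈ S, g p) * ∏ p ∈ P \ S, (1 - g p)) *
        ∏ p ∈ P, (if p ∈ S then a p else b p) =
      ∏ p ∈ P, (g p * a p + (1 - g p) * b p) := by
  rw [Finset.prod_add]
  refine Finset.sum_congr rfl fun S hS => ?_
  have hSP := Finset.mem_powerset.1 hS
  rw [← Finset.prod_sdiff hSP, Finset.prod_mul_distrib, Finset.prod_mul_distrib]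
  have h1 : ∏ p ∈ S, (if p ∈ S then a p else b p) = ∏ p ∈ S, a p :=
    Finset.prod_congr rfl fun p hp => if_pos hp
  have h2 : ∏ p ∈ P \ S, (if p ∈ S then a p else b p) = ∏ p ∈ P \ S, b p :=
    Finset.prod_congr rfl fun p hp => if_neg (Finset.mem_sdiff.1 hp).2
  rw [h1, h2]
  ring

/-- The probability that the random subset contains `T`. It is the model for the proportion of
points `v` with `B v p` for all `p ∈ T`. -/
lemma sum_powerset_subset (P : Finset ℕ) (g : ℕ → ℝ) {T : Finset ℕ} (hT : T ⊆ P) :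
    ∑ S ∈ P.powerset, ((∏ p ∈ S, g p) * ∏ p ∈ P \ S, (1 - g p)) * (if T ⊆ S then 1 else 0) =
      ∏ p ∈ T, g p := by
  have h := sum_powerset_prod_ite P g (fun _ => 1) (fun p => if p ∈ T then 0 else 1)
  have h1 : ∀ S : Finset ℕ, ∏ p ∈ P, (if p ∈ S then (1 : ℝ) else if p ∈ T then 0 else 1) =
      if T ⊆ S then 1 else 0 := by
    intro S
    split_ifs with hTS
    · apply Finset.prod_eq_one
      intro p _
      by_cases hpS : p ∈ S
      · simp [hpS]
      · have hpT : p ∉ T := fun hpT => hpS (hTS hpT)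
        simp [hpS, hpT]
    · obtain ⟨p, hpT, hpS⟩ := Finset.not_subset.1 hTS
      exact Finset.prod_eq_zero (hT hpT) (by simp [hpT, hpS])
  simp only [h1] at h
  rw [h, ← Finset.prod_sdiff hT]
  have h2 : ∏ p ∈ P \ T, (g p * 1 + (1 - g p) * (if p ∈ T then (0 : ℝ) else 1)) = 1 := by
    apply Finset.prod_eq_one
    intro p hp
    rw [if_neg (Finset.mem_sdiff.1 hp).2]; ring
  rw [h2, one_mul]
  refine Finset.prod_congr rfl fun p hp => ?_
  rw [if_pos hp]; ring

/-- The factor `h_p - (1 + h_p) 1_{p ∈ S}`, where `h_p = g_p / (1 - g_p)`. -/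
noncomputable def sieveFactor (g : ℕ → ℝ) (S : Finset ℕ) (p : ℕ) : ℝ :=
  if p ∈ S then -1 else g p / (1 - g p)

/-- The factors at distinct primes are independent, with mean `-g + (1 - g) h = 0` and second moment
`g + (1 - g) h ^ 2 = h`, where `h = g / (1 - g)`. Products over different sets are therefore
orthogonal. This is what diagonalizes Selberg's quadratic form. -/
lemma sum_powerset_sieveFactor (P : Finset ℕ) (g : ℕ → ℝ) (hg : ∀ p ∈ P, g p < 1)
    {U V : Finset ℕ} (hU : U ⊆ P) (hV : V ⊆ P) :
    ∑ S ∈ P.powerset, ((∏ p ∈ S, g p) * ∏ p ∈ P \ S, (1 - g p)) *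
        ((∏ p ∈ U, sieveFactor g S p) * ∏ p ∈ V, sieveFactor g S p) =
      if U = V then ∏ p ∈ U, g p / (1 - g p) else 0 := by
  have h := sum_powerset_prod_ite P g
    (fun p => (if p ∈ U then -1 else 1) * (if p ∈ V then -1 else 1))
    (fun p => (if p ∈ U then g p / (1 - g p) else 1) * (if p ∈ V then g p / (1 - g p) else 1))
  have h1 : ∀ S : Finset ℕ, ∏ p ∈ P, (if p ∈ S then
      ((if p ∈ U then (-1 : ℝ) else 1) * (if p ∈ V then -1 else 1)) else
      ((if p ∈ U then g p / (1 - g p) else 1) * (if p ∈ V then g p / (1 - g p) else 1))) =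
      (∏ p ∈ U, sieveFactor g S p) * ∏ p ∈ V, sieveFactor g S p := by
    intro S
    have h2 : ∀ W : Finset ℕ, W ⊆ P → ∏ p ∈ W, sieveFactor g S p =
        ∏ p ∈ P, if p ∈ W then sieveFactor g S p else 1 := by
      intro W hW
      rw [Finset.prod_ite_mem, Finset.inter_eq_right.2 hW]
    rw [h2 U hU, h2 V hV, ← Finset.prod_mul_distrib]
    refine Finset.prod_congr rfl fun p _ => ?_
    unfold sieveFactor
    split_ifs <;> rfl
  simp only [h1] at h
  rw [h]
  split_ifs with hUV
  · subst hUV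
    rw [← Finset.prod_sdiff hU]
    have h3 : ∏ p ∈ P \ U, (g p * ((if p ∈ U then (-1 : ℝ) else 1) * (if p ∈ U then -1 else 1)) +
        (1 - g p) * ((if p ∈ U then g p / (1 - g p) else 1) *
          (if p ∈ U then g p / (1 - g p) else 1))) = 1 := by
      apply Finset.prod_eq_one
      intro p hp
      simp only [if_neg (Finset.mem_sdiff.1 hp).2]; ring
    rw [h3, one_mul]
    refine Finset.prod_congr rfl fun p hp => ?_
    have : 1 - g p ≠ 0 := by have := hg p (hU hp); linarith
    simp only [if_pos hp]
    field_simp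
    ring
  · have hex : ∃ p ∈ P, ¬(p ∈ U ↔ p ∈ V) := by
      by_contra hcon
      push Not at hcon
      apply hUV
      ext p
      by_cases hp : p ∈ P
      · exact hcon p hp
      · exact ⟨fun h => absurd (hU h) hp, fun h => absurd (hV h) hp⟩
    obtain ⟨p, hp, hpUV⟩ := hex
    apply Finset.prod_eq_zero hp
    have : 1 - g p ≠ 0 := by have := hg p hp; linarith
    by_cases h1 : p ∈ U <;> by_cases h2 : p ∈ V
    · simp [h1, h2] at hpUV
    · simp only [h1, h2, if_true, if_false]; field_simp; ring
    · simp only [h1, h2, if_true, if_false]; field_simp; ring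
    · simp [h1, h2] at hpUV

variable (P : Finset ℕ) (g : ℕ → ℝ) (𝒟 : Finset (Finset ℕ))

/-- The coefficients of Selberg's sieve, without the normalization. -/
noncomputable def selbergWeight (T : Finset ℕ) : ℝ :=
  ∑ U ∈ 𝒟 with T ⊆ U, (∏ p ∈ T, (-1 - g p / (1 - g p))) * ∏ p ∈ U \ T, g p / (1 - g p)

/-- Expand each product after writing its factors as `h_p - (1 + h_p) 1_{p ∈ S}`, and collect the
coefficient of the event `T ⊆ S`. Closure of `𝒟` under subsets keeps all `T` inside `𝒟`. -/
lemma sum_prod_sieveFactor (hdown : ∀ U ∈ 𝒟, ∀ T ⊆ U, T ∈ 𝒟) (S : Finset ℕ) :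
    ∑ U ∈ 𝒟, ∏ p ∈ U, sieveFactor g S p =
      ∑ T ∈ 𝒟, selbergWeight g 𝒟 T * (if T ⊆ S then 1 else 0) := by
  have h1 : ∀ U ∈ 𝒟, ∏ p ∈ U, sieveFactor g S p =
      ∑ T ∈ 𝒟, if T ⊆ U then ((∏ p ∈ T, (-1 - g p / (1 - g p))) *
        ∏ p ∈ U \ T, g p / (1 - g p)) * (if T ⊆ S then 1 else 0) else 0 := by
    intro U hU
    have h2 : ∀ p, sieveFactor g S p =
        (if p ∈ S then (-1 - g p / (1 - g p)) else 0) + g p / (1 - g p) := by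
      intro p
      unfold sieveFactor
      split_ifs <;> ring
    simp only [h2]
    rw [Finset.prod_add, ← Finset.sum_filter]
    have h3 : 𝒟.filter (fun T => T ⊆ U) = U.powerset := by
      ext T
      rw [Finset.mem_filter, Finset.mem_powerset]
      exact ⟨fun h => h.2, fun h => ⟨hdown U hU T h, h⟩⟩
    rw [h3]
    refine Finset.sum_congr rfl fun T _ => ?_
    split_ifs with hTS
    · rw [mul_one]
      congr 1
      exact Finset.prod_congr rfl fun p hp => if_pos (hTS hp)
    · obtain ⟨p, hpT, hpS⟩ := Finset.not_subset.1 hTS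
      rw [Finset.prod_eq_zero hpT (by simp [hpS])]
      ring
  rw [Finset.sum_congr rfl h1, Finset.sum_comm]
  refine Finset.sum_congr rfl fun T _ => ?_
  unfold selbergWeight
  rw [← Finset.sum_filter, Finset.sum_mul]

/-- Both sides are the second moment of the same random variable, evaluated once through the
expansion into events `T ⊆ S` and once through orthogonality. -/
lemma sum_selbergWeight_eq (hg : ∀ p ∈ P, g p < 1) (h𝒟 : 𝒟 ⊆ P.powerset)
    (hdown : ∀ U ∈ 𝒟, ∀ T ⊆ U, T ∈ 𝒟) :
    ∑ T₁ ∈ 𝒟, ∑ T₂ ∈ 𝒟, selbergWeight g 𝒟 T₁ * selbergWeight g 𝒟 T₂ * ∏ p ∈ T₁ ∪ T₂, g p =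
      ∑ U ∈ 𝒟, ∏ p ∈ U, g p / (1 - g p) := by
  set μ : Finset ℕ → ℝ := fun S => (∏ p ∈ S, g p) * ∏ p ∈ P \ S, (1 - g p) with hμ
  have hsub : ∀ U ∈ 𝒟, U ⊆ P := fun U hU => Finset.mem_powerset.1 (h𝒟 hU)
  have e1 : ∑ S ∈ P.powerset, μ S * (∑ U ∈ 𝒟, ∏ p ∈ U, sieveFactor g S p) ^ 2 =
      ∑ U ∈ 𝒟, ∏ p ∈ U, g p / (1 - g p) := by
    calc ∑ S ∈ P.powerset, μ S * (∑ U ∈ 𝒟, ∏ p ∈ U, sieveFactor g S p) ^ 2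
        = ∑ S ∈ P.powerset, ∑ U ∈ 𝒟, ∑ V ∈ 𝒟, μ S *
            ((∏ p ∈ U, sieveFactor g S p) * ∏ p ∈ V, sieveFactor g S p) := by
          refine Finset.sum_congr rfl fun S _ => ?_
          rw [sq, Finset.sum_mul_sum, Finset.mul_sum]
          exact Finset.sum_congr rfl fun U _ => Finset.mul_sum _ _ _
      _ = ∑ U ∈ 𝒟, ∑ V ∈ 𝒟, ∑ S ∈ P.powerset, μ S *
            ((∏ p ∈ U, sieveFactor g S p) * ∏ p ∈ V, sieveFactor g S p) := by
          rw [Finset.sum_comm]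
          exact Finset.sum_congr rfl fun U _ => Finset.sum_comm
      _ = ∑ U ∈ 𝒟, ∑ V ∈ 𝒟, if U = V then ∏ p ∈ U, g p / (1 - g p) else 0 :=
          Finset.sum_congr rfl fun U hU => Finset.sum_congr rfl fun V hV =>
            sum_powerset_sieveFactor P g hg (hsub U hU) (hsub V hV)
      _ = _ := by
          refine Finset.sum_congr rfl fun U hU => ?_
          rw [Finset.sum_ite_eq, if_pos hU]
  have e2 : ∑ S ∈ P.powerset, μ S * (∑ U ∈ 𝒟, ∏ p ∈ U, sieveFactor g S p) ^ 2 =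
      ∑ T₁ ∈ 𝒟, ∑ T₂ ∈ 𝒟, selbergWeight g 𝒟 T₁ * selbergWeight g 𝒟 T₂ *
        ∏ p ∈ T₁ ∪ T₂, g p := by
    calc ∑ S ∈ P.powerset, μ S * (∑ U ∈ 𝒟, ∏ p ∈ U, sieveFactor g S p) ^ 2
        = ∑ S ∈ P.powerset, ∑ T₁ ∈ 𝒟, ∑ T₂ ∈ 𝒟,
            selbergWeight g 𝒟 T₁ * selbergWeight g 𝒟 T₂ *
              (μ S * (if T₁ ∪ T₂ ⊆ S then 1 else 0)) := by
          refine Finset.sum_congr rfl fun S _ => ?_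
          rw [sum_prod_sieveFactor g 𝒟 hdown S, sq, Finset.sum_mul_sum, Finset.mul_sum]
          refine Finset.sum_congr rfl fun T₁ _ => ?_
          rw [Finset.mul_sum]
          refine Finset.sum_congr rfl fun T₂ _ => ?_
          by_cases h1 : T₁ ⊆ S <;> by_cases h2 : T₂ ⊆ S <;>
            simp [Finset.union_subset_iff, h1, h2] <;> ring
      _ = ∑ T₁ ∈ 𝒟, ∑ T₂ ∈ 𝒟, ∑ S ∈ P.powerset,
            selbergWeight g 𝒟 T₁ * selbergWeight g 𝒟 T₂ *
              (μ S * (if T₁ ∪ T₂ ⊆ S then 1 else 0)) := by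
          rw [Finset.sum_comm]
          exact Finset.sum_congr rfl fun U _ => Finset.sum_comm
      _ = _ := by
          refine Finset.sum_congr rfl fun T₁ h₁ => Finset.sum_congr rfl fun T₂ h₂ => ?_
          rw [← Finset.mul_sum, sum_powerset_subset P g (Finset.union_subset (hsub _ h₁) (hsub _ h₂))]
  rw [← e2, e1]

/-- Since `1 + h_p = (1 - g_p)⁻¹`, only the sum of `∏_{U \ T} h_p` over `U ⊇ T` needs a bound. The
map `U ↦ U \ T` is injective with values in `𝒟`, and all terms are nonnegative. -/
lemma abs_selbergWeight_le (hg0 : ∀ p ∈ P, 0 ≤ g p) (hg : ∀ p ∈ P, g p < 1)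
    (h𝒟 : 𝒟 ⊆ P.powerset) (hdown : ∀ U ∈ 𝒟, ∀ T ⊆ U, T ∈ 𝒟) {T : Finset ℕ} (hT : T ∈ 𝒟) :
    |selbergWeight g 𝒟 T| ≤
      (∑ U ∈ 𝒟, ∏ p ∈ U, g p / (1 - g p)) * ∏ p ∈ T, (1 - g p)⁻¹ := by
  have hsub : ∀ U ∈ 𝒟, U ⊆ P := fun U hU => Finset.mem_powerset.1 (h𝒟 hU)
  have hh : ∀ p ∈ P, 0 ≤ g p / (1 - g p) := fun p hp =>
    div_nonneg (hg0 p hp) (by have := hg p hp; linarith)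
  unfold selbergWeight
  rw [← Finset.mul_sum, abs_mul, mul_comm]
  have h1 : |∏ p ∈ T, (-1 - g p / (1 - g p))| = ∏ p ∈ T, (1 - g p)⁻¹ := by
    rw [Finset.abs_prod]
    refine Finset.prod_congr rfl fun p hp => ?_
    have h2 : 0 < 1 - g p := by have := hg p (hsub T hT hp); linarith
    have h3 : -1 - g p / (1 - g p) = -(1 - g p)⁻¹ := by field_simp; ring
    rw [h3, abs_neg, abs_of_pos (inv_pos.2 h2)]
  rw [h1]
  have hpos : 0 ≤ ∏ p ∈ T, (1 - g p)⁻¹ := Finset.prod_nonneg fun p hp =>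
    inv_nonneg.2 (by have := hg p (hsub T hT hp); linarith)
  apply mul_le_mul_of_nonneg_right _ hpos
  rw [abs_of_nonneg (Finset.sum_nonneg fun U hU => Finset.prod_nonneg fun p hp =>
    hh p (hsub U (Finset.mem_filter.1 hU).1 (Finset.mem_sdiff.1 hp).1))]
  have hinj : Set.InjOn (fun U : Finset ℕ => U \ T) (𝒟.filter fun U => T ⊆ U) := by
    intro U hU V hV hUV
    have h1 := (Finset.mem_filter.1 hU).2
    have h2 := (Finset.mem_filter.1 hV).2
    simp only at hUV
    rw [← Finset.sdiff_union_of_subset h1, ← Finset.sdiff_union_of_subset h2, hUV]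
  rw [← Finset.sum_image (f := fun V : Finset ℕ => ∏ p ∈ V, g p / (1 - g p)) hinj]
  apply Finset.sum_le_sum_of_subset_of_nonneg
  · intro V hV
    obtain ⟨U, hU, rfl⟩ := Finset.mem_image.1 hV
    exact hdown U (Finset.mem_filter.1 hU).1 _ Finset.sdiff_subset
  · exact fun U hU _ => Finset.prod_nonneg fun p hp => hh p (hsub U hU hp)

open Classical in
-- The weighted sum `F` of indicators equals `L` at every sifted point. Hence `L ^ 2` times the
-- sifted count is at most `∑ F ^ 2`, whose main term is `Y` times the quadratic form, that is `Y
-- L`. Dividing by `L ^ 2` gives the bound. The weights are not normalized, which is why `L` also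
-- bounds them and cancels in the error term.
theorem selberg_sieve (hg0 : ∀ p ∈ P, 0 ≤ g p) (hg : ∀ p ∈ P, g p < 1)
    (h𝒟 : 𝒟 ⊆ P.powerset) (hempty : ∅ ∈ 𝒟) (hdown : ∀ U ∈ 𝒟, ∀ T ⊆ U, T ∈ 𝒟)
    (Ω : Finset α) (B : α → ℕ → Prop) (Y R : ℝ)
    (hcount : ∀ T₁ ∈ 𝒟, ∀ T₂ ∈ 𝒟, |((Ω.filter fun v => ∀ p ∈ T₁ ∪ T₂, B v p).card : ℝ) -
      Y * ∏ p ∈ T₁ ∪ T₂, g p| ≤ R) :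
    ((Ω.filter fun v => ∀ p ∈ P, ¬ B v p).card : ℝ) ≤
      Y / (∑ U ∈ 𝒟, ∏ p ∈ U, g p / (1 - g p)) +
        R * (∑ T ∈ 𝒟, ∏ p ∈ T, (1 - g p)⁻¹) ^ 2 := by
  have hsub : ∀ U ∈ 𝒟, U ⊆ P := fun U hU => Finset.mem_powerset.1 (h𝒟 hU)
  have hh : ∀ p ∈ P, 0 ≤ g p / (1 - g p) := fun p hp =>
    div_nonneg (hg0 p hp) (by have := hg p hp; linarith)
  set L := ∑ U ∈ 𝒟, ∏ p ∈ U, g p / (1 - g p) with hL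
  have hLpos : 0 < L := by
    have := Finset.single_le_sum (f := fun U : Finset ℕ => ∏ p ∈ U, g p / (1 - g p))
      (fun U hU => Finset.prod_nonneg fun p hp => hh p (hsub U hU hp)) hempty
    simp only [Finset.prod_empty] at this
    linarith
  set lam := selbergWeight g 𝒟 with hlam
  have hR : 0 ≤ R := (abs_nonneg _).trans (hcount ∅ hempty ∅ hempty)
  set F : α → ℝ := fun v => ∑ T ∈ 𝒟, lam T * (if ∀ p ∈ T, B v p then 1 else 0) with hF
  have hFS : ∀ v, F v = ∑ U ∈ 𝒟, ∏ p ∈ U, sieveFactor g (P.filter fun p => B v p) p := by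
    intro v
    rw [sum_prod_sieveFactor g 𝒟 hdown]
    refine Finset.sum_congr rfl fun T hT => ?_
    congr 1
    refine if_congr ?_ rfl rfl
    constructor
    · intro h p hp
      exact Finset.mem_filter.2 ⟨hsub T hT hp, h p hp⟩
    · intro h p hp
      exact (Finset.mem_filter.1 (h hp)).2
  have hF1 : ∀ v, (∀ p ∈ P, ¬ B v p) → F v = L := by
    intro v hv
    rw [hFS]
    refine Finset.sum_congr rfl fun U hU => Finset.prod_congr rfl fun p hp => ?_
    unfold sieveFactor
    rw [if_neg]
    intro h
    exact hv p (hsub U hU hp) (Finset.mem_filter.1 h).2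
  have h1 : L ^ 2 * ((Ω.filter fun v => ∀ p ∈ P, ¬ B v p).card : ℝ) ≤ ∑ v ∈ Ω, F v ^ 2 := by
    calc L ^ 2 * ((Ω.filter fun v => ∀ p ∈ P, ¬ B v p).card : ℝ)
        = ∑ v ∈ Ω.filter fun v => ∀ p ∈ P, ¬ B v p, F v ^ 2 := by
          rw [Finset.sum_congr rfl (fun v hv => by rw [hF1 v (Finset.mem_filter.1 hv).2]),
            Finset.sum_const, nsmul_eq_mul, mul_comm]
      _ ≤ _ := Finset.sum_le_sum_of_subset_of_nonneg (Finset.filter_subset _ _)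
          fun _ _ _ => sq_nonneg _
  have h2 : ∑ v ∈ Ω, F v ^ 2 = ∑ T₁ ∈ 𝒟, ∑ T₂ ∈ 𝒟, lam T₁ * lam T₂ *
      ((Ω.filter fun v => ∀ p ∈ T₁ ∪ T₂, B v p).card : ℝ) := by
    calc ∑ v ∈ Ω, F v ^ 2 = ∑ v ∈ Ω, ∑ T₁ ∈ 𝒟, ∑ T₂ ∈ 𝒟, lam T₁ * lam T₂ *
          (if ∀ p ∈ T₁ ∪ T₂, B v p then 1 else 0) := by
          refine Finset.sum_congr rfl fun v _ => ?_
          simp only [hF]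
          rw [sq, Finset.sum_mul_sum]
          refine Finset.sum_congr rfl fun T₁ _ => Finset.sum_congr rfl fun T₂ _ => ?_
          have hiff : (∀ p ∈ T₁ ∪ T₂, B v p) ↔ (∀ p ∈ T₁, B v p) ∧ (∀ p ∈ T₂, B v p) := by
            simp only [Finset.mem_union, or_imp, forall_and]
          by_cases h1 : ∀ p ∈ T₁, B v p <;> by_cases h2 : ∀ p ∈ T₂, B v p
          · rw [if_pos h1, if_pos h2, if_pos (hiff.2 ⟨h1, h2⟩)]; ring
          · rw [if_neg h2, if_neg (fun h => h2 (hiff.1 h).2)]; ring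
          · rw [if_neg h1, if_neg (fun h => h1 (hiff.1 h).1)]; ring
          · rw [if_neg h1, if_neg (fun h => h1 (hiff.1 h).1)]; ring
      _ = _ := by
          rw [Finset.sum_comm]
          refine Finset.sum_congr rfl fun T₁ _ => ?_
          rw [Finset.sum_comm]
          refine Finset.sum_congr rfl fun T₂ _ => ?_
          rw [← Finset.mul_sum, Finset.sum_boole]
  have h3 : ∑ v ∈ Ω, F v ^ 2 ≤ Y * L + R * (∑ T ∈ 𝒟, |lam T|) ^ 2 := by
    rw [h2, hL, ← sum_selbergWeight_eq P g 𝒟 hg h𝒟 hdown, sq, Finset.sum_mul_sum,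
      Finset.mul_sum, Finset.mul_sum, ← Finset.sum_add_distrib]
    refine Finset.sum_le_sum fun T₁ hT₁ => ?_
    rw [Finset.mul_sum, Finset.mul_sum, ← Finset.sum_add_distrib]
    refine Finset.sum_le_sum fun T₂ hT₂ => ?_
    have h4 := hcount T₁ hT₁ T₂ hT₂
    set c := ((Ω.filter fun v => ∀ p ∈ T₁ ∪ T₂, B v p).card : ℝ)
    set G := ∏ p ∈ T₁ ∪ T₂, g p
    have h5 : lam T₁ * lam T₂ * (c - Y * G) ≤ |lam T₁| * |lam T₂| * R := by
      refine (le_abs_self _).trans ?_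
      rw [abs_mul, abs_mul]
      gcongr
    change lam T₁ * lam T₂ * c ≤ Y * (lam T₁ * lam T₂ * G) + R * (|lam T₁| * |lam T₂|)
    linarith
  have h6 : ∑ T ∈ 𝒟, |lam T| ≤ L * ∑ T ∈ 𝒟, ∏ p ∈ T, (1 - g p)⁻¹ := by
    rw [Finset.mul_sum]
    exact Finset.sum_le_sum fun T hT => abs_selbergWeight_le P g 𝒟 hg0 hg h𝒟 hdown hT
  have h7 : (∑ T ∈ 𝒟, |lam T|) ^ 2 ≤ (L * ∑ T ∈ 𝒟, ∏ p ∈ T, (1 - g p)⁻¹) ^ 2 :=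
    pow_le_pow_left₀ (Finset.sum_nonneg fun _ _ => abs_nonneg _) h6 2
  have h8 : L ^ 2 * ((Ω.filter fun v => ∀ p ∈ P, ¬ B v p).card : ℝ) ≤
      L ^ 2 * (Y / L + R * (∑ T ∈ 𝒟, ∏ p ∈ T, (1 - g p)⁻¹) ^ 2) := by
    have h9 : R * (∑ T ∈ 𝒟, |lam T|) ^ 2 ≤
      R * (L * ∑ T ∈ 𝒟, ∏ p ∈ T, (1 - g p)⁻¹) ^ 2 := mul_le_mul_of_nonneg_left h7 hR
    have h10 : L ^ 2 * (Y / L + R * (∑ T ∈ 𝒟, ∏ p ∈ T, (1 - g p)⁻¹) ^ 2) =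
        Y * L + R * (L * ∑ T ∈ 𝒟, ∏ p ∈ T, (1 - g p)⁻¹) ^ 2 := by
      field_simp
    rw [h10]
    linarith
  exact le_of_mul_le_mul_left h8 (by positivity)

end Selberg

lemma prod_injOn_primes {𝒟 : Finset (Finset ℕ)} (h : ∀ T ∈ 𝒟, ∀ p ∈ T, p.Prime) :
    Set.InjOn (fun T : Finset ℕ => ∏ p ∈ T, p) (𝒟 : Set (Finset ℕ)) := by
  intro T hT U hU hTU
  have h1 := Nat.primeFactors_prod (h T hT)
  have h2 := Nat.primeFactors_prod (h U hU)
  simp only at hTU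
  rw [← h1, ← h2, hTU]

/-- The denominator in Selberg's sieve is at least half of the full Euler product if the level is a
large power of the sifting limit. -/
lemma exists_prod_le_sum_selberg (e : ℝ) (he : 0 ≤ e) :
    ∃ κ : ℝ, 0 < κ ∧ ∀ (P : Finset ℕ) (h : ℕ → ℝ) (w D : ℝ), 1 ≤ w → 1 ≤ D →
      κ * (1 + Real.log w) ≤ Real.log D →
      (∀ p ∈ P, p.Prime ∧ (p : ℝ) ≤ w ∧ 0 ≤ h p ∧ h p ≤ e / p) →
      ∏ p ∈ P, (1 + h p) ≤
        2 * ∑ T ∈ P.powerset with ((∏ p ∈ T, p : ℕ) : ℝ) ≤ D, ∏ p ∈ T, h p := by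
  obtain ⟨K, hK, hK'⟩ := exists_sum_one_add_log_div_le
  -- With `β = 1 / (1 + log w)` the twist by `p ^ β` multiplies the product by at most `exp(3eK)`,
  -- and `D ^ (-β) ≤ exp(-(3eK + 1))`. The terms beyond `D` therefore make up at most a proportion
  -- `1/e < 1/2`.
  refine ⟨3 * e * K + 1, by positivity, fun P h w D hw hD hκ hP => ?_⟩
  have hlw : 0 ≤ Real.log w := Real.log_nonneg hw
  have hlD : 0 ≤ Real.log D := Real.log_nonneg hD
  set β := 1 / (1 + Real.log w) with hβ
  have hβ0 : 0 < β := by positivity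
  have hprod : ∏ p ∈ P, (1 + h p) = ∑ T ∈ P.powerset, ∏ p ∈ T, h p := Finset.prod_one_add P
  have hpos : 0 ≤ ∏ p ∈ P, (1 + h p) := Finset.prod_nonneg fun p hp => by
    have := (hP p hp).2.2.1; linarith
  have htail : ∑ T ∈ P.powerset with ¬ ((∏ p ∈ T, p : ℕ) : ℝ) ≤ D, ∏ p ∈ T, h p ≤
      D ^ (-β) * ∏ p ∈ P, (1 + h p * (p : ℝ) ^ β) := by
    rw [Finset.prod_one_add, Finset.mul_sum]
    have hnn : ∀ T ∈ P.powerset, 0 ≤ ∏ p ∈ T, h p * (p : ℝ) ^ β := fun T hT =>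
      Finset.prod_nonneg fun p hp => mul_nonneg (hP p (Finset.mem_powerset.1 hT hp)).2.2.1
        (by positivity)
    refine le_trans (Finset.sum_le_sum (g := fun T => D ^ (-β) * ∏ p ∈ T, h p * (p : ℝ) ^ β) ?_)
      (Finset.sum_le_sum_of_subset_of_nonneg (Finset.filter_subset _ _)
        fun T hT _ => mul_nonneg (by positivity) (hnn T hT))
    intro T hT
    obtain ⟨hTP, hTD⟩ := Finset.mem_filter.1 hT
    rw [Finset.mem_powerset] at hTP
    have h1 : ∏ p ∈ T, h p * (p : ℝ) ^ β = (∏ p ∈ T, h p) * ((∏ p ∈ T, p : ℕ) : ℝ) ^ β := by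
      rw [Finset.prod_mul_distrib]
      congr 1
      push_cast
      rw [← Real.finsetProd_rpow]
      intro p _; positivity
    have h2 : D ^ β ≤ ((∏ p ∈ T, p : ℕ) : ℝ) ^ β :=
      Real.rpow_le_rpow (by linarith) (not_le.1 hTD).le hβ0.le
    have h3 : 0 ≤ ∏ p ∈ T, h p := Finset.prod_nonneg fun p hp => (hP p (hTP hp)).2.2.1
    have h4 : 1 ≤ D ^ (-β) * ((∏ p ∈ T, p : ℕ) : ℝ) ^ β := by
      rw [Real.rpow_neg (by linarith), inv_mul_eq_div, one_le_div (by positivity)]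
      exact h2
    rw [h1]
    calc ∏ p ∈ T, h p = (∏ p ∈ T, h p) * 1 := (mul_one _).symm
      _ ≤ (∏ p ∈ T, h p) * (D ^ (-β) * ((∏ p ∈ T, p : ℕ) : ℝ) ^ β) := by gcongr
      _ = _ := by ring
  have hloc : ∏ p ∈ P, (1 + h p * (p : ℝ) ^ β) ≤
      (∏ p ∈ P, (1 + h p)) * Real.exp (3 * e * K) := by
    calc ∏ p ∈ P, (1 + h p * (p : ℝ) ^ β)
        ≤ ∏ p ∈ P, ((1 + h p) * Real.exp (3 * e * β * ((1 + Real.log p) / p))) := by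
          apply Finset.prod_le_prod
          · intro p hp
            have := (hP p hp).2.2.1
            positivity
          · intro p hp
            obtain ⟨hpp, hpw, hp0, hpe⟩ := hP p hp
            have hp0' : (0 : ℝ) < p := by exact_mod_cast hpp.pos
            have hlp : 0 ≤ Real.log p := Real.log_natCast_nonneg p
            have hlpw : Real.log p ≤ Real.log w := Real.log_le_log hp0' hpw
            set x := β * Real.log p with hx
            have hx0 : 0 ≤ x := by positivity
            have hx1 : x ≤ 1 := by
              rw [hx, hβ, one_div_mul_eq_div, div_le_one (by linarith)]
              linarith
            have hpβ : (p : ℝ) ^ β = Real.exp x := by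
              rw [Real.rpow_def_of_pos hp0', mul_comm]
            have h5 : Real.exp x ≤ 1 + 3 * x := by
              have h6 := Real.add_one_le_exp (-x)
              have h7 : Real.exp (-x) * Real.exp x = 1 := by rw [← Real.exp_add]; simp
              have h8 : Real.exp x ≤ 3 :=
                (Real.exp_le_exp.2 hx1).trans (by linarith [Real.exp_one_lt_d9])
              nlinarith [Real.exp_pos x]
            set t := 3 * e * β * ((1 + Real.log p) / p) with ht
            have h9 : h p * (3 * x) ≤ t := by
              calc h p * (3 * x) ≤ e / p * (3 * x) := by gcongr
                _ = 3 * e * β * (Real.log p / p) := by rw [hx]; ring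
                _ ≤ t := by rw [ht]; gcongr; linarith
            have h10 := Real.add_one_le_exp t
            have h11 : 0 ≤ t := by positivity
            rw [hpβ]
            nlinarith
      _ = (∏ p ∈ P, (1 + h p)) * Real.exp (3 * e * β * ∑ p ∈ P, (1 + Real.log p) / p) := by
          rw [Finset.prod_mul_distrib, ← Real.exp_sum, Finset.mul_sum]
      _ ≤ _ := by
          refine mul_le_mul_of_nonneg_left (Real.exp_le_exp.2 ?_) hpos
          have h1 : ∑ p ∈ P, (1 + Real.log p) / p ≤ K * (1 + Real.log w) := by
            refine le_trans (Finset.sum_le_sum_of_subset_of_nonneg ?_ ?_) (hK' w hw)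
            · intro p hp
              obtain ⟨hpp, hpw, -, -⟩ := hP p hp
              exact (mem_primesIoc le_rfl).2 ⟨hpp, by exact_mod_cast hpp.pos, hpw⟩
            · intro p _ _
              have := Real.log_natCast_nonneg p
              positivity
          calc 3 * e * β * ∑ p ∈ P, (1 + Real.log p) / p
              ≤ 3 * e * β * (K * (1 + Real.log w)) := by gcongr
            _ = 3 * e * K := by rw [hβ]; field_simp
  have hDβ : D ^ (-β) ≤ Real.exp (-(3 * e * K + 1)) := by
    rw [Real.rpow_def_of_pos (by linarith)]
    apply Real.exp_le_exp.2
    have : 3 * e * K + 1 ≤ Real.log D * β := by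
      rw [hβ, mul_one_div, le_div_iff₀ (by positivity)]; exact hκ
    linarith
  have hsmall : D ^ (-β) * ∏ p ∈ P, (1 + h p * (p : ℝ) ^ β) ≤ (∏ p ∈ P, (1 + h p)) / 2 := by
    calc D ^ (-β) * ∏ p ∈ P, (1 + h p * (p : ℝ) ^ β)
        ≤ Real.exp (-(3 * e * K + 1)) * ((∏ p ∈ P, (1 + h p)) * Real.exp (3 * e * K)) := by
          refine mul_le_mul hDβ hloc (Finset.prod_nonneg fun p hp => ?_) (Real.exp_pos _).le
          have := (hP p hp).2.2.1
          positivity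
      _ = (∏ p ∈ P, (1 + h p)) * Real.exp (-1) := by
          rw [mul_comm (Real.exp _), mul_assoc, ← Real.exp_add]
          ring_nf
      _ ≤ _ := by
          rw [div_eq_mul_inv]
          gcongr
          rw [Real.exp_neg]
          apply inv_anti₀ (by norm_num)
          linarith [Real.exp_one_gt_d9]
  have hsplit := Finset.sum_filter_add_sum_filter_not P.powerset
    (fun T => ((∏ p ∈ T, p : ℕ) : ℝ) ≤ D) (fun T => ∏ p ∈ T, h p)
  linarith

open Classical in
/-- Selberg's upper bound sieve for densities `g p ≪ 1 / p`. -/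
lemma exists_sieve_bound (e : ℝ) (he : 0 ≤ e) :
    ∃ κ : ℝ, 0 < κ ∧ ∀ {α : Type} (P : Finset ℕ) (g : ℕ → ℝ) (w D : ℝ), 1 ≤ w → 1 ≤ D →
      κ * (1 + Real.log w) ≤ Real.log D →
      (∀ p ∈ P, p.Prime ∧ (p : ℝ) ≤ w ∧ 0 ≤ g p ∧ g p / (1 - g p) ≤ e / p ∧ g p < 1 ∧
        (1 - g p)⁻¹ ≤ p) →
      ∀ (Ω : Finset α) (B : α → ℕ → Prop) (Y R : ℝ), 0 ≤ Y →
      (∀ T ⊆ P, ((∏ p ∈ T, p : ℕ) : ℝ) ≤ D ^ 2 →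
        |((Ω.filter fun v => ∀ p ∈ T, B v p).card : ℝ) - Y * ∏ p ∈ T, g p| ≤ R) →
      ((Ω.filter fun v => ∀ p ∈ P, ¬ B v p).card : ℝ) ≤
        2 * Y * ∏ p ∈ P, (1 - g p) + R * D ^ 4 := by
  obtain ⟨κ, hκ, hκ'⟩ := exists_prod_le_sum_selberg e he
  refine ⟨κ, hκ, fun {α} P g w D hw hD hwD hP Ω B Y R hY hcount => ?_⟩
  have hg1 : ∀ p ∈ P, 0 < 1 - g p := fun p hp => by have := (hP p hp).2.2.2.2.1; linarith
  have hg0 : ∀ p ∈ P, 0 ≤ g p := fun p hp => (hP p hp).2.2.1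
  set 𝒟 := P.powerset.filter fun T => ((∏ p ∈ T, p : ℕ) : ℝ) ≤ D with h𝒟
  have hsub : ∀ T ∈ 𝒟, T ⊆ P := fun T hT => Finset.mem_powerset.1 (Finset.mem_filter.1 hT).1
  have hle : ∀ T ∈ 𝒟, ((∏ p ∈ T, p : ℕ) : ℝ) ≤ D := fun T hT => (Finset.mem_filter.1 hT).2
  have hprime : ∀ T ⊆ P, ∀ p ∈ T, p.Prime := fun T hT p hp => (hP p (hT hp)).1
  have hppos : ∀ T ⊆ P, 0 < ∏ p ∈ T, p := fun T hT =>
    Finset.prod_pos fun p hp => (hprime T hT p hp).pos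
  have hR : 0 ≤ R := (abs_nonneg _).trans (hcount ∅ (Finset.empty_subset _) (by
    rw [Finset.prod_empty]; push_cast; nlinarith))
  have hdown : ∀ U ∈ 𝒟, ∀ T ⊆ U, T ∈ 𝒟 := by
    intro U hU T hTU
    refine Finset.mem_filter.2 ⟨Finset.mem_powerset.2 (hTU.trans (hsub U hU)), ?_⟩
    refine le_trans ?_ (hle U hU)
    exact_mod_cast Nat.le_of_dvd (hppos U (hsub U hU)) (Finset.prod_dvd_prod_of_subset T U _ hTU)
  have h1 := selberg_sieve P g 𝒟 hg0 (fun p hp => (hP p hp).2.2.2.2.1)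
    (Finset.filter_subset _ _)
    (Finset.mem_filter.2 ⟨Finset.mem_powerset.2 (Finset.empty_subset _), by simpa using hD⟩)
    hdown Ω B Y R (by
      intro T₁ hT₁ T₂ hT₂
      refine hcount _ (Finset.union_subset (hsub _ hT₁) (hsub _ hT₂)) ?_
      have h2 : ∏ p ∈ T₁ ∪ T₂, p ≤ (∏ p ∈ T₁, p) * ∏ p ∈ T₂, p := by
        rw [← Finset.prod_union_inter]
        exact Nat.le_mul_of_pos_right _
          (hppos _ (Finset.inter_subset_left.trans (hsub _ hT₁)))
      calc ((∏ p ∈ T₁ ∪ T₂, p : ℕ) : ℝ) ≤ ((∏ p ∈ T₁, p : ℕ) : ℝ) * ((∏ p ∈ T₂, p : ℕ) : ℝ) := by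
            exact_mod_cast h2
        _ ≤ D * D := mul_le_mul (hle _ hT₁) (hle _ hT₂) (by positivity) (by linarith)
        _ = D ^ 2 := by ring)
  refine h1.trans (add_le_add ?_ ?_)
  · have h2 := hκ' P (fun p => g p / (1 - g p)) w D hw hD hwD (fun p hp =>
      ⟨(hP p hp).1, (hP p hp).2.1, div_nonneg (hg0 p hp) (hg1 p hp).le, (hP p hp).2.2.2.1⟩)
    rw [← h𝒟] at h2
    have h3 : ∏ p ∈ P, (1 + g p / (1 - g p)) = (∏ p ∈ P, (1 - g p))⁻¹ := by
      rw [← Finset.prod_inv_distrib]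
      refine Finset.prod_congr rfl fun p hp => ?_
      have := (hg1 p hp).ne'
      field_simp
      ring
    rw [h3] at h2
    have h4 : 0 < ∏ p ∈ P, (1 - g p) := Finset.prod_pos hg1
    have h5 : 0 < ∑ T ∈ 𝒟, ∏ p ∈ T, g p / (1 - g p) := by
      have := inv_pos.2 h4
      linarith
    rw [div_le_iff₀ h5]
    rw [inv_le_iff_one_le_mul₀ h4] at h2
    calc Y = Y * 1 := (mul_one Y).symm
      _ ≤ Y * (2 * (∑ T ∈ 𝒟, ∏ p ∈ T, g p / (1 - g p)) * ∏ p ∈ P, (1 - g p)) := by gcongr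
      _ = _ := by ring
  -- Distinct sets of primes have distinct products, so there are at most `D` of them. Each
  -- contributes at most `∏ p ≤ D` because `(1 - g p)⁻¹ ≤ p`.
  · have h2 : ∑ T ∈ 𝒟, ∏ p ∈ T, (1 - g p)⁻¹ ≤ D ^ 2 := by
      have hcard : (𝒟.card : ℝ) ≤ D := by
        have h3 : 𝒟.card ≤ (Finset.Icc 1 ⌊D⌋₊).card := by
          apply Finset.card_le_card_of_injOn (fun T => ∏ p ∈ T, p)
          · intro T hT
            rw [Finset.mem_coe, Finset.mem_Icc]
            exact ⟨hppos T (hsub T hT), Nat.le_floor (hle T hT)⟩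
          · exact prod_injOn_primes fun T hT => hprime T (hsub T hT)
        rw [Nat.card_Icc, Nat.add_sub_cancel] at h3
        exact (Nat.cast_le.2 h3).trans (Nat.floor_le (by linarith))
      calc ∑ T ∈ 𝒟, ∏ p ∈ T, (1 - g p)⁻¹ ≤ ∑ T ∈ 𝒟, D := by
            refine Finset.sum_le_sum fun T hT => le_trans ?_ (hle T hT)
            push_cast
            exact Finset.prod_le_prod (fun p hp => inv_nonneg.2 (hg1 p (hsub T hT hp)).le)
              fun p hp => (hP p (hsub T hT hp)).2.2.2.2.2
        _ = 𝒟.card * D := by rw [Finset.sum_const, nsmul_eq_mul]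
        _ ≤ D ^ 2 := by nlinarith
    have h0 : 0 ≤ ∑ T ∈ 𝒟, ∏ p ∈ T, (1 - g p)⁻¹ := Finset.sum_nonneg fun T hT =>
      Finset.prod_nonneg fun p hp => inv_nonneg.2 (hg1 p (hsub T hT hp)).le
    calc R * (∑ T ∈ 𝒟, ∏ p ∈ T, (1 - g p)⁻¹) ^ 2 ≤ R * (D ^ 2) ^ 2 := by gcongr
      _ = _ := by ring

/-! ### Points modulo prime powers -/

/-- The reduction of an integral point modulo `n`. -/
def red (n : ℕ) (v : ℤ × ℤ) : ZMod n × ZMod n := ((v.1 : ZMod n), (v.2 : ZMod n))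

lemma red_surjective (n : ℕ) : Function.Surjective (red n) := by
  rintro ⟨x, y⟩
  obtain ⟨a, rfl⟩ := ZMod.intCast_surjective x
  obtain ⟨b, rfl⟩ := ZMod.intCast_surjective y
  exact ⟨(a, b), rfl⟩

lemma red_eq_red_iff {n : ℕ} {v w : ℤ × ℤ} :
    red n v = red n w ↔ (n : ℤ) ∣ v.1 - w.1 ∧ (n : ℤ) ∣ v.2 - w.2 := by
  unfold red
  rw [Prod.mk.injEq, eq_comm, ZMod.intCast_eq_intCast_iff_dvd_sub, eq_comm (a := (v.2 : ZMod n)),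
    ZMod.intCast_eq_intCast_iff_dvd_sub]

lemma castHom_red {m n : ℕ} (h : m ∣ n) (v : ℤ × ℤ) :
    (ZMod.castHom h (ZMod m) (red n v).1, ZMod.castHom h (ZMod m) (red n v).2) = red m v := by
  simp [red]

lemma aeval_red (Q : MvPolynomial (Fin 2) ℤ) (n : ℕ) (v : ℤ × ℤ) :
    MvPolynomial.aeval ![(red n v).1, (red n v).2] Q = ((value Q v : ℤ) : ZMod n) := by
  have h : (![(red n v).1, (red n v).2] : Fin 2 → ZMod n) =
      algebraMap ℤ (ZMod n) ∘ ![v.1, v.2] := by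
    funext i
    fin_cases i <;> simp [red]
  rw [h, MvPolynomial.aeval_algebraMap_apply]
  simp [value, MvPolynomial.aeval_eq_eval]

lemma isPoint_red {Q : MvPolynomial (Fin 2) ℤ} {n : ℕ} {v : ℤ × ℤ} :
    IsPoint Q n (red n v) ↔ (n : ℤ) ∣ value Q v := by
  unfold IsPoint
  rw [aeval_red, ZMod.intCast_zmod_eq_zero_iff_dvd]

lemma isSmoothAt_red {Q : MvPolynomial (Fin 2) ℤ} {p k : ℕ} (hp : p.Prime) (hk : k ≠ 0)
    {v : ℤ × ℤ} : IsSmoothAt Q (p ^ k) (red (p ^ k) v) ↔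
      ∃ i, ¬ (p : ℤ) ∣ value (MvPolynomial.pderiv i Q) v := by
  unfold IsSmoothAt
  refine exists_congr fun i => ?_
  rw [aeval_red, ZMod.coe_int_isUnit_iff_isCoprime, Nat.cast_pow,
    IsCoprime.pow_left_iff (Nat.pos_of_ne_zero hk), (Nat.prime_iff_prime_int.1 hp).coprime_iff_not_dvd]

lemma hasLift_red {Q : MvPolynomial (Fin 2) ℤ} {p k : ℕ} {v : ℤ × ℤ} :
    HasLift Q p k (red (p ^ k) v) ↔
      ∃ w : ℤ × ℤ, ((p ^ (k + 1) : ℕ) : ℤ) ∣ value Q w ∧ red (p ^ k) w = red (p ^ k) v := by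
  unfold HasLift
  constructor
  · rintro ⟨w, hw, h1, h2⟩
    obtain ⟨w, rfl⟩ := red_surjective _ w
    refine ⟨w, isPoint_red.1 hw, ?_⟩
    rw [← castHom_red (pow_dvd_pow p k.le_succ) w, h1, h2]
  · rintro ⟨w, hw, h⟩
    have h3 := castHom_red (pow_dvd_pow p k.le_succ) w
    rw [h] at h3
    exact ⟨red _ w, isPoint_red.2 hw, congrArg Prod.fst h3, congrArg Prod.snd h3⟩

/-- Taylor's formula to first order, in a form without denominators that can be proved by induction
on the polynomial. -/
lemma value_taylor (Q : MvPolynomial (Fin 2) ℤ) (n : ℤ) (v s : ℤ × ℤ) :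
    n ^ 2 ∣ value Q (v.1 + n * s.1, v.2 + n * s.2) - value Q v -
      n * (s.1 * value (MvPolynomial.pderiv 0 Q) v + s.2 * value (MvPolynomial.pderiv 1 Q) v) := by
  unfold value
  induction Q using MvPolynomial.induction_on with
  | C a => simp
  | add p q hp hq =>
    simp only [map_add]
    have := dvd_add hp hq
    refine this.trans (dvd_of_eq ?_)
    ring
  | mul_X p i hp =>
    obtain ⟨c, hc⟩ := hp
    rw [sub_sub, sub_eq_iff_eq_add] at hc
    simp only [MvPolynomial.pderiv_mul, map_add, map_mul, MvPolynomial.eval_X] at hc ⊢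
    rw [hc]
    fin_cases i
    · simp only [Fin.zero_eta, MvPolynomial.pderiv_X_self,
        MvPolynomial.pderiv_X_of_ne (show (0 : Fin 2) ≠ 1 by decide), map_one, map_zero,
        Matrix.cons_val_zero]
      refine ⟨c * (v.1 + n * s.1) + s.1 * (s.1 * MvPolynomial.eval ![v.1, v.2]
        (MvPolynomial.pderiv 0 p) + s.2 * MvPolynomial.eval ![v.1, v.2]
        (MvPolynomial.pderiv 1 p)), ?_⟩
      ring
    · simp only [Fin.mk_one, MvPolynomial.pderiv_X_self,
        MvPolynomial.pderiv_X_of_ne (show (1 : Fin 2) ≠ 0 by decide), map_one, map_zero,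
        show (![v.1, v.2] : Fin 2 → ℤ) 1 = v.2 from rfl,
        show (![v.1 + n * s.1, v.2 + n * s.2] : Fin 2 → ℤ) 1 = v.2 + n * s.2 from rfl]
      refine ⟨c * (v.2 + n * s.2) + s.2 * (s.1 * MvPolynomial.eval ![v.1, v.2]
        (MvPolynomial.pderiv 0 p) + s.2 * MvPolynomial.eval ![v.1, v.2]
        (MvPolynomial.pderiv 1 p)), ?_⟩
      ring

/-- In Taylor's formula with step `p ^ k`, the linear term gains a factor `p` because the gradient
vanishes modulo `p`, and the remainder is divisible by `p ^ (2k)` with `2k ≥ k + 1`. -/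
lemma dvd_value_of_not_smooth {Q : MvPolynomial (Fin 2) ℤ} {p k : ℕ} (hp : p.Prime) (hk : k ≠ 0)
    {v w : ℤ × ℤ} (hs : ¬ IsSmoothAt Q (p ^ k) (red (p ^ k) v))
    (hvw : red (p ^ k) w = red (p ^ k) v) :
    ((p ^ (k + 1) : ℕ) : ℤ) ∣ value Q w - value Q v := by
  rw [isSmoothAt_red hp hk] at hs
  push Not at hs
  obtain ⟨⟨a, ha⟩, ⟨b, hb⟩⟩ := red_eq_red_iff.1 hvw
  have hw : w = (v.1 + ((p ^ k : ℕ) : ℤ) * a, v.2 + ((p ^ k : ℕ) : ℤ) * b) := by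
    rw [← ha, ← hb]; ext <;> simp
  have h1 := value_taylor Q ((p ^ k : ℕ) : ℤ) v (a, b)
  simp only at h1
  rw [← hw] at h1
  have h2 : ((p ^ (k + 1) : ℕ) : ℤ) ∣ ((p ^ k : ℕ) : ℤ) ^ 2 := by
    push_cast
    rw [← pow_mul]
    exact pow_dvd_pow _ (by omega)
  have h3 : ((p ^ (k + 1) : ℕ) : ℤ) ∣ ((p ^ k : ℕ) : ℤ) *
      (a * value (MvPolynomial.pderiv 0 Q) v + b * value (MvPolynomial.pderiv 1 Q) v) := by
    push_cast
    rw [pow_succ]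
    exact mul_dvd_mul_left _ (dvd_add ((hs 0).mul_left a) ((hs 1).mul_left b))
  have h4 := dvd_add (h2.trans h1) h3
  rwa [sub_add_cancel] at h4

/-- If `p ^ k` divides `Q(v)` exactly then `v` modulo `p ^ k` is smooth or has no lift. -/
lemma smooth_or_not_hasLift {Q : MvPolynomial (Fin 2) ℤ} {p k : ℕ} (hp : p.Prime) (hk : k ≠ 0)
    {v : ℤ × ℤ} (hv : ¬ ((p ^ (k + 1) : ℕ) : ℤ) ∣ value Q v) :
    IsSmoothAt Q (p ^ k) (red (p ^ k) v) ∨ ¬ HasLift Q p k (red (p ^ k) v) := by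
  by_contra h
  push Not at h
  obtain ⟨w, hw, hwv⟩ := hasLift_red.1 h.2
  exact hv ((dvd_sub_right hw).1 (dvd_value_of_not_smooth hp hk h.1 hwv))

/-- All fibres of a surjective homomorphism are equally large. It is used to compare densities at
different moduli. -/
lemma card_preimage_mul {G H : Type*} [AddGroup G] [AddGroup H] [Fintype G] [Fintype H]
    [DecidableEq H] (f : G →+ H) (hf : Function.Surjective f) (S : Finset H) :
    (Finset.univ.filter fun x => f x ∈ S).card * Fintype.card H = S.card * Fintype.card G := by
  have hfib : ∀ y : H, (Finset.univ.filter fun x => f x = y).card =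
      (Finset.univ.filter fun x => f x = 0).card := fun y =>
    AddMonoidHom.card_fiber_eq_of_mem_range f (hf y) (hf 0)
  have h1 : ∀ S : Finset H, (Finset.univ.filter fun x => f x ∈ S).card =
      S.card * (Finset.univ.filter fun x => f x = 0).card := by
    intro S
    rw [Finset.card_eq_sum_card_fiberwise (f := f) (t := S)
      (s := Finset.univ.filter fun x => f x ∈ S)
      (fun x hx => (Finset.mem_filter.1 (Finset.mem_coe.1 hx)).2)]
    rw [Finset.sum_congr rfl (g := fun _ => (Finset.univ.filter fun x => f x = 0).card),
      Finset.sum_const, smul_eq_mul]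
    intro y hy
    rw [← hfib y, Finset.filter_filter]
    congr 1
    ext x
    simp only [Finset.mem_filter, Finset.mem_univ, true_and]
    exact ⟨fun h => h.2, fun h => ⟨h ▸ hy, h⟩⟩
  have h2 := h1 Finset.univ
  simp only [Finset.mem_univ, Finset.filter_true, Finset.card_univ] at h2
  rw [h1 S, h2]
  ring

open Classical in
lemma rho_eq (Q : MvPolynomial (Fin 2) ℤ) (n : ℕ) [NeZero n] :
    rho Q n = (Finset.univ.filter fun v : ZMod n × ZMod n => IsPoint Q n v).card := by
  unfold rho
  rw [Nat.card_eq_fintype_card, Fintype.card_subtype]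

open Classical in
lemma rhoTildePrimePow_eq (Q : MvPolynomial (Fin 2) ℤ) (p k : ℕ) [NeZero p] :
    rhoTildePrimePow Q p k = (Finset.univ.filter fun v : ZMod (p ^ k) × ZMod (p ^ k) =>
      IsPoint Q (p ^ k) v ∧ (IsSmoothAt Q (p ^ k) v ∨ ¬ HasLift Q p k v)).card := by
  unfold rhoTildePrimePow
  rw [Nat.card_eq_fintype_card, Fintype.card_subtype]

lemma rhoTildePrimePow_le_rho (Q : MvPolynomial (Fin 2) ℤ) (p k : ℕ) [NeZero p] :
    rhoTildePrimePow Q p k ≤ rho Q (p ^ k) := by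
  classical
  rw [rhoTildePrimePow_eq, rho_eq]
  apply Finset.card_le_card
  intro v hv
  rw [Finset.mem_filter] at hv ⊢
  exact ⟨hv.1, hv.2.1⟩

/-- The reduction map on pairs. -/
def castPair {m n : ℕ} (h : m ∣ n) : ZMod n × ZMod n →+ ZMod m × ZMod m :=
  AddMonoidHom.prodMap (ZMod.castHom h (ZMod m)).toAddMonoidHom
    (ZMod.castHom h (ZMod m)).toAddMonoidHom

lemma castPair_red {m n : ℕ} (h : m ∣ n) (v : ℤ × ℤ) : castPair h (red n v) = red m v :=
  castHom_red h v

lemma castPair_surjective {m n : ℕ} (h : m ∣ n) : Function.Surjective (castPair h) := by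
  intro y
  obtain ⟨v, rfl⟩ := red_surjective m y
  exact ⟨red n v, castPair_red h v⟩

/-- The density of the points of the curve modulo `n`. -/
noncomputable def density (Q : MvPolynomial (Fin 2) ℤ) (n : ℕ) : ℝ := rho Q n / (n : ℝ) ^ 2

lemma density_nonneg (Q : MvPolynomial (Fin 2) ℤ) (n : ℕ) : 0 ≤ density Q n := by
  unfold density; positivity

lemma density_le_of_dvd (Q : MvPolynomial (Fin 2) ℤ) {m n : ℕ} [NeZero m] [NeZero n] (h : m ∣ n) :
    density Q n ≤ density Q m := by
  classical
  have h1 := card_preimage_mul (castPair h) (castPair_surjective h)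
    (Finset.univ.filter fun v => IsPoint Q m v)
  have h2 : rho Q n ≤ (Finset.univ.filter fun x =>
      castPair h x ∈ Finset.univ.filter fun v => IsPoint Q m v).card := by
    rw [rho_eq]
    apply Finset.card_le_card
    intro v hv
    obtain ⟨v, rfl⟩ := red_surjective n v
    simp only [Finset.mem_filter, Finset.mem_univ, true_and, isPoint_red, castPair_red] at hv ⊢
    exact (Int.natCast_dvd_natCast.2 h).trans hv
  rw [← rho_eq] at h1
  simp only [Fintype.card_prod, ZMod.card] at h1
  have h3 : rho Q n * (m * m) ≤ rho Q m * (n * n) := by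
    rw [← h1]; exact Nat.mul_le_mul_right _ h2
  unfold density
  have hm : (0 : ℝ) < m := by exact_mod_cast Nat.pos_of_ne_zero (NeZero.ne m)
  have hn : (0 : ℝ) < n := by exact_mod_cast Nat.pos_of_ne_zero (NeZero.ne n)
  rw [div_le_div_iff₀ (by positivity) (by positivity)]
  have h4 : (rho Q n : ℝ) * (m * m) ≤ rho Q m * (n * n) := by exact_mod_cast h3
  nlinarith

/-- A point not counted by `ρ̃_Q` is singular and has a lift. By the Taylor argument all residues
above it modulo `p ^ (k + 1)` are then points of the curve, so these points keep their full density
one level up. -/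
lemma density_le_add (Q : MvPolynomial (Fin 2) ℤ) {p k : ℕ} (hp : p.Prime) (hk : k ≠ 0) :
    density Q (p ^ k) ≤ rhoTildePrimePow Q p k / ((p : ℝ) ^ k) ^ 2 + density Q (p ^ (k + 1)) := by
  classical
  have : NeZero p := ⟨hp.ne_zero⟩
  set S := Finset.univ.filter fun v : ZMod (p ^ k) × ZMod (p ^ k) =>
    ¬ IsSmoothAt Q (p ^ k) v ∧ HasLift Q p k v with hS
  have hdvd : p ^ k ∣ p ^ (k + 1) := pow_dvd_pow p k.le_succ
  have h1 : rho Q (p ^ k) ≤ rhoTildePrimePow Q p k + S.card := by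
    rw [rho_eq, rhoTildePrimePow_eq]
    refine le_trans (Finset.card_le_card ?_) (Finset.card_union_le _ _)
    intro v hv
    rw [Finset.mem_union, Finset.mem_filter, hS, Finset.mem_filter]
    have := (Finset.mem_filter.1 hv).2
    by_cases h : IsSmoothAt Q (p ^ k) v ∨ ¬ HasLift Q p k v
    · exact Or.inl ⟨Finset.mem_univ _, this, h⟩
    · push Not at h
      exact Or.inr ⟨Finset.mem_univ _, h⟩
  have h2 := card_preimage_mul (castPair hdvd) (castPair_surjective hdvd) S
  have h3 : (Finset.univ.filter fun x => castPair hdvd x ∈ S).card ≤ rho Q (p ^ (k + 1)) := by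
    rw [rho_eq]
    apply Finset.card_le_card
    intro v hv
    obtain ⟨v, rfl⟩ := red_surjective _ v
    rw [Finset.mem_filter, castPair_red, hS, Finset.mem_filter] at hv
    obtain ⟨-, -, hsm, hl⟩ := hv
    obtain ⟨w, hw, hwv⟩ := hasLift_red.1 hl
    refine Finset.mem_filter.2 ⟨Finset.mem_univ _, isPoint_red.2 ?_⟩
    exact (dvd_sub_right hw).1 (dvd_value_of_not_smooth hp hk hsm hwv)
  simp only [Fintype.card_prod, ZMod.card] at h2
  have h4 : S.card * (p ^ (k + 1) * p ^ (k + 1)) ≤ rho Q (p ^ (k + 1)) * (p ^ k * p ^ k) := by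
    rw [← h2]; exact Nat.mul_le_mul_right _ h3
  have hp0 : (0 : ℝ) < p := by exact_mod_cast hp.pos
  have h5 : (S.card : ℝ) / ((p : ℝ) ^ k) ^ 2 ≤ density Q (p ^ (k + 1)) := by
    unfold density
    push_cast
    rw [div_le_div_iff₀ (by positivity) (by positivity)]
    have : (S.card : ℝ) * (p ^ (k + 1) * p ^ (k + 1)) ≤ rho Q (p ^ (k + 1)) * (p ^ k * p ^ k) := by
      exact_mod_cast h4
    nlinarith
  have h6 : (rho Q (p ^ k) : ℝ) ≤ rhoTildePrimePow Q p k + S.card := by exact_mod_cast h1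
  calc density Q (p ^ k) = rho Q (p ^ k) / ((p : ℝ) ^ k) ^ 2 := by unfold density; push_cast; rfl
    _ ≤ (rhoTildePrimePow Q p k + S.card) / ((p : ℝ) ^ k) ^ 2 := by gcongr
    _ = rhoTildePrimePow Q p k / ((p : ℝ) ^ k) ^ 2 + S.card / ((p : ℝ) ^ k) ^ 2 := by ring
    _ ≤ _ := by gcongr

/-- Schwartz–Zippel. -/
lemma rho_prime_le {Q : MvPolynomial (Fin 2) ℤ} {p : ℕ} (hp : p.Prime)
    (hQ : ¬ MvPolynomial.C (p : ℤ) ∣ Q) : rho Q p ≤ Q.totalDegree * p := by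
  classical
  have : Fact p.Prime := ⟨hp⟩
  rw [MvPolynomial.C_dvd_iff_zmod] at hQ
  have h1 := MvPolynomial.schwartz_zippel_totalDegree hQ Finset.univ
  have hdeg : (MvPolynomial.map (Int.castRingHom (ZMod p)) Q).totalDegree ≤ Q.totalDegree := by
    unfold MvPolynomial.totalDegree
    exact Finset.sup_mono (MvPolynomial.support_map_subset _ _)
  have hp0 : (0 : ℚ≥0) < p := by exact_mod_cast hp.pos
  rw [Finset.card_univ, ZMod.card, div_le_div_iff₀ (by positivity) hp0] at h1
  have h2 : rho Q p ≤ (Finset.filter (fun f : Fin 2 → ZMod p => MvPolynomial.eval f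
      (MvPolynomial.map (Int.castRingHom (ZMod p)) Q) = 0)
      (Fintype.piFinset fun _ => Finset.univ)).card := by
    rw [rho_eq]
    apply Finset.card_le_card_of_injOn (fun v => ![v.1, v.2])
    · intro v hv
      have := (Finset.mem_filter.1 hv).2
      refine Finset.mem_coe.2 (Finset.mem_filter.2 ⟨by simp, ?_⟩)
      rw [MvPolynomial.eval_map]
      exact this
    · intro v _ w _ h
      have h0 := congrFun h 0
      have h1 := congrFun h 1
      simp at h0 h1
      exact Prod.ext h0 h1
  have h3 : (rho Q p : ℚ≥0) * p ≤ Q.totalDegree * p * p := by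
    calc (rho Q p : ℚ≥0) * p ≤ _ * p := by gcongr
      _ ≤ _ := h1
      _ ≤ Q.totalDegree * (p : ℚ≥0) ^ 2 := by gcongr
      _ = _ := by ring
  have h4 := le_of_mul_le_mul_right h3 hp0
  exact_mod_cast h4

/-! ### The density of the points modulo `p ^ l` tends to zero -/

/-- Split off one approximate root `x₀`. At another root `x`, fewer than `j` factors `p` of the
value can sit in `x - x₀`, so the quotient by `X - x₀` is divisible by the power with exponent
lowered by `j`. After `d` such divisions only the coefficient of degree `d` remains. -/
lemma pow_dvd_coeff_of_roots {p j : ℕ} (hp : p.Prime) :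
    ∀ (d l : ℕ) (P : Polynomial ℤ) (s : Finset ℤ), P.natDegree ≤ d → s.card = d + 1 →
      (∀ x ∈ s, ∀ y ∈ s, x ≠ y → ¬ (p : ℤ) ^ j ∣ x - y) →
      (∀ x ∈ s, (p : ℤ) ^ (j * d + l) ∣ P.eval x) → (p : ℤ) ^ l ∣ P.coeff d := by
  intro d
  induction d with
  | zero =>
    intro l P s hP hs _ hroot
    obtain ⟨x, hx⟩ := Finset.card_pos.1 (by omega : 0 < s.card)
    have h1 := hroot x hx
    rw [Polynomial.eq_C_of_natDegree_le_zero hP] at h1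
    simpa using h1
  | succ d ih =>
    intro l P s hP hs hdist hroot
    obtain ⟨x₀, hx₀⟩ := Finset.card_pos.1 (by omega : 0 < s.card)
    set G := P /ₘ (Polynomial.X - Polynomial.C x₀) with hG
    have hmon := Polynomial.monic_X_sub_C x₀
    have hPG : P = Polynomial.C (P.eval x₀) + (Polynomial.X - Polynomial.C x₀) * G := by
      rw [hG, ← Polynomial.modByMonic_X_sub_C_eq_C_eval]
      exact (Polynomial.modByMonic_add_div P (Polynomial.X - Polynomial.C x₀)).symm
    have hGdeg : G.natDegree ≤ d := by
      rw [hG, Polynomial.natDegree_divByMonic P hmon, Polynomial.natDegree_X_sub_C]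
      omega
    have hcoeff : P.coeff (d + 1) = G.coeff d := by
      conv_lhs => rw [hPG]
      rw [Polynomial.coeff_add, Polynomial.coeff_C_succ, zero_add, sub_mul, Polynomial.coeff_sub,
        Polynomial.coeff_X_mul, Polynomial.coeff_C_mul,
        Polynomial.coeff_eq_zero_of_natDegree_lt (by omega : G.natDegree < d + 1)]
      ring
    rw [hcoeff]
    refine ih l G (s.erase x₀) hGdeg (by rw [Finset.card_erase_of_mem hx₀, hs]; rfl)
      (fun x hx y hy => hdist x (Finset.mem_of_mem_erase hx) y (Finset.mem_of_mem_erase hy)) ?_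
    intro x hx
    have hxs := Finset.mem_of_mem_erase hx
    have h1 := dvd_sub (hroot x hxs) (hroot x₀ hx₀)
    have h2 : P.eval x - P.eval x₀ = (x - x₀) * G.eval x := by
      conv_lhs => rw [hPG]
      simp
    rw [h2] at h1
    have h3 := hdist x hxs x₀ hx₀ (Finset.ne_of_mem_erase hx)
    have hp' := Nat.prime_iff_prime_int.1 hp
    have h4 : j * (d + 1) + l + 1 = j + (j * d + l + 1) := by ring
    have h5 : (p : ℤ) ^ (j + (j * d + l) - j) ∣ G.eval x := by
      by_contra hcon
      have hcon' : ¬ (p : ℤ) ^ (j * d + l) ∣ G.eval x := by rwa [Nat.add_sub_cancel_left] at hcon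
      -- multiplicities
      have hfin : ∀ a : ℤ, ∀ n : ℕ, ¬ (p : ℤ) ^ n ∣ a → FiniteMultiplicity (p : ℤ) a := by
        intro a n hn
        rw [Int.finiteMultiplicity_iff]
        refine ⟨by simpa using hp.ne_one, ?_⟩
        rintro rfl
        exact hn (dvd_zero _)
      have hm1 := hfin _ _ h3
      have hm2 := hfin _ _ hcon'
      have h6 := (hm1.pow_dvd_iff_le_multiplicity).not.1 h3
      have h7 := (hm2.pow_dvd_iff_le_multiplicity).not.1 hcon'
      have hm3 : FiniteMultiplicity (p : ℤ) ((x - x₀) * G.eval x) :=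
        hp'.finiteMultiplicity_mul hm1 hm2
      have h8 := (hm3.pow_dvd_iff_le_multiplicity).1 h1
      rw [multiplicity_mul hp' hm3] at h8
      have : j * (d + 1) = j * d + j := by ring
      omega
    rwa [Nat.add_sub_cancel_left] at h5

open Classical in
-- The roots occupy at most `d` classes modulo `p ^ j`: otherwise `d + 1` representatives from
-- distinct classes would force `p ^ l` to divide the coefficient of degree `d`.
lemma card_roots_mod_le {p : ℕ} (hp : p.Prime) (d j l n : ℕ) (hn : n = p ^ (j * d + l + j))
    (P : Polynomial ℤ) (hP : P.natDegree ≤ d) (hl : ¬ (p : ℤ) ^ l ∣ P.coeff d) [NeZero n] :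
    (Finset.univ.filter fun t : ZMod n =>
      ((P.eval (t.val : ℤ) : ℤ) : ZMod n) = 0).card * p ^ j ≤ d * n := by
  have : NeZero (p ^ j) := ⟨pow_ne_zero _ hp.ne_zero⟩
  have hdvd : p ^ j ∣ n := hn ▸ pow_dvd_pow p (by omega)
  set f : ZMod n →+ ZMod (p ^ j) := (ZMod.castHom hdvd (ZMod (p ^ j))).toAddMonoidHom with hf
  have hfs : Function.Surjective f := ZMod.castHom_surjective hdvd
  set R := Finset.univ.filter fun t : ZMod n => ((P.eval (t.val : ℤ) : ℤ) : ZMod n) = 0 with hR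
  have h1 := card_preimage_mul f hfs (R.image f)
  rw [ZMod.card, ZMod.card] at h1
  have h2 : R.card ≤ (Finset.univ.filter fun x => f x ∈ R.image f).card := by
    apply Finset.card_le_card
    intro t ht
    exact Finset.mem_filter.2 ⟨Finset.mem_univ _, Finset.mem_image_of_mem f ht⟩
  have h3 : (R.image f).card ≤ d := by
    by_contra hcon
    push Not at hcon
    obtain ⟨I, hI, hIc⟩ := Finset.exists_subset_card_eq (by omega : d + 1 ≤ (R.image f).card)
    have hch : ∀ y ∈ I, ∃ t ∈ R, f t = y := fun y hy => Finset.mem_image.1 (hI hy)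
    choose! t ht hty using hch
    have hval : ∀ y ∈ I, (((t y).val : ℤ) : ZMod (p ^ j)) = y := by
      intro y hy
      have h5 : f (t y) = (((t y).val : ℤ) : ZMod (p ^ j)) := by
        simp [hf, ZMod.natCast_val]
      rw [← h5, hty y hy]
    have hinj : Set.InjOn (fun y => ((t y).val : ℤ)) I := by
      intro y hy z hz hyz
      simp only at hyz
      rw [← hval y hy, ← hval z hz, hyz]
    apply hl
    refine pow_dvd_coeff_of_roots (j := j) hp d l P (I.image fun y => ((t y).val : ℤ)) hP
      (by rw [Finset.card_image_of_injOn hinj, hIc]) ?_ ?_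
    · intro x hx y hy hxy hdv
      obtain ⟨a, ha, rfl⟩ := Finset.mem_image.1 hx
      obtain ⟨b, hb, rfl⟩ := Finset.mem_image.1 hy
      apply hxy
      have h6 : a = b := by
        rw [← hval a ha, ← hval b hb, eq_comm, ZMod.intCast_eq_intCast_iff_dvd_sub]
        exact_mod_cast hdv
      rw [h6]
    · intro x hx
      obtain ⟨a, ha, rfl⟩ := Finset.mem_image.1 hx
      have h7 := (Finset.mem_filter.1 (ht a ha)).2
      rw [ZMod.intCast_zmod_eq_zero_iff_dvd] at h7
      refine dvd_trans ?_ h7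
      rw [hn]
      push_cast
      exact pow_dvd_pow _ (by omega)
  calc R.card * p ^ j ≤ (Finset.univ.filter fun x => f x ∈ R.image f).card * p ^ j :=
        Nat.mul_le_mul_right _ h2
    _ = (R.image f).card * n := h1
    _ ≤ d * n := Nat.mul_le_mul_right _ h3

/-- The restriction of `Q` to the line through `u` with direction `w`. -/
noncomputable def lineRestrict (Q : MvPolynomial (Fin 2) ℤ) (u w : ℤ × ℤ) : Polynomial ℤ :=
  MvPolynomial.aeval ![Polynomial.C u.1 + Polynomial.C w.1 * Polynomial.X,
    Polynomial.C u.2 + Polynomial.C w.2 * Polynomial.X] Q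

lemma eval_lineRestrict (Q : MvPolynomial (Fin 2) ℤ) (u w : ℤ × ℤ) (t : ℤ) :
    (lineRestrict Q u w).eval t = value Q (u.1 + w.1 * t, u.2 + w.2 * t) := by
  unfold lineRestrict value
  induction Q using MvPolynomial.induction_on with
  | C a => simp
  | add p q hp hq => simp only [map_add, Polynomial.eval_add, hp, hq]
  | mul_X p i hp =>
    simp only [map_mul, Polynomial.eval_mul, hp, MvPolynomial.aeval_X, MvPolynomial.eval_X]
    fin_cases i <;> simp

lemma natDegree_linear_le (a b : ℤ) :
    (Polynomial.C a + Polynomial.C b * Polynomial.X).natDegree ≤ 1 := by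
  rw [add_comm]; exact Polynomial.natDegree_linear_le

lemma natDegree_prod_linear_le (u w : ℤ × ℤ) (m n : ℕ) :
    ((Polynomial.C u.1 + Polynomial.C w.1 * Polynomial.X) ^ m *
      (Polynomial.C u.2 + Polynomial.C w.2 * Polynomial.X) ^ n).natDegree ≤ m + n := by
  refine Polynomial.natDegree_mul_le.trans (add_le_add ?_ ?_)
  · refine Polynomial.natDegree_pow_le.trans ?_
    nlinarith [natDegree_linear_le u.1 w.1]
  · refine Polynomial.natDegree_pow_le.trans ?_
    nlinarith [natDegree_linear_le u.2 w.2]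

lemma coeff_prod_linear (u w : ℤ × ℤ) (m n : ℕ) :
    ((Polynomial.C u.1 + Polynomial.C w.1 * Polynomial.X) ^ m *
      (Polynomial.C u.2 + Polynomial.C w.2 * Polynomial.X) ^ n).coeff (m + n) =
      w.1 ^ m * w.2 ^ n := by
  have h : ∀ (a b : ℤ) (m : ℕ), ((Polynomial.C a + Polynomial.C b * Polynomial.X) ^ m).natDegree ≤ m
      ∧ ((Polynomial.C a + Polynomial.C b * Polynomial.X) ^ m).coeff m = b ^ m := by
    intro a b m
    constructor
    · refine Polynomial.natDegree_pow_le.trans ?_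
      nlinarith [natDegree_linear_le a b]
    · have := Polynomial.coeff_pow_of_natDegree_le (m := m) (natDegree_linear_le a b)
      rw [mul_one] at this
      rw [this, Polynomial.coeff_add, Polynomial.coeff_C_mul, Polynomial.coeff_X_one,
        Polynomial.coeff_C_succ, zero_add, mul_one]
  rw [Polynomial.coeff_mul_add_eq_of_natDegree_le (h u.1 w.1 m).1 (h u.2 w.2 n).1,
    (h u.1 w.1 m).2, (h u.2 w.2 n).2]

lemma lineRestrict_eq_sum (Q : MvPolynomial (Fin 2) ℤ) (u w : ℤ × ℤ) :
    lineRestrict Q u w = ∑ m ∈ Q.support, Polynomial.C (Q.coeff m) *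
      ((Polynomial.C u.1 + Polynomial.C w.1 * Polynomial.X) ^ m 0 *
      (Polynomial.C u.2 + Polynomial.C w.2 * Polynomial.X) ^ m 1) := by
  unfold lineRestrict
  rw [MvPolynomial.aeval_def, MvPolynomial.eval₂_eq']
  refine Finset.sum_congr rfl fun m _ => ?_
  rw [Fin.prod_univ_two]
  simp

lemma degree_fin_two (m : Fin 2 →₀ ℕ) : Finsupp.degree m = m 0 + m 1 := by
  rw [Finsupp.degree_eq_sum, Fin.sum_univ_two]

lemma le_totalDegree_fin_two {Q : MvPolynomial (Fin 2) ℤ} {m : Fin 2 →₀ ℕ} (hm : m ∈ Q.support) :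
    m 0 + m 1 ≤ Q.totalDegree := by
  have := MvPolynomial.le_totalDegree hm
  rwa [Finsupp.sum_fintype _ _ (fun _ => rfl), Fin.sum_univ_two] at this

lemma natDegree_lineRestrict_le (Q : MvPolynomial (Fin 2) ℤ) (u w : ℤ × ℤ) :
    (lineRestrict Q u w).natDegree ≤ Q.totalDegree := by
  rw [lineRestrict_eq_sum]
  refine Polynomial.natDegree_sum_le_of_forall_le _ _ fun m hm => ?_
  refine (Polynomial.natDegree_C_mul_le _ _).trans ?_
  exact (natDegree_prod_linear_le u w _ _).trans (le_totalDegree_fin_two hm)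

lemma coeff_lineRestrict (Q : MvPolynomial (Fin 2) ℤ) (u w : ℤ × ℤ) :
    (lineRestrict Q u w).coeff Q.totalDegree =
      value (MvPolynomial.homogeneousComponent Q.totalDegree Q) w := by
  rw [lineRestrict_eq_sum, Polynomial.finsetSum_coeff, value,
    MvPolynomial.homogeneousComponent_apply, map_sum, Finset.sum_filter]
  refine Finset.sum_congr rfl fun m hm => ?_
  rw [Polynomial.coeff_C_mul, degree_fin_two]
  have hle := le_totalDegree_fin_two hm
  split_ifs with h
  · rw [← h, coeff_prod_linear, MvPolynomial.eval_monomial, Finsupp.prod_fintype _ _ (by simp),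
      Fin.prod_univ_two]
    simp
  · rw [Polynomial.coeff_eq_zero_of_natDegree_lt, mul_zero]
    exact (natDegree_prod_linear_le u w _ _).trans_lt (lt_of_le_of_ne hle h)

lemma exists_direction {Q : MvPolynomial (Fin 2) ℤ} (hQ : Q ≠ 0) :
    ∃ w : ℤ × ℤ, value (MvPolynomial.homogeneousComponent Q.totalDegree Q) w ≠ 0 := by
  by_contra hcon
  push Not at hcon
  have h0 : MvPolynomial.homogeneousComponent Q.totalDegree Q = 0 := by
    apply MvPolynomial.funext
    intro x
    have := hcon (x 0, x 1)
    unfold value at this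
    rw [map_zero, ← this]
    congr 2
    funext i
    fin_cases i <;> rfl
  obtain ⟨m, hm, hdeg⟩ := Finset.exists_mem_eq_sup Q.support
    (MvPolynomial.support_nonempty.2 hQ) (fun s => s.sum fun _ e => e)
  have h1 := MvPolynomial.coeff_homogeneousComponent Q.totalDegree Q m
  rw [h0, MvPolynomial.coeff_zero, if_pos] at h1
  · exact MvPolynomial.mem_support_iff.1 hm h1.symm
  · change _ = Q.support.sup fun s => s.sum fun _ e => e
    rw [hdeg, Finsupp.degree_eq_sum, Finsupp.sum_fintype _ _ (fun _ => rfl)]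

/-- Slice the plane by the translates of a line along whose direction the leading form of `Q` does
not vanish. On every slice the coefficient of degree `deg Q` is the same nonzero integer `c`, so the
root count applies uniformly, and averaging over the translates gives the density. -/
lemma exists_density_le {Q : MvPolynomial (Fin 2) ℤ} (hQ : Q ≠ 0) {p : ℕ} (hp : p.Prime) (j : ℕ) :
    ∃ L : ℕ, density Q (p ^ L) ≤ Q.totalDegree / (p : ℝ) ^ j := by
  classical
  obtain ⟨w, hw⟩ := exists_direction hQ
  set c := value (MvPolynomial.homogeneousComponent Q.totalDegree Q) w with hc
  set d := Q.totalDegree with hd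
  obtain ⟨l, hl⟩ : ∃ l : ℕ, ¬ (p : ℤ) ^ l ∣ c := by
    have hfin : FiniteMultiplicity (p : ℤ) c := by
      rw [Int.finiteMultiplicity_iff]
      exact ⟨by simpa using hp.ne_one, hw⟩
    obtain ⟨n, hn⟩ := hfin
    exact ⟨n + 1, hn⟩
  set n := p ^ (j * d + l + j) with hn
  have : NeZero n := ⟨pow_ne_zero _ hp.ne_zero⟩
  refine ⟨j * d + l + j, ?_⟩
  rw [← hn]
  have hline : ∀ u : ZMod n × ZMod n, (Finset.univ.filter fun t : ZMod n =>
      IsPoint Q n (u + (t * (w.1 : ZMod n), t * (w.2 : ZMod n)))).card * p ^ j ≤ d * n := by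
    intro u
    obtain ⟨u, rfl⟩ := red_surjective n u
    have h1 := card_roots_mod_le hp d j l n hn (lineRestrict Q u w) (natDegree_lineRestrict_le Q u w)
      (by rw [coeff_lineRestrict]; exact hl)
    refine le_trans (le_of_eq ?_) h1
    congr 2
    ext t
    simp only [Finset.mem_filter, Finset.mem_univ, true_and]
    have h2 : red n u + (t * (w.1 : ZMod n), t * (w.2 : ZMod n)) =
        red n (u.1 + w.1 * t.val, u.2 + w.2 * t.val) := by
      have ht : ((t.val : ℤ) : ZMod n) = t := by rw [Int.cast_natCast, ZMod.natCast_zmod_val]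
      simp only [red, Prod.mk_add_mk, Int.cast_add, Int.cast_mul, ht]
      rw [mul_comm t, mul_comm t]
    rw [h2, isPoint_red, eval_lineRestrict, ZMod.intCast_zmod_eq_zero_iff_dvd]
  have hsum : ∑ u : ZMod n × ZMod n, (Finset.univ.filter fun t : ZMod n =>
      IsPoint Q n (u + (t * (w.1 : ZMod n), t * (w.2 : ZMod n)))).card = n * rho Q n := by
    simp only [Finset.card_filter]
    rw [Finset.sum_comm]
    have h3 : ∀ t : ZMod n, ∑ u : ZMod n × ZMod n,
        (if IsPoint Q n (u + (t * (w.1 : ZMod n), t * (w.2 : ZMod n))) then 1 else 0) =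
        rho Q n := by
      intro t
      rw [rho_eq, Finset.card_filter]
      exact Fintype.sum_equiv (Equiv.addRight (t * (w.1 : ZMod n), t * (w.2 : ZMod n))) _ _
        fun u => rfl
    simp only [h3, Finset.sum_const, Finset.card_univ, ZMod.card, smul_eq_mul]
  have h4 : n * rho Q n * p ^ j ≤ n * n * (d * n) := by
    rw [← hsum, Finset.sum_mul]
    refine (Finset.sum_le_sum fun u _ => hline u).trans ?_
    rw [Finset.sum_const, Finset.card_univ, Fintype.card_prod, ZMod.card, smul_eq_mul]
  have hp0 : (0 : ℝ) < p := by exact_mod_cast hp.pos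
  have hn0 : (0 : ℝ) < n := by exact_mod_cast Nat.pos_of_ne_zero (NeZero.ne n)
  unfold density
  rw [div_le_div_iff₀ (by positivity) (by positivity)]
  have h5 : (n : ℝ) * rho Q n * p ^ j ≤ n * n * (d * n) := by exact_mod_cast h4
  have h6 : (n : ℝ) * (rho Q n * p ^ j) ≤ n * (d * n ^ 2) := by nlinarith
  exact le_of_mul_le_mul_left h6 hn0

lemma rhoTilde_prime_pow (Q : MvPolynomial (Fin 2) ℤ) {p k : ℕ} (hp : p.Prime) (hk : k ≠ 0) :
    rhoTilde Q (p ^ k) = rhoTildePrimePow Q p k := by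
  unfold rhoTilde
  rw [Nat.primeFactors_prime_pow hk hp, Finset.prod_singleton, hp.factorization_pow,
    Finsupp.single_eq_same]

lemma rhoTilde_one (Q : MvPolynomial (Fin 2) ℤ) : rhoTilde Q 1 = 1 := by
  simp [rhoTilde]

lemma rhoTilde_mul (Q : MvPolynomial (Fin 2) ℤ) {m n : ℕ} (h : m.Coprime n) :
    rhoTilde Q (m * n) = rhoTilde Q m * rhoTilde Q n := by
  unfold rhoTilde
  rw [h.primeFactors_mul, Finset.prod_union h.disjoint_primeFactors]
  congr 1
  · refine Finset.prod_congr rfl fun p hp => ?_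
    rw [Nat.factorization_eq_of_coprime_left h (Nat.mem_primeFactors_iff_mem_primeFactorsList.1 hp)]
  · refine Finset.prod_congr rfl fun p hp => ?_
    rw [Nat.factorization_eq_of_coprime_right h (Nat.mem_primeFactors_iff_mem_primeFactorsList.1 hp)]

/-- The hypothesis on the growth of `ρ̃_Q` at the prime powers. -/
def RhoBound (C r : ℝ) (Q : MvPolynomial (Fin 2) ℤ) : Prop :=
  ∀ p k : ℕ, p.Prime → 1 ≤ k → (rhoTilde Q (p ^ k) : ℝ) ≤ C * (p : ℝ) ^ ((k : ℝ) * (2 - r))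

lemma RhoBound.div_le {C r : ℝ} {Q : MvPolynomial (Fin 2) ℤ} (h : RhoBound C r Q) {p k : ℕ}
    (hp : p.Prime) (hk : 1 ≤ k) :
    (rhoTilde Q (p ^ k) : ℝ) / ((p : ℝ) ^ k) ^ 2 ≤ C * (p : ℝ) ^ (-(r * k)) := by
  have hp0 : (0 : ℝ) < p := by exact_mod_cast hp.pos
  rw [div_le_iff₀ (by positivity)]
  refine (h p k hp hk).trans (le_of_eq ?_)
  rw [mul_assoc, ← pow_mul, ← Real.rpow_natCast, ← Real.rpow_add hp0]
  push_cast
  ring_nf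

/-- Iterating `density_le_add` bounds the density by `∑ C p ^ (-r(k + i))` plus the density at a far
level. The series is dominated by a geometric one of ratio `2 ^ (-r)`, and the far density is
arbitrarily small by `exists_density_le`. -/
lemma RhoBound.density_le {C r : ℝ} {Q : MvPolynomial (Fin 2) ℤ} (hC : 0 ≤ C) (hr : 0 < r)
    (h : RhoBound C r Q) (hQ : Q ≠ 0) {p k : ℕ} (hp : p.Prime) (hk : 1 ≤ k) :
    density Q (p ^ k) ≤ C * (1 - (2 : ℝ) ^ (-r))⁻¹ * (p : ℝ) ^ (-(r * k)) := by
  have hp0 : (0 : ℝ) < p := by exact_mod_cast hp.pos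
  have hp2 : (2 : ℝ) ≤ p := by exact_mod_cast hp.two_le
  have : NeZero p := ⟨hp.ne_zero⟩
  have h2r : (2 : ℝ) ^ (-r) < 1 := Real.rpow_lt_one_of_one_lt_of_neg (by norm_num) (by linarith)
  have h2r0 : 0 < (2 : ℝ) ^ (-r) := by positivity
  have hstep : ∀ m : ℕ, density Q (p ^ k) ≤
      ∑ i ∈ Finset.range m, C * (p : ℝ) ^ (-(r * k)) * ((2 : ℝ) ^ (-r)) ^ i +
        density Q (p ^ (k + m)) := by
    intro m
    induction m with
    | zero => simp
    | succ m ih =>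
      have h1 := density_le_add Q hp (k := k + m) (by omega)
      rw [← rhoTilde_prime_pow Q hp (by omega)] at h1
      have h2 := h.div_le hp (k := k + m) (by omega)
      have h3 : (p : ℝ) ^ (-(r * ((k + m : ℕ) : ℝ))) ≤
          (p : ℝ) ^ (-(r * k)) * ((2 : ℝ) ^ (-r)) ^ m := by
        have h4 : -(r * ((k + m : ℕ) : ℝ)) = -(r * k) + -(r * m) := by push_cast; ring
        rw [h4, Real.rpow_add hp0]
        gcongr
        rw [← Real.rpow_natCast, ← Real.rpow_mul (by norm_num), neg_mul]
        exact Real.rpow_le_rpow_of_nonpos (by norm_num) hp2 (by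
          have : 0 ≤ r * m := by positivity
          linarith)
      rw [Finset.sum_range_succ, ← add_assoc k m 1]
      have h5 : C * (p : ℝ) ^ (-(r * ((k + m : ℕ) : ℝ))) ≤
          C * (p : ℝ) ^ (-(r * k)) * ((2 : ℝ) ^ (-r)) ^ m := by
        rw [mul_assoc]; gcongr
      linarith
  have hgeom : ∀ m : ℕ, ∑ i ∈ Finset.range m, C * (p : ℝ) ^ (-(r * k)) * ((2 : ℝ) ^ (-r)) ^ i ≤
      C * (1 - (2 : ℝ) ^ (-r))⁻¹ * (p : ℝ) ^ (-(r * k)) := by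
    intro m
    rw [← Finset.mul_sum]
    have h1 := hasSum_geometric_of_lt_one h2r0.le h2r
    have h2 := sum_le_hasSum (Finset.range m) (fun i _ => pow_nonneg h2r0.le i) h1
    calc C * (p : ℝ) ^ (-(r * k)) * ∑ i ∈ Finset.range m, ((2 : ℝ) ^ (-r)) ^ i
        ≤ C * (p : ℝ) ^ (-(r * k)) * (1 - (2 : ℝ) ^ (-r))⁻¹ := by gcongr
      _ = _ := by ring
  apply le_of_forall_pos_le_add
  intro e he
  obtain ⟨j, hj⟩ := exists_nat_gt (Q.totalDegree / e)
  obtain ⟨L, hL⟩ := exists_density_le hQ hp j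
  have h1 := hstep L
  have h2 : density Q (p ^ (k + L)) ≤ density Q (p ^ L) :=
    density_le_of_dvd Q (pow_dvd_pow p (by omega))
  have h3 : (Q.totalDegree : ℝ) / (p : ℝ) ^ j ≤ e := by
    have h4 : (j : ℝ) ≤ (p : ℝ) ^ j := by
      have : j < p ^ j := Nat.lt_pow_self hp.one_lt
      exact_mod_cast this.le
    rw [div_le_iff₀ (by positivity)]
    rw [div_lt_iff₀ he] at hj
    nlinarith
  linarith [hgeom L]

lemma density_eq_one_of_dvd {Q : MvPolynomial (Fin 2) ℤ} {p : ℕ} (hp : p.Prime)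
    (h : MvPolynomial.C (p : ℤ) ∣ Q) : density Q p = 1 := by
  classical
  have : NeZero p := ⟨hp.ne_zero⟩
  have h1 : rho Q p = p * p := by
    rw [rho_eq, Finset.filter_true_of_mem, Finset.card_univ, Fintype.card_prod, ZMod.card]
    intro v _
    obtain ⟨v, rfl⟩ := red_surjective p v
    rw [isPoint_red]
    obtain ⟨R, rfl⟩ := h
    exact ⟨value R v, by simp [value]⟩
  have hp0 : (0 : ℝ) < p := by exact_mod_cast hp.pos
  unfold density
  rw [h1]
  push_cast
  field_simp

lemma density_prime_le {Q : MvPolynomial (Fin 2) ℤ} {p : ℕ} (hp : p.Prime)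
    (hQ : ¬ MvPolynomial.C (p : ℤ) ∣ Q) : density Q p ≤ Q.totalDegree / p := by
  have hp0 : (0 : ℝ) < p := by exact_mod_cast hp.pos
  have h : (rho Q p : ℝ) ≤ Q.totalDegree * p := by exact_mod_cast rho_prime_le hp hQ
  unfold density
  rw [div_le_div_iff₀ (by positivity) hp0]
  nlinarith

/-- The summand `f(a) ρ̃_Q(a) / a ^ 2`. -/
noncomputable def weight (Q : MvPolynomial (Fin 2) ℤ) (f : ℕ → ℝ) (a : ℕ) : ℝ :=
  f a * (rhoTilde Q a : ℝ) / (a : ℝ) ^ 2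

lemma nonnegMul_weight (Q : MvPolynomial (Fin 2) ℤ) {f : ℕ → ℝ} (hf : NonnegMul f) :
    NonnegMul (weight Q f) where
  one := by simp [weight, hf.one, rhoTilde_one]
  nonneg n := div_nonneg (mul_nonneg (hf.nonneg n) (by positivity)) (by positivity)
  mul m n h := by
    unfold weight
    rw [hf.mul m n h, rhoTilde_mul Q h]
    push_cast
    rw [div_mul_div_comm]
    ring

lemma IsOfClassM.nonnegMul {A B ε : ℝ} {f : ArithmeticFunction ℝ} (hf : IsOfClassM A B ε f) :
    NonnegMul f where
  one := hf.isMultiplicative.map_one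
  nonneg := hf.nonneg
  mul _ _ h := hf.isMultiplicative.map_mul_of_coprime h

lemma IsOfClassM.prime_pow_le {A B ε : ℝ} {f : ArithmeticFunction ℝ} (hf : IsOfClassM A B ε f)
    {p : ℕ} (hp : p.Prime) (k : ℕ) : f (p ^ k) ≤ A ^ k ∧ f (p ^ k) ≤ B * (p : ℝ) ^ (ε * k) := by
  have h := hf.le_min (p ^ k) (pow_pos hp.pos k)
  rw [le_min_iff, ArithmeticFunction.cardFactors_apply_prime_pow hp] at h
  refine ⟨h.1, h.2.trans (le_of_eq ?_)⟩
  push_cast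
  rw [← Real.rpow_natCast, ← Real.rpow_mul (by positivity), mul_comm ε]

/-- The decay in `k` comes from `f(p ^ k) ≤ B p ^ (εk)` and the hypothesis on `ρ̃_Q`. For the bound
`c/p` there are three cases. If `p` divides `Q`, the density at `p` is `1`, so `p ^ r ≤ C'` and `p`
is bounded. If `(r - ε) k ≥ 1`, the decay already suffices. Otherwise `k` is bounded, so `f(p ^ k) ≤
A ^ k` is bounded and Schwartz–Zippel supplies `d/p`. -/
lemma exists_tame_weight (A B ε C r : ℝ) (d : ℕ) (hA : 1 ≤ A) (hB : 0 < B) (hC : 0 < C)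
    (hr : 0 < r) (hεr : ε < r) :
    ∃ c : ℝ, 0 ≤ c ∧ ∀ (Q : MvPolynomial (Fin 2) ℤ) (f : ArithmeticFunction ℝ), Q ≠ 0 →
      Q.totalDegree = d → RhoBound C r Q → IsOfClassM A B ε f →
      Tame c (r - ε) (weight Q f) := by
  have hγ : 0 < r - ε := by linarith
  have h2r : (2 : ℝ) ^ (-r) < 1 := Real.rpow_lt_one_of_one_lt_of_neg (by norm_num) (by linarith)
  set C' := C * (1 - (2 : ℝ) ^ (-r))⁻¹ with hC'
  have hC'0 : 0 ≤ C' := mul_nonneg hC.le (inv_nonneg.2 (by linarith))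
  set P₀ := C' ^ (1 / r) with hP₀
  have hP₀0 : 0 ≤ P₀ := by positivity
  have hA0 : 0 ≤ A ^ (1 / (r - ε)) * d := by positivity
  refine ⟨B * C + A ^ (1 / (r - ε)) * d + B * C * P₀, by positivity, ?_⟩
  intro Q f hQ hd hρ hf
  have hmain : ∀ p k : ℕ, p.Prime → 1 ≤ k →
      weight Q f (p ^ k) ≤ B * C * (p : ℝ) ^ (-((r - ε) * k)) := by
    intro p k hp hk
    have hp0 : (0 : ℝ) < p := by exact_mod_cast hp.pos
    unfold weight
    push_cast
    rw [mul_div_assoc]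
    calc f (p ^ k) * ((rhoTilde Q (p ^ k) : ℝ) / ((p : ℝ) ^ k) ^ 2)
        ≤ (B * (p : ℝ) ^ (ε * k)) * (C * (p : ℝ) ^ (-(r * k))) :=
          mul_le_mul (hf.prime_pow_le hp k).2 (hρ.div_le hp hk) (by positivity) (by positivity)
      _ = B * C * ((p : ℝ) ^ (ε * k) * (p : ℝ) ^ (-(r * k))) := by ring
      _ = _ := by
          rw [← Real.rpow_add hp0]
          ring_nf
  refine ⟨nonnegMul_weight Q hf.nonnegMul, ?_, ?_⟩
  · intro p k hp hk
    have hp0 : (0 : ℝ) < p := by exact_mod_cast hp.pos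
    have hp1 : (1 : ℝ) ≤ p := by exact_mod_cast hp.one_le
    have : NeZero p := ⟨hp.ne_zero⟩
    have hk0 : (1 : ℝ) ≤ k := by exact_mod_cast hk
    rw [le_div_iff₀ hp0]
    by_cases hdvd : MvPolynomial.C (p : ℤ) ∣ Q
    · have h1 := hρ.density_le hC.le hr hQ hp (k := 1) le_rfl
      rw [pow_one, density_eq_one_of_dvd hp hdvd, ← hC', Nat.cast_one, mul_one,
        Real.rpow_neg hp0.le, ← div_eq_mul_inv, one_le_div (by positivity)] at h1
      have h2 : (p : ℝ) ≤ P₀ := by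
        have := Real.rpow_le_rpow (by positivity) h1 (by positivity : 0 ≤ 1 / r)
        rwa [← Real.rpow_mul hp0.le, mul_one_div_cancel hr.ne', Real.rpow_one] at this
      have h3 : (p : ℝ) ^ (-((r - ε) * k)) ≤ 1 :=
        Real.rpow_le_one_of_one_le_of_nonpos hp1 (by
          have : 0 ≤ (r - ε) * k := by positivity
          linarith)
      calc weight Q f (p ^ k) * p ≤ (B * C * (p : ℝ) ^ (-((r - ε) * k))) * p := by
            gcongr; exact hmain p k hp hk
        _ ≤ (B * C * 1) * P₀ := by gcongr
        _ ≤ _ := by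
            have : 0 < B * C := by positivity
            linarith
    · by_cases hk1 : 1 ≤ (r - ε) * k
      · have h3 : (p : ℝ) ^ (-((r - ε) * k)) ≤ (p : ℝ) ^ (-1 : ℝ) :=
          Real.rpow_le_rpow_of_exponent_le hp1 (by linarith)
        calc weight Q f (p ^ k) * p ≤ (B * C * (p : ℝ) ^ (-1 : ℝ)) * p := by
              gcongr; exact (hmain p k hp hk).trans (by gcongr)
          _ = B * C := by rw [Real.rpow_neg_one]; field_simp
          _ ≤ _ := by
              have : 0 ≤ B * C * P₀ := by positivity
              linarith
      · push Not at hk1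
        have h4 : A ^ k ≤ A ^ (1 / (r - ε)) := by
          rw [← Real.rpow_natCast]
          apply Real.rpow_le_rpow_of_exponent_le hA
          rw [le_div_iff₀ hγ]
          linarith
        have h5 : (rhoTilde Q (p ^ k) : ℝ) / ((p : ℝ) ^ k) ^ 2 ≤ d / p := by
          calc (rhoTilde Q (p ^ k) : ℝ) / ((p : ℝ) ^ k) ^ 2 ≤ density Q (p ^ k) := by
                unfold density
                push_cast
                gcongr
                rw [rhoTilde_prime_pow Q hp (by omega)]
                exact_mod_cast rhoTildePrimePow_le_rho Q p k
            _ ≤ density Q p := density_le_of_dvd Q (dvd_pow_self p (by omega))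
            _ ≤ _ := by rw [← hd]; exact density_prime_le hp hdvd
        calc weight Q f (p ^ k) * p = f (p ^ k) * ((rhoTilde Q (p ^ k) : ℝ) / ((p : ℝ) ^ k) ^ 2) * p := by
              unfold weight; push_cast; ring
          _ ≤ A ^ (1 / (r - ε)) * (d / p) * p := by
              gcongr
              exact (hf.prime_pow_le hp k).1.trans h4
          _ = A ^ (1 / (r - ε)) * d := by field_simp
          _ ≤ _ := by
              have : 0 ≤ B * C * P₀ := by positivity
              have : 0 < B * C := by positivity
              linarith
  · intro p k hp hk
    refine (hmain p k hp hk).trans ?_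
    gcongr
    have : 0 ≤ B * C * P₀ := by positivity
    linarith

/-- Rankin's trick for `ρ̃_Q(a) / a ^ 2` over integers with bounded prime factors. -/
lemma exists_sum_smooth_le (C r β y : ℝ) (hC : 0 < C) (hβ : 0 ≤ β) (hβr : β < r) :
    ∃ K : ℝ, 0 < K ∧ ∀ (Q : MvPolynomial (Fin 2) ℤ), RhoBound C r Q → ∀ (T : ℝ), 0 < T →
      ∀ S : Finset ℕ, (∀ a ∈ S, a ≠ 0 ∧ T ≤ a ∧ ∀ p : ℕ, p.Prime → p ∣ a → (p : ℝ) ≤ y) →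
      ∑ a ∈ S, (rhoTilde Q a : ℝ) / (a : ℝ) ^ 2 ≤ K * T ^ (-β) := by
  set q := (2 : ℝ) ^ (-(r - β)) with hq
  have hq0 : 0 < q := by positivity
  have hq1 : q < 1 := Real.rpow_lt_one_of_one_lt_of_neg (by norm_num) (by linarith)
  -- A uniform bound for every local factor. The resulting power `M ^ π(y)` is affordable because
  -- `y` will be a constant; in return `β` may be any fixed number below `r`.
  set M := 1 + C * (1 - q)⁻¹ with hM
  have hM1 : 1 ≤ M := by
    have : 0 ≤ C * (1 - q)⁻¹ := mul_nonneg hC.le (inv_nonneg.2 (by linarith))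
    linarith
  refine ⟨M ^ (primesIoc 0 y).card, by positivity, fun Q hQ T hT S hS => ?_⟩
  have hone : NonnegMul (fun _ => (1 : ℝ)) := ⟨rfl, fun _ => zero_le_one, fun _ _ _ => (one_mul 1).symm⟩
  set G := weight Q (fun _ => 1) with hG
  have hGm : NonnegMul G := nonnegMul_weight Q hone
  have hGt := hGm.twist β
  have hbd : ∀ p k : ℕ, p.Prime → twist G β (p ^ (k + 1)) ≤ C * q ^ k := by
    intro p k hp
    have hp0 : (0 : ℝ) < p := by exact_mod_cast hp.pos
    have hp2 : (2 : ℝ) ≤ p := by exact_mod_cast hp.two_le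
    have h1 := hQ.div_le hp (k := k + 1) (by omega)
    have h2 : ((p ^ (k + 1) : ℕ) : ℝ) ^ β = (p : ℝ) ^ (β * ((k + 1 : ℕ) : ℝ)) := by
      push_cast
      rw [← Real.rpow_natCast, ← Real.rpow_mul hp0.le]
      push_cast
      ring_nf
    unfold twist
    rw [h2, hG, weight, one_mul]
    push_cast at h1 ⊢
    calc (rhoTilde Q (p ^ (k + 1)) : ℝ) / ((p : ℝ) ^ (k + 1)) ^ 2 * (p : ℝ) ^ (β * (k + 1 : ℝ))
        ≤ C * (p : ℝ) ^ (-(r * (k + 1 : ℝ))) * (p : ℝ) ^ (β * (k + 1 : ℝ)) := by gcongr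
      _ = C * (p : ℝ) ^ (-((r - β) * (k + 1))) := by
          rw [mul_assoc, ← Real.rpow_add hp0]; ring_nf
      _ ≤ C * (2 : ℝ) ^ (-((r - β) * (k + 1))) := by
          gcongr ?_ * ?_
          have h0 : 0 ≤ (r - β) * ((k : ℝ) + 1) := mul_nonneg (by linarith) (by positivity)
          exact Real.rpow_le_rpow_of_nonpos (by norm_num) hp2 (by linarith)
      _ ≤ C * (2 : ℝ) ^ (-((r - β) * k)) := by
          gcongr ?_ * ?_
          exact Real.rpow_le_rpow_of_exponent_le (by norm_num) (by linarith)
      _ = C * q ^ k := by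
          rw [hq, ← Real.rpow_natCast, ← Real.rpow_mul (by norm_num)]; ring_nf
  have hgeo := hasSum_geometric_of_lt_one hq0.le hq1
  have hs1 : ∀ p : ℕ, p.Prime → Summable fun k : ℕ => twist G β (p ^ (k + 1)) := fun p hp =>
    Summable.of_nonneg_of_le (fun k => hGt.nonneg _) (fun k => hbd p k hp) (hgeo.summable.mul_left C)
  have hs : ∀ p : ℕ, p.Prime → Summable fun k : ℕ => twist G β (p ^ k) := fun p hp =>
    (summable_nat_add_iff 1).1 (hs1 p hp)
  have hE : eulerProd (twist G β) y ≤ M ^ (primesIoc 0 y).card := by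
    unfold eulerProd
    rw [← Finset.prod_const]
    refine Finset.prod_le_prod (fun p _ => tsum_nonneg fun k => hGt.nonneg _) ?_
    intro p hp
    have hp := ((mem_primesIoc le_rfl).1 hp).1
    rw [(hs p hp).tsum_eq_zero_add, pow_zero, hGt.one, hM]
    gcongr
    have := Summable.tsum_le_tsum (fun k => hbd p k hp) (hs1 p hp) (hgeo.summable.mul_left C)
    rwa [tsum_mul_left, hgeo.tsum_eq] at this
  have h3 := hGt.sum_le_eulerProd (y := y) (fun p hp => hs p ((mem_primesIoc le_rfl).1 hp).1) S
    (fun a ha => ⟨(hS a ha).1, (hS a ha).2.2⟩)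
  calc ∑ a ∈ S, (rhoTilde Q a : ℝ) / (a : ℝ) ^ 2 ≤ ∑ a ∈ S, T ^ (-β) * twist G β a := by
        apply Finset.sum_le_sum
        intro a ha
        have h4 : T ^ β ≤ (a : ℝ) ^ β := Real.rpow_le_rpow hT.le (hS a ha).2.1 hβ
        have h5 : 1 ≤ T ^ (-β) * (a : ℝ) ^ β := by
          rw [Real.rpow_neg hT.le, inv_mul_eq_div, one_le_div (by positivity)]
          exact h4
        unfold twist
        rw [hG, weight, one_mul]
        calc (rhoTilde Q a : ℝ) / (a : ℝ) ^ 2 = (rhoTilde Q a : ℝ) / (a : ℝ) ^ 2 * 1 := (mul_one _).symm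
          _ ≤ (rhoTilde Q a : ℝ) / (a : ℝ) ^ 2 * (T ^ (-β) * (a : ℝ) ^ β) := by gcongr
          _ = _ := by ring
    _ = T ^ (-β) * ∑ a ∈ S, twist G β a := by rw [Finset.mul_sum]
    _ ≤ T ^ (-β) * M ^ (primesIoc 0 y).card := by gcongr; exact h3.trans hE
    _ = _ := by ring

/-! ### Counting points in residue classes -/

open Classical in
/-- `W` is equidistributed in the residue classes modulo `a` for `a ^ 2 ≤ N`. -/
def EquiDist (N R : ℝ) (W : Finset (ℤ × ℤ)) : Prop :=
  ∀ (a : ℕ) (v₀ : ℤ × ℤ), 0 < a → (a : ℝ) ^ 2 ≤ N →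
    |((W.filter fun v => red a v = red a v₀).card : ℝ) - N / (a : ℝ) ^ 2| ≤ R

lemma exists_red_eq {a b : ℕ} (h : a.Coprime b) (v w : ℤ × ℤ) :
    ∃ u : ℤ × ℤ, red a u = red a v ∧ red b u = red b w := by
  obtain ⟨s, t, hst⟩ := Nat.isCoprime_iff_coprime.2 h
  refine ⟨(v.1 * (t * b) + w.1 * (s * a), v.2 * (t * b) + w.2 * (s * a)), ?_, ?_⟩
  · refine red_eq_red_iff.2 ⟨⟨(w.1 - v.1) * s, ?_⟩, ⟨(w.2 - v.2) * s, ?_⟩⟩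
    · linear_combination v.1 * hst
    · linear_combination v.2 * hst
  · refine red_eq_red_iff.2 ⟨⟨(v.1 - w.1) * t, ?_⟩, ⟨(v.2 - w.2) * t, ?_⟩⟩
    · linear_combination w.1 * hst
    · linear_combination w.2 * hst

lemma red_mul_eq_iff {a b : ℕ} (h : a.Coprime b) {v w : ℤ × ℤ} :
    red (a * b) v = red (a * b) w ↔ red a v = red a w ∧ red b v = red b w := by
  have hc : IsCoprime (a : ℤ) b := Nat.isCoprime_iff_coprime.2 h
  simp only [red_eq_red_iff, Nat.cast_mul]
  constructor
  · rintro ⟨h1, h2⟩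
    exact ⟨⟨(dvd_mul_right _ _).trans h1, (dvd_mul_right _ _).trans h2⟩,
      (dvd_mul_left _ _).trans h1, (dvd_mul_left _ _).trans h2⟩
  · rintro ⟨⟨h1, h2⟩, h3, h4⟩
    exact ⟨hc.mul_dvd h1 h3, hc.mul_dvd h2 h4⟩

open Classical in
-- Adding a prime `p` to `T` splits the class modulo `a` into `ρ_Q(p)` classes modulo `ap` by the
-- Chinese remainder theorem. The main term acquires the factor `ρ_Q(p) / p ^ 2` and the error at
-- most the factor `p ^ 2`.
lemma EquiDist.abs_card_dvd_sub_le {N R : ℝ} {W : Finset (ℤ × ℤ)} (hW : EquiDist N R W)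
    (hR : 0 ≤ R) (Q : MvPolynomial (Fin 2) ℤ) (T : Finset ℕ) :
    ∀ (a : ℕ) (v₀ : ℤ × ℤ), 0 < a → (∀ p ∈ T, p.Prime ∧ ¬ p ∣ a) →
      ((a * ∏ p ∈ T, p : ℕ) : ℝ) ^ 2 ≤ N →
      |((W.filter fun v => red a v = red a v₀ ∧ ∀ p ∈ T, (p : ℤ) ∣ value Q v).card : ℝ) -
        N / (a : ℝ) ^ 2 * ∏ p ∈ T, density Q p| ≤ ((∏ p ∈ T, p : ℕ) : ℝ) ^ 2 * R := by
  induction T using Finset.induction_on with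
  | empty =>
    intro a v₀ ha _ haN
    simpa using hW a v₀ ha (by simpa using haN)
  | insert p T hpT ih =>
    intro a v₀ ha hT haN
    obtain ⟨hp, hpa⟩ := hT p (Finset.mem_insert_self p T)
    have hcop : a.Coprime p := (Nat.Coprime.symm ((Nat.Prime.coprime_iff_not_dvd hp).2 hpa))
    have : NeZero p := ⟨hp.ne_zero⟩
    have hp0 : (0 : ℝ) < p := by exact_mod_cast hp.pos
    have ha0 : (0 : ℝ) < a := by exact_mod_cast ha
    set S := Finset.univ.filter fun v : ZMod p × ZMod p => IsPoint Q p v with hS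
    have hch : ∀ c : ZMod p × ZMod p, ∃ u : ℤ × ℤ, red a u = red a v₀ ∧ red p u = c := by
      intro c
      obtain ⟨w, rfl⟩ := red_surjective p c
      exact exists_red_eq hcop v₀ w
    choose u hu1 hu2 using hch
    have hT' : ∀ q ∈ T, q.Prime ∧ ¬ q ∣ a * p := by
      intro q hq
      obtain ⟨hq1, hq2⟩ := hT q (Finset.mem_insert_of_mem hq)
      refine ⟨hq1, fun h => ?_⟩
      rcases hq1.dvd_mul.1 h with h | h
      · exact hq2 h
      · rw [(Nat.prime_dvd_prime_iff_eq hq1 hp).1 h] at hq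
        exact hpT hq
    have hprod : a * p * ∏ q ∈ T, q = a * ∏ q ∈ insert p T, q := by
      rw [Finset.prod_insert hpT]; ring
    have hcard : (W.filter fun v => red a v = red a v₀ ∧
        ∀ q ∈ insert p T, (q : ℤ) ∣ value Q v).card =
        ∑ c ∈ S, (W.filter fun v => red (a * p) v = red (a * p) (u c) ∧
          ∀ q ∈ T, (q : ℤ) ∣ value Q v).card := by
      rw [Finset.card_eq_sum_card_fiberwise (f := red p) (t := S)]
      · refine Finset.sum_congr rfl fun c hc => ?_
        congr 1
        ext v
        rw [Finset.mem_filter, Finset.mem_filter, Finset.mem_filter, red_mul_eq_iff hcop, hu1, hu2]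
        simp only [Finset.forall_mem_insert]
        constructor
        · rintro ⟨⟨h1, h2, h3, h4⟩, h5⟩
          exact ⟨h1, ⟨h2, h5⟩, h4⟩
        · rintro ⟨h1, ⟨h2, h5⟩, h4⟩
          refine ⟨⟨h1, h2, ?_, h4⟩, h5⟩
          rw [← isPoint_red, h5]
          exact (Finset.mem_filter.1 hc).2
      · intro v hv
        have := (Finset.mem_filter.1 (Finset.mem_coe.1 hv)).2.2 p (Finset.mem_insert_self p T)
        exact Finset.mem_coe.2 (Finset.mem_filter.2 ⟨Finset.mem_univ _, isPoint_red.2 this⟩)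
    have hih := fun c : ZMod p × ZMod p => ih (a * p) (u c) (Nat.mul_pos ha hp.pos) hT'
      (by rw [hprod]; exact haN)
    have hScard : (S.card : ℝ) = rho Q p := by rw [rho_eq]
    have hSle : (S.card : ℝ) ≤ (p : ℝ) ^ 2 := by
      have : S.card ≤ p * p := by
        refine (Finset.card_le_univ _).trans (le_of_eq ?_)
        rw [Fintype.card_prod, ZMod.card]
      rw [sq]; exact_mod_cast this
    rw [hcard]
    push_cast
    have hmain : N / (a : ℝ) ^ 2 * ∏ q ∈ insert p T, density Q q =
        ∑ c ∈ S, N / ((a * p : ℕ) : ℝ) ^ 2 * ∏ q ∈ T, density Q q := by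
      rw [Finset.sum_const, nsmul_eq_mul, hScard, Finset.prod_insert hpT]
      have : density Q p = rho Q p / (p : ℝ) ^ 2 := rfl
      rw [this]
      push_cast
      field_simp
    rw [hmain, ← Finset.sum_sub_distrib]
    refine (Finset.abs_sum_le_sum_abs _ _).trans ?_
    refine (Finset.sum_le_sum fun c _ => hih c).trans ?_
    rw [Finset.sum_const, nsmul_eq_mul, Finset.prod_insert hpT]
    push_cast
    calc (S.card : ℝ) * ((∏ q ∈ T, (q : ℝ)) ^ 2 * R)
        ≤ (p : ℝ) ^ 2 * ((∏ q ∈ T, (q : ℝ)) ^ 2 * R) := by gcongr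
      _ = _ := by ring

open Classical in
-- For `a ≤ N ^ η` the main term is at least `N ^ (1 - 2η)`, which dominates the error.
lemma EquiDist.card_le {N Cl η : ℝ} {W : Finset (ℤ × ℤ)}
    (hW : EquiDist N (Cl * N ^ (1 - 3 * η)) W) (hN : 1 ≤ N) (hCl : 0 < Cl) (hη0 : 0 < η)
    (hη : η < 1 / 2) {a : ℕ} (ha : 0 < a) (haN : (a : ℝ) ≤ N ^ η) (v₀ : ℤ × ℤ) :
    ((W.filter fun v => red a v = red a v₀).card : ℝ) ≤ (1 + Cl) * (N / (a : ℝ) ^ 2) := by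
  have ha0 : (0 : ℝ) < a := by exact_mod_cast ha
  have hN0 : 0 < N := by linarith
  have h1 : (a : ℝ) ^ 2 ≤ N ^ (2 * η) := by
    calc (a : ℝ) ^ 2 ≤ (N ^ η) ^ 2 := by gcongr
      _ = N ^ (2 * η) := by rw [← Real.rpow_natCast, ← Real.rpow_mul hN0.le]; push_cast; ring_nf
  have h2 : (a : ℝ) ^ 2 ≤ N := by
    refine h1.trans ?_
    conv_rhs => rw [← Real.rpow_one N]
    exact Real.rpow_le_rpow_of_exponent_le hN (by linarith)
  have h3 := (abs_le.1 (hW a v₀ ha h2)).2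
  have h4 : N ^ (1 - 3 * η) ≤ N / (a : ℝ) ^ 2 := by
    rw [le_div_iff₀ (by positivity)]
    calc N ^ (1 - 3 * η) * (a : ℝ) ^ 2 ≤ N ^ (1 - 3 * η) * N ^ (2 * η) := by gcongr
      _ = N ^ (1 - η) := by rw [← Real.rpow_add hN0]; ring_nf
      _ ≤ N ^ (1 : ℝ) := Real.rpow_le_rpow_of_exponent_le hN (by linarith)
      _ = N := Real.rpow_one N
  nlinarith

/-- Powers of `log N` are bounded by powers of `N`. -/
lemma exists_pow_le_rpow (Λ c e : ℝ) (hΛ : 1 ≤ Λ) (hc : 0 ≤ c) (he : 0 < e) :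
    ∃ K : ℝ, 0 < K ∧ ∀ N : ℝ, 1 ≤ N → ∃ i : ℕ, 1 + c * Real.log N ≤ 2 ^ i ∧ Λ ^ i ≤ K * N ^ e := by
  obtain ⟨m₀, hm₀⟩ := pow_unbounded_of_one_lt Λ (one_lt_two (α := ℝ))
  set m := m₀ + 1 with hm
  have hΛm : Λ ≤ 2 ^ m := hm₀.le.trans (pow_le_pow_right₀ (by norm_num) (by omega))
  set e' := e / m with he'
  have hm0 : (0 : ℝ) < m := by exact_mod_cast Nat.succ_pos m₀
  have he'0 : 0 < e' := by positivity
  refine ⟨(2 * (1 + c / e')) ^ m, by positivity, fun N hN => ?_⟩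
  have hlN : 0 ≤ Real.log N := Real.log_nonneg hN
  set x := 1 + c * Real.log N with hx
  have hx1 : 1 ≤ x := by
    have : 0 ≤ c * Real.log N := by positivity
    linarith
  have hex : ∃ i : ℕ, x ≤ 2 ^ i := (pow_unbounded_of_one_lt x one_lt_two).imp fun i h => h.le
  -- Minimality of the exponent gives `2 ^ i ≤ 2x`, so `Λ ^ i ≤ (2x) ^ m` is only a power of a
  -- logarithm.
  refine ⟨Nat.find hex, Nat.find_spec hex, ?_⟩
  have h2i : (2 : ℝ) ^ Nat.find hex ≤ 2 * x := by
    rcases Nat.eq_zero_or_pos (Nat.find hex) with h | h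
    · rw [h, pow_zero]; linarith
    · have h1 := Nat.find_min hex (Nat.sub_one_lt (by omega : Nat.find hex ≠ 0))
      push Not at h1
      have h2 : (2 : ℝ) ^ Nat.find hex = 2 * 2 ^ (Nat.find hex - 1) := by
        rw [← pow_succ', Nat.sub_add_cancel h]
      rw [h2]
      linarith
  have hxN : x ≤ (1 + c / e') * N ^ e' := by
    have h1 : Real.log N ≤ N ^ e' / e' := Real.log_le_rpow_div (by linarith) he'0
    have h2 : 1 ≤ N ^ e' := Real.one_le_rpow hN he'0.le
    calc x ≤ 1 * N ^ e' + c * (N ^ e' / e') := by rw [hx]; gcongr; linarith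
      _ = _ := by ring
  calc Λ ^ Nat.find hex ≤ (2 ^ m) ^ Nat.find hex := pow_le_pow_left₀ (by linarith) hΛm _
    _ = (2 ^ Nat.find hex) ^ m := by rw [← pow_mul, ← pow_mul, mul_comm]
    _ ≤ (2 * ((1 + c / e') * N ^ e')) ^ m := by
        gcongr
        exact h2i.trans (by linarith)
    _ = (2 * (1 + c / e')) ^ m * N ^ e := by
        rw [← mul_assoc, mul_pow]
        congr 1
        rw [← Real.rpow_natCast, ← Real.rpow_mul (by linarith), he', div_mul_cancel₀ _ hm0.ne']

/-! ### Sieving within a residue class. -/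

open Classical in
/-- The primes in the sieve product. -/
noncomputable def sievePrimes (Q : MvPolynomial (Fin 2) ℤ) (X : ℝ) : Finset ℕ :=
  (Finset.Ioc Q.totalDegree ⌊X⌋₊).filter
    (fun p : ℕ => p.Prime ∧ ¬ (MvPolynomial.C (p : ℤ) ∣ Q))

lemma sieveProduct_eq (Q : MvPolynomial (Fin 2) ℤ) (X : ℝ) :
    sieveProduct Q X = ∏ p ∈ sievePrimes Q X, (1 - density Q p) := by
  rfl

lemma mem_sievePrimes {Q : MvPolynomial (Fin 2) ℤ} {X : ℝ} {p : ℕ} :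
    p ∈ sievePrimes Q X ↔
      p.Prime ∧ Q.totalDegree < p ∧ (p : ℝ) ≤ X ∧ ¬ MvPolynomial.C (p : ℤ) ∣ Q := by
  classical
  unfold sievePrimes
  rw [Finset.mem_filter, Finset.mem_Ioc]
  constructor
  · rintro ⟨⟨h1, h2⟩, h3, h4⟩
    exact ⟨h3, h1, (Nat.le_floor_iff' h3.ne_zero).1 h2, h4⟩
  · rintro ⟨h3, h1, h2, h4⟩
    exact ⟨⟨h1, (Nat.le_floor_iff' h3.ne_zero).2 h2⟩, h3, h4⟩

lemma one_sub_density_bounds {Q : MvPolynomial (Fin 2) ℤ} {p : ℕ} (hp : p.Prime)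
    (hd : Q.totalDegree < p) (hQ : ¬ MvPolynomial.C (p : ℤ) ∣ Q) :
    (1 : ℝ) / p ≤ 1 - density Q p ∧ (1 - density Q p)⁻¹ ≤ localFactor Q.totalDegree p := by
  have hp0 : (0 : ℝ) < p := by exact_mod_cast hp.pos
  have h1 := density_prime_le hp hQ
  have h2 : (Q.totalDegree : ℝ) + 1 ≤ p := by exact_mod_cast hd
  have h3 : (1 : ℝ) / p ≤ 1 - Q.totalDegree / p := by
    rw [one_sub_div hp0.ne']; gcongr; linarith
  refine ⟨by linarith, ?_⟩
  unfold localFactor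
  rw [if_pos hd]
  have : (0 : ℝ) < 1 / p := by positivity
  apply inv_anti₀ (by linarith)
  linarith

lemma one_sub_density_pos {Q : MvPolynomial (Fin 2) ℤ} {p : ℕ} (hp : p.Prime)
    (hd : Q.totalDegree < p) (hQ : ¬ MvPolynomial.C (p : ℤ) ∣ Q) : 0 < 1 - density Q p := by
  have hp0 : (0 : ℝ) < p := by exact_mod_cast hp.pos
  have : (0 : ℝ) < 1 / p := by positivity
  linarith [(one_sub_density_bounds hp hd hQ).1]

lemma sieveProduct_pos (Q : MvPolynomial (Fin 2) ℤ) (X : ℝ) : 0 < sieveProduct Q X := by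
  rw [sieveProduct_eq]
  refine Finset.prod_pos fun p hp => ?_
  obtain ⟨h1, h2, h3, h4⟩ := mem_sievePrimes.1 hp
  exact one_sub_density_pos h1 h2 h4

/-- The product of `1 - ρ_Q(p) / p ^ 2` over a set of primes is not too small. -/
lemma exists_one_le_prod_mul_pow (d : ℕ) :
    ∃ Λ : ℝ, 1 ≤ Λ ∧ ∀ (Q : MvPolynomial (Fin 2) ℤ), Q.totalDegree = d →
      ∀ (i : ℕ) (w X : ℝ), 1 ≤ w → 1 ≤ X → 1 + Real.log X ≤ 2 ^ i * (1 + Real.log w) →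
      ∀ P : Finset ℕ, P ⊆ sievePrimes Q X → (∀ p ∈ P, w < (p : ℝ)) →
      1 ≤ (∏ p ∈ P, (1 - density Q p)) * Λ ^ i := by
  obtain ⟨Λ, hΛ, h⟩ := exists_prod_one_add_div_le (d * (d + 1)) (by positivity)
  refine ⟨Λ, hΛ, fun Q hQ i w X hw hX hi P hP hPw => ?_⟩
  have h1 := h i w X hw hX hi
  have hpos : 0 < ∏ p ∈ P, (1 - density Q p) := by
    refine Finset.prod_pos fun p hp => ?_
    obtain ⟨h1, h2, h3, h4⟩ := mem_sievePrimes.1 (hP hp)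
    exact one_sub_density_pos h1 h2 h4
  rw [← inv_le_iff_one_le_mul₀' hpos, ← Finset.prod_inv_distrib]
  calc ∏ p ∈ P, (1 - density Q p)⁻¹ ≤ ∏ p ∈ P, (1 + (d * (d + 1) : ℝ) / p) := by
        refine Finset.prod_le_prod (fun p hp => ?_) (fun p hp => ?_)
        · obtain ⟨h1, h2, h3, h4⟩ := mem_sievePrimes.1 (hP hp)
          exact inv_nonneg.2 (one_sub_density_pos h1 h2 h4).le
        · obtain ⟨h1, h2, h3, h4⟩ := mem_sievePrimes.1 (hP hp)
          refine (one_sub_density_bounds h1 h2 h4).2.trans ?_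
          rw [hQ]
          exact localFactor_le d p
    _ ≤ ∏ p ∈ primesIoc w X, (1 + (d * (d + 1) : ℝ) / p) := by
        have hsub : P ⊆ primesIoc w X := fun p hp => by
          obtain ⟨h1, h2, h3, h4⟩ := mem_sievePrimes.1 (hP hp)
          exact (mem_primesIoc (by linarith)).2 ⟨h1, hPw p hp, h3⟩
        rw [← Finset.prod_sdiff hsub]
        apply le_mul_of_one_le_left (Finset.prod_nonneg fun p _ => by positivity)
        have : ∏ p ∈ primesIoc w X \ P, (1 : ℝ) ≤
            ∏ p ∈ primesIoc w X \ P, (1 + (d * (d + 1) : ℝ) / p) :=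
          Finset.prod_le_prod (fun _ _ => zero_le_one) (fun p _ => by
            have : 0 ≤ (d * (d + 1) : ℝ) / p := by positivity
            linarith)
        simpa using this
    _ ≤ Λ ^ i := h1

lemma one_le_prod_of_one_le {ι : Type*} (s : Finset ι) (F : ι → ℝ) (h : ∀ i ∈ s, 1 ≤ F i) :
    1 ≤ ∏ i ∈ s, F i := by
  have := Finset.prod_le_prod (s := s) (f := fun _ => (1 : ℝ)) (fun _ _ => zero_le_one) h
  simpa using this

lemma one_le_correction (d a : ℕ) : 1 ≤ correction d a :=
  one_le_prod_of_one_le _ _ fun p _ => one_le_localFactor d p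

/-- The sieve cannot use the primes dividing the modulus. Omitting such a prime loses `(1 - ρ_Q(p) /
p ^ 2)⁻¹`, which is at most its local factor. -/
lemma prod_le_sieveProduct_mul_correction (Q : MvPolynomial (Fin 2) ℤ) {a : ℕ} (ha : a ≠ 0)
    (w : ℝ) : ∏ p ∈ (sievePrimes Q w).filter (fun p => ¬ p ∣ a), (1 - density Q p) ≤
      sieveProduct Q w * correction Q.totalDegree a := by
  have hsplit := Finset.prod_filter_mul_prod_filter_not (sievePrimes Q w) (fun p => ¬ p ∣ a)
    (fun p => 1 - density Q p)
  rw [sieveProduct_eq, ← hsplit, mul_assoc]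
  have hpos : ∀ p ∈ sievePrimes Q w, 0 < 1 - density Q p := by
    intro p hp
    obtain ⟨h1, h2, h3, h4⟩ := mem_sievePrimes.1 hp
    exact one_sub_density_pos h1 h2 h4
  apply le_mul_of_one_le_right
    (Finset.prod_nonneg fun p hp => (hpos p (Finset.mem_filter.1 hp).1).le)
  set S := (sievePrimes Q w).filter (fun p => ¬ ¬ p ∣ a) with hS
  have hSsub : S ⊆ a.primeFactors := by
    intro p hp
    obtain ⟨h1, h2⟩ := Finset.mem_filter.1 hp
    exact Nat.mem_primeFactors.2 ⟨(mem_sievePrimes.1 h1).1, not_not.1 h2, ha⟩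
  unfold correction
  rw [← Finset.prod_sdiff hSsub]
  have h1 : 1 ≤ ∏ p ∈ a.primeFactors \ S, localFactor Q.totalDegree p :=
    one_le_prod_of_one_le _ _ fun p _ => one_le_localFactor _ p
  have h2 : 1 ≤ (∏ p ∈ S, (1 - density Q p)) * ∏ p ∈ S, localFactor Q.totalDegree p := by
    rw [← Finset.prod_mul_distrib]
    refine one_le_prod_of_one_le _ _ fun p hp => ?_
    have hp' := (Finset.mem_filter.1 hp).1
    obtain ⟨h1, h2, h3, h4⟩ := mem_sievePrimes.1 hp'
    rw [← inv_le_iff_one_le_mul₀' (hpos p hp')]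
    exact (one_sub_density_bounds h1 h2 h4).2
  calc (1 : ℝ) ≤ 1 * ((∏ p ∈ S, (1 - density Q p)) * ∏ p ∈ S, localFactor Q.totalDegree p) := by
        linarith
    _ ≤ (∏ p ∈ a.primeFactors \ S, localFactor Q.totalDegree p) *
        ((∏ p ∈ S, (1 - density Q p)) * ∏ p ∈ S, localFactor Q.totalDegree p) := by gcongr
    _ = _ := by ring

open Classical in
/-- The upper bound sieve in a residue class modulo `a`. -/
lemma exists_card_sifted_class_le (Cl η : ℝ) (d : ℕ) (hCl : 0 < Cl) (hη0 : 0 < η)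
    (hη : η < 1 / 2) :
    ∃ τ K : ℝ, 0 < τ ∧ 0 < K ∧ ∀ (N : ℝ) (W : Finset (ℤ × ℤ)) (Q : MvPolynomial (Fin 2) ℤ),
      1 ≤ N → EquiDist N (Cl * N ^ (1 - 3 * η)) W → Q.totalDegree = d →
      ∀ (a : ℕ) (v₀ : ℤ × ℤ) (w : ℝ), 0 < a → (a : ℝ) ≤ N ^ (3 * η / 4) → 1 ≤ w → w ≤ N ^ τ →
      ((W.filter fun v => red a v = red a v₀ ∧
        ∀ p : ℕ, p.Prime → (p : ℝ) ≤ w → (p : ℤ) ∣ value Q v → p ∣ a).card : ℝ) ≤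
        K * (N / (a : ℝ) ^ 2) * (sieveProduct Q w * correction d a) := by
  obtain ⟨κ, hκ, hsieve⟩ := exists_sieve_bound (d * (1 + d * (d + 1))) (by positivity)
  obtain ⟨Λ, hΛ, hlow⟩ := exists_one_le_prod_mul_pow d
  -- For `2 ≤ w ≤ N ^ τ` one has `1 + log w ≤ 3 log w`, so `κ(1 + log w) ≤ (η/16) log N`, the
  -- logarithm of the level `D = N ^ (η/16)`.
  set τ := η / (48 * κ) with hτ
  have hτ0 : 0 < τ := by positivity
  obtain ⟨K₁, hK₁, hpow⟩ := exists_pow_le_rpow Λ τ η hΛ hτ0.le hη0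
  refine ⟨τ, 2 + Cl * K₁ + (1 + Cl), hτ0, by positivity, ?_⟩
  intro N W Q hN hW hd a v₀ w ha haN hw hwN
  have hN0 : 0 < N := by linarith
  have hlN : 0 ≤ Real.log N := Real.log_nonneg hN
  have ha0 : (0 : ℝ) < a := by exact_mod_cast ha
  set P := (sievePrimes Q w).filter (fun p => ¬ p ∣ a) with hP
  have hPs : ∀ p ∈ P, p.Prime ∧ Q.totalDegree < p ∧ (p : ℝ) ≤ w ∧
      ¬ MvPolynomial.C (p : ℤ) ∣ Q := fun p hp => mem_sievePrimes.1 (Finset.mem_filter.1 hp).1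
  have hPpos : ∀ p ∈ P, 0 < 1 - density Q p := fun p hp =>
    one_sub_density_pos (hPs p hp).1 (hPs p hp).2.1 (hPs p hp).2.2.2
  have hprodP : 0 < ∏ p ∈ P, (1 - density Q p) := Finset.prod_pos hPpos
  have hprod := prod_le_sieveProduct_mul_correction Q ha.ne' w
  rw [← hP, hd] at hprod
  have hY : 0 ≤ N / (a : ℝ) ^ 2 := by positivity
  have hsc : 0 < sieveProduct Q w * correction d a := hprodP.trans_le hprod
  -- Below `2` there is nothing to sieve, and `1 + log w` is not controlled by `log N` when `N` is
  -- near `1`.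
  by_cases hw2 : w < 2
  · have hemp : sievePrimes Q w = ∅ := by
      rw [Finset.eq_empty_iff_forall_notMem]
      intro p hp
      obtain ⟨h1, -, h3, -⟩ := mem_sievePrimes.1 hp
      have : (2 : ℝ) ≤ p := by exact_mod_cast h1.two_le
      linarith
    have hs1 : 1 ≤ sieveProduct Q w * correction d a := by
      rw [sieveProduct_eq, hemp, Finset.prod_empty, one_mul]
      exact one_le_correction d a
    have h1 := hW.card_le hN hCl hη0 hη ha (haN.trans
      (Real.rpow_le_rpow_of_exponent_le hN (by linarith))) v₀
    have h2 : ((W.filter fun v => red a v = red a v₀ ∧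
        ∀ p : ℕ, p.Prime → (p : ℝ) ≤ w → (p : ℤ) ∣ value Q v → p ∣ a).card : ℝ) ≤
        ((W.filter fun v => red a v = red a v₀).card : ℝ) := by
      refine Nat.cast_le.2 (Finset.card_le_card fun v hv => ?_)
      obtain ⟨h3, h4, -⟩ := Finset.mem_filter.1 hv
      exact Finset.mem_filter.2 ⟨h3, h4⟩
    calc _ ≤ (1 + Cl) * (N / (a : ℝ) ^ 2) * 1 := by rw [mul_one]; exact h2.trans h1
      _ ≤ (2 + Cl * K₁ + (1 + Cl)) * (N / (a : ℝ) ^ 2) * (sieveProduct Q w * correction d a) := by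
          have : 0 < Cl * K₁ := by positivity
          have hconst : 1 + Cl ≤ 2 + Cl * K₁ + (1 + Cl) := by linarith
          exact mul_le_mul (mul_le_mul_of_nonneg_right hconst hY) hs1 zero_le_one (by positivity)
  · push Not at hw2
    set D := N ^ (η / 16) with hD
    have hD1 : 1 ≤ D := Real.one_le_rpow hN (by positivity)
    have hlw : Real.log w ≤ τ * Real.log N := by
      rw [← Real.log_rpow hN0]
      exact Real.log_le_log (by linarith) hwN
    have hwD : κ * (1 + Real.log w) ≤ Real.log D := by
      rw [hD, Real.log_rpow hN0]
      have h1 : Real.log 2 ≤ Real.log w := Real.log_le_log (by norm_num) hw2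
      have h2 := Real.log_two_gt_d9
      calc κ * (1 + Real.log w) ≤ κ * (3 * (τ * Real.log N)) := by gcongr; linarith
        _ = η / 16 * Real.log N := by rw [hτ]; field_simp; ring
    have hcond : ∀ p ∈ P, p.Prime ∧ (p : ℝ) ≤ w ∧ 0 ≤ density Q p ∧
        density Q p / (1 - density Q p) ≤ (d * (1 + d * (d + 1)) : ℝ) / p ∧ density Q p < 1 ∧
        (1 - density Q p)⁻¹ ≤ p := by
      intro p hp
      obtain ⟨h1, h2, h3, h4⟩ := hPs p hp
      have hp0 : (0 : ℝ) < p := by exact_mod_cast h1.pos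
      have hp1 : (1 : ℝ) ≤ p := by exact_mod_cast h1.one_le
      have h5 := hPpos p hp
      obtain ⟨h6, h7⟩ := one_sub_density_bounds h1 h2 h4
      refine ⟨h1, h3, density_nonneg Q p, ?_, by linarith, ?_⟩
      · have h8 : (1 - density Q p)⁻¹ ≤ 1 + d * (d + 1) := by
          rw [hd] at h7
          refine (h7.trans (localFactor_le d p)).trans ?_
          gcongr
          exact div_le_self (by positivity) hp1
        have h9 := density_prime_le h1 h4
        rw [hd] at h9
        calc density Q p / (1 - density Q p) = density Q p * (1 - density Q p)⁻¹ := by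
              rw [div_eq_mul_inv]
          _ ≤ d / p * (1 + d * (d + 1)) :=
              mul_le_mul h9 h8 (inv_nonneg.2 h5.le) (by positivity)
          _ = _ := by ring
      · rw [inv_le_comm₀ h5 hp0, ← one_div]
        exact h6
    have h1 := hsieve P (density Q) w D hw hD1 hwD hcond
      (W.filter fun v => red a v = red a v₀) (fun v p => (p : ℤ) ∣ value Q v)
      (N / (a : ℝ) ^ 2) (N ^ (η / 4) * (Cl * N ^ (1 - 3 * η))) hY (by
        intro T hT hTD
        have hTD' : ((∏ p ∈ T, p : ℕ) : ℝ) ≤ N ^ (η / 8) := by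
          refine hTD.trans (le_of_eq ?_)
          rw [hD, ← Real.rpow_natCast, ← Real.rpow_mul hN0.le]
          push_cast; ring_nf
        have h2 := hW.abs_card_dvd_sub_le (by positivity) Q T a v₀ ha
          (fun p hp => ⟨(hPs p (hT hp)).1, (Finset.mem_filter.1 (hT hp)).2⟩) (by
            push_cast at hTD' ⊢
            calc ((a : ℝ) * ∏ p ∈ T, (p : ℝ)) ^ 2
                ≤ (N ^ (3 * η / 4) * N ^ (η / 8)) ^ 2 := by gcongr
              _ = N ^ (7 * η / 4) := by
                  rw [← Real.rpow_add hN0, ← Real.rpow_natCast, ← Real.rpow_mul hN0.le]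
                  push_cast; ring_nf
              _ ≤ N ^ (1 : ℝ) := Real.rpow_le_rpow_of_exponent_le hN (by linarith)
              _ = N := Real.rpow_one N)
        rw [Finset.filter_filter]
        refine le_trans (le_of_eq ?_) (h2.trans ?_)
        · congr!
        gcongr
        calc ((∏ p ∈ T, p : ℕ) : ℝ) ^ 2 ≤ (N ^ (η / 8)) ^ 2 := by gcongr
          _ = N ^ (η / 4) := by
              rw [← Real.rpow_natCast, ← Real.rpow_mul hN0.le]
              push_cast; ring_nf)
    rw [Finset.filter_filter] at h1
    have h2 : ((W.filter fun v => red a v = red a v₀ ∧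
        ∀ p : ℕ, p.Prime → (p : ℝ) ≤ w → (p : ℤ) ∣ value Q v → p ∣ a).card : ℝ) ≤
        ((W.filter fun v => red a v = red a v₀ ∧ ∀ p ∈ P, ¬ (p : ℤ) ∣ value Q v).card : ℝ) := by
      refine Nat.cast_le.2 (Finset.card_le_card fun v hv => ?_)
      obtain ⟨h3, h4, h5⟩ := Finset.mem_filter.1 hv
      refine Finset.mem_filter.2 ⟨h3, h4, fun p hp hpv => ?_⟩
      exact (Finset.mem_filter.1 hp).2 (h5 p (hPs p hp).1 (hPs p hp).2.2.1 hpv)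
    obtain ⟨i, hi1, hi2⟩ := hpow N hN
    have h3 := hlow Q hd i 1 w le_rfl hw (by rw [Real.log_one, add_zero, mul_one]; linarith) P
      (Finset.filter_subset _ _) (fun p hp => by exact_mod_cast (hPs p hp).1.one_lt)
    have h4 : N ^ (-η) ≤ K₁ * ∏ p ∈ P, (1 - density Q p) := by
      have h5 : 1 ≤ (∏ p ∈ P, (1 - density Q p)) * (K₁ * N ^ η) :=
        h3.trans (mul_le_mul_of_nonneg_left hi2 hprodP.le)
      rw [Real.rpow_neg hN0.le, inv_le_iff_one_le_mul₀ (by positivity)]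
      linarith
    -- The total error is `≪ N ^ (1 - 5η/2)`. Since `N / a ^ 2 ≥ N ^ (1 - 3η/2)`, it is smaller than
    -- the main scale by `N ^ (-η)`, and the sieve product is `≫ N ^ (-η)` by the Mertens-type
    -- bound.
    have h5 : N ^ (η / 4) * (Cl * N ^ (1 - 3 * η)) * D ^ 4 ≤
        Cl * (N / (a : ℝ) ^ 2) * (K₁ * ∏ p ∈ P, (1 - density Q p)) := by
      have h6 : N ^ (1 - 3 * η / 2) ≤ N / (a : ℝ) ^ 2 := by
        rw [le_div_iff₀ (by positivity)]
        calc N ^ (1 - 3 * η / 2) * (a : ℝ) ^ 2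
            ≤ N ^ (1 - 3 * η / 2) * (N ^ (3 * η / 4)) ^ 2 := by gcongr
          _ = N ^ (1 : ℝ) := by
              rw [← Real.rpow_natCast, ← Real.rpow_mul hN0.le, ← Real.rpow_add hN0]
              push_cast; ring_nf
          _ = N := Real.rpow_one N
      calc N ^ (η / 4) * (Cl * N ^ (1 - 3 * η)) * D ^ 4
          = Cl * (N ^ (1 - 3 * η / 2) * N ^ (-η)) := by
            have : N ^ (η / 4) * N ^ (1 - 3 * η) * D ^ 4 = N ^ (1 - 3 * η / 2) * N ^ (-η) := by
              rw [hD, ← Real.rpow_natCast, ← Real.rpow_mul hN0.le, ← Real.rpow_add hN0,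
                ← Real.rpow_add hN0, ← Real.rpow_add hN0]
              push_cast; ring_nf
            rw [← this]; ring
        _ ≤ Cl * (N / (a : ℝ) ^ 2 * (K₁ * ∏ p ∈ P, (1 - density Q p))) := by gcongr
        _ = _ := by ring
    calc _ ≤ 2 * (N / (a : ℝ) ^ 2) * ∏ p ∈ P, (1 - density Q p) +
          Cl * (N / (a : ℝ) ^ 2) * (K₁ * ∏ p ∈ P, (1 - density Q p)) := by
          refine h2.trans (le_trans (le_of_eq ?_) (h1.trans (add_le_add_right h5 _)))
          congr!
      _ = (2 + Cl * K₁) * (N / (a : ℝ) ^ 2) * ∏ p ∈ P, (1 - density Q p) := by ring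
      _ ≤ (2 + Cl * K₁ + (1 + Cl)) * (N / (a : ℝ) ^ 2) * (sieveProduct Q w * correction d a) := by
          have hconst : 2 + Cl * K₁ ≤ 2 + Cl * K₁ + (1 + Cl) := by linarith
          exact mul_le_mul (mul_le_mul_of_nonneg_right hconst hY) hprod hprodP.le (by positivity)

/-! ### Exact divisors -/

/-- `a` is a unitary divisor of `Q(v) ≠ 0`. -/
def IsExactDivisor (Q : MvPolynomial (Fin 2) ℤ) (a : ℕ) (v : ℤ × ℤ) : Prop :=
  value Q v ≠ 0 ∧ a ∣ (value Q v).natAbs ∧ a.Coprime ((value Q v).natAbs / a)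

lemma IsExactDivisor.pos {Q : MvPolynomial (Fin 2) ℤ} {a : ℕ} {v : ℤ × ℤ}
    (h : IsExactDivisor Q a v) : 0 < a := by
  rcases Nat.eq_zero_or_pos a with rfl | h0
  · exact absurd (Int.natAbs_eq_zero.1 (Nat.eq_zero_of_zero_dvd h.2.1)) h.1
  · exact h0

open Classical in
/-- The local set counted by `ρ̃_Q(p ^ k)`. -/
noncomputable def tildePoints (Q : MvPolynomial (Fin 2) ℤ) (p k : ℕ) [NeZero p] :
    Finset (ZMod (p ^ k) × ZMod (p ^ k)) :=
  Finset.univ.filter fun v => IsPoint Q (p ^ k) v ∧ (IsSmoothAt Q (p ^ k) v ∨ ¬ HasLift Q p k v)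

lemma IsExactDivisor.red_mem {Q : MvPolynomial (Fin 2) ℤ} {a : ℕ} {v : ℤ × ℤ}
    (h : IsExactDivisor Q a v) {p : ℕ} [NeZero p] (hp : p ∈ a.primeFactors) :
    red (p ^ a.factorization p) v ∈ tildePoints Q p (a.factorization p) := by
  classical
  obtain ⟨hpp, hpa, ha0⟩ := Nat.mem_primeFactors.1 hp
  set k := a.factorization p with hk
  have hk0 : k ≠ 0 := (hpp.factorization_pos_of_dvd ha0 hpa).ne'
  obtain ⟨h1, h2, h3⟩ := h
  have hka : p ^ k ∣ a := Nat.ordProj_dvd a p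
  refine Finset.mem_filter.2 ⟨Finset.mem_univ _, isPoint_red.2 ?_,
    smooth_or_not_hasLift hpp hk0 ?_⟩
  · exact Int.natCast_dvd.2 (hka.trans h2)
  · intro h4
    have h5 := Int.natCast_dvd.1 h4
    obtain ⟨b, hb⟩ := h2
    rw [hb, Nat.mul_div_cancel_left _ (Nat.pos_of_ne_zero ha0)] at h3
    rw [hb] at h5
    have hpb : (p ^ (k + 1)).Coprime b :=
      Nat.Coprime.pow_left _ (Nat.Coprime.coprime_dvd_left hpa h3)
    have h6 := hpb.dvd_of_dvd_mul_right h5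
    have h7 := (hpp.pow_dvd_iff_le_factorization ha0).1 h6
    omega

open Classical in
/-- The residue classes modulo `a` of the points of which `a` is a unitary divisor number at most
`ρ̃_Q(a)`. -/
lemma card_image_red_le (Q : MvPolynomial (Fin 2) ℤ) {a : ℕ} (W : Finset (ℤ × ℤ))
    (hW : ∀ v ∈ W, IsExactDivisor Q a v) : (W.image (red a)).card ≤ rhoTilde Q a := by
  rcases Nat.eq_zero_or_pos a with rfl | ha
  · have : W = ∅ := by
      rw [Finset.eq_empty_iff_forall_notMem]
      exact fun v hv => (hW v hv).pos.ne' rfl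
    simp [this]
  have hne : ∀ p ∈ a.primeFactors, NeZero p := fun p hp => ⟨(Nat.prime_of_mem_primeFactors hp).ne_zero⟩
  have hrho : rhoTilde Q a = (a.primeFactors.pi fun p =>
      if h : NeZero p then tildePoints Q p (a.factorization p) else ∅).card := by
    rw [Finset.card_pi]
    unfold rhoTilde
    refine Finset.prod_congr rfl fun p hp => ?_
    have := hne p hp
    rw [dif_pos this, rhoTildePrimePow_eq]
    rfl
  rw [hrho]
  apply Finset.card_le_card_of_injOn
    (fun c => fun p _ => castPair (Nat.ordProj_dvd a p) c)
  · intro c hc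
    obtain ⟨v, hv, rfl⟩ := Finset.mem_image.1 (Finset.mem_coe.1 hc)
    refine Finset.mem_coe.2 (Finset.mem_pi.2 fun p hp => ?_)
    have := hne p hp
    rw [dif_pos this]
    show castPair _ (red a v) ∈ _
    rw [castPair_red]
    exact (hW v hv).red_mem hp
  · intro c _ c' _ hcc
    obtain ⟨v, rfl⟩ := red_surjective a c
    obtain ⟨w, rfl⟩ := red_surjective a c'
    have h1 : ∀ p ∈ a.primeFactors, red (p ^ a.factorization p) v = red (p ^ a.factorization p) w := by
      intro p hp
      have := congrFun (congrFun hcc p) hp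
      simpa only [castPair_red] using this
    have h2 : ∀ z : ℤ, (∀ p ∈ a.primeFactors, ((p ^ a.factorization p : ℕ) : ℤ) ∣ z) → (a : ℤ) ∣ z := by
      intro z hz
      rw [Int.natCast_dvd]
      conv_lhs => rw [← Nat.prod_factorization_pow_eq_self ha.ne']
      apply Finset.prod_dvd_of_isRelPrime
      · intro p hp q hq hpq
        have hp' := Nat.prime_of_mem_primeFactors hp
        have hq' := Nat.prime_of_mem_primeFactors hq
        exact Nat.coprime_iff_isRelPrime.1
          (Nat.Coprime.pow _ _ ((Nat.coprime_primes hp' hq').2 hpq))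
      · intro p hp
        exact Int.natCast_dvd.1 (hz p hp)
    exact red_eq_red_iff.2 ⟨h2 _ fun p hp => (red_eq_red_iff.1 (h1 p hp)).1,
      h2 _ fun p hp => (red_eq_red_iff.1 (h1 p hp)).2⟩

open Classical in
lemma card_exactDivisor_le (Q : MvPolynomial (Fin 2) ℤ) {a : ℕ} (W : Finset (ℤ × ℤ))
    (q : ℤ × ℤ → Prop) {M : ℝ} (hM : 0 ≤ M)
    (h : ∀ v₀ : ℤ × ℤ, ((W.filter fun v => red a v = red a v₀ ∧ q v).card : ℝ) ≤ M) :
    ((W.filter fun v => IsExactDivisor Q a v ∧ q v).card : ℝ) ≤ rhoTilde Q a * M := by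
  set S := W.filter fun v => IsExactDivisor Q a v ∧ q v with hS
  have h1 := card_image_red_le Q S (fun v hv => (Finset.mem_filter.1 hv).2.1)
  rw [Finset.card_eq_sum_card_image (red a) S]
  push_cast
  calc ∑ c ∈ S.image (red a), ((S.filter fun v => red a v = c).card : ℝ)
      ≤ ∑ c ∈ S.image (red a), M := by
        refine Finset.sum_le_sum fun c hc => ?_
        obtain ⟨v₀, -, rfl⟩ := Finset.mem_image.1 hc
        refine le_trans (Nat.cast_le.2 (Finset.card_le_card ?_)) (h v₀)
        intro v hv
        obtain ⟨hv1, hv2⟩ := Finset.mem_filter.1 hv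
        obtain ⟨hv3, hv4, hv5⟩ := Finset.mem_filter.1 hv1
        exact Finset.mem_filter.2 ⟨hv3, hv2, hv5⟩
    _ = (S.image (red a)).card * M := by rw [Finset.sum_const, nsmul_eq_mul]
    _ ≤ rhoTilde Q a * M := by gcongr

lemma weight_nonneg (Q : MvPolynomial (Fin 2) ℤ) {f : ℕ → ℝ} (hf : ∀ n, 0 ≤ f n) (a : ℕ) :
    0 ≤ weight Q f a := by
  unfold weight
  have := hf a
  positivity

open Classical in
/-- The sum of `f(|Q(v)|)` over points at which a divisor `a ∈ 𝒜` carries `f` up to a factor `L`,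
whereas its codivisor has no prime factor up to `w`. -/
lemma exists_sum_block_le (Cl η : ℝ) (d : ℕ) (hCl : 0 < Cl) (hη0 : 0 < η) (hη : η < 1 / 2) :
    ∃ τ K : ℝ, 0 < τ ∧ 0 < K ∧ ∀ (N : ℝ) (W : Finset (ℤ × ℤ)) (Q : MvPolynomial (Fin 2) ℤ),
      1 ≤ N → EquiDist N (Cl * N ^ (1 - 3 * η)) W → Q.totalDegree = d →
      ∀ (f : ℕ → ℝ) (𝒜 : Finset ℕ) (L w : ℝ) (V : Finset (ℤ × ℤ)), (∀ n, 0 ≤ f n) → 0 ≤ L →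
      1 ≤ w → w ≤ N ^ τ → (∀ a ∈ 𝒜, (a : ℝ) ≤ N ^ (3 * η / 4)) → V ⊆ W →
      (∀ v ∈ V, ∃ a ∈ 𝒜, IsExactDivisor Q a v ∧ f (value Q v).natAbs ≤ L * f a ∧
        ∀ p : ℕ, p.Prime → (p : ℝ) ≤ w → (p : ℤ) ∣ value Q v → p ∣ a) →
      ∑ v ∈ V, f (value Q v).natAbs ≤
        K * (L * N * sieveProduct Q w * ∑ a ∈ 𝒜, weight Q f a * correction d a) := by
  obtain ⟨τ, K, hτ, hK, h⟩ := exists_card_sifted_class_le Cl η d hCl hη0 hη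
  refine ⟨τ, K, hτ, hK, ?_⟩
  intro N W Q hN hW hd f 𝒜 L w V hf hL hw hwN h𝒜 hVW hV
  set q : ℕ → ℤ × ℤ → Prop := fun a v =>
    ∀ p : ℕ, p.Prime → (p : ℝ) ≤ w → (p : ℤ) ∣ value Q v → p ∣ a with hq
  have hs := (sieveProduct_pos Q w).le
  calc ∑ v ∈ V, f (value Q v).natAbs
      ≤ ∑ v ∈ V, ∑ a ∈ 𝒜, if IsExactDivisor Q a v ∧ q a v then L * f a else 0 := by
        refine Finset.sum_le_sum fun v hv => ?_
        obtain ⟨a, ha, h1, h2, h3⟩ := hV v hv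
        refine h2.trans ?_
        have h4 := Finset.single_le_sum
          (f := fun a => if IsExactDivisor Q a v ∧ q a v then L * f a else 0)
          (fun b _ => by
            split_ifs
            · exact mul_nonneg hL (hf b)
            · exact le_rfl) ha
        rwa [if_pos ⟨h1, h3⟩] at h4
    _ = ∑ a ∈ 𝒜, ((V.filter fun v => IsExactDivisor Q a v ∧ q a v).card : ℝ) * (L * f a) := by
        rw [Finset.sum_comm]
        refine Finset.sum_congr rfl fun a _ => ?_
        rw [← Finset.sum_filter, Finset.sum_const, nsmul_eq_mul]
    _ ≤ ∑ a ∈ 𝒜, (K * (L * N * sieveProduct Q w)) * (weight Q f a * correction d a) := by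
        refine Finset.sum_le_sum fun a ha => ?_
        have hc := correction_nonneg d a
        have hfa := hf a
        rcases Nat.eq_zero_or_pos a with rfl | ha0
        · have : V.filter (fun v => IsExactDivisor Q 0 v ∧ q 0 v) = ∅ := by
            rw [Finset.eq_empty_iff_forall_notMem]
            exact fun v hv => (Finset.mem_filter.1 hv).2.1.pos.ne' rfl
          rw [this, Finset.card_empty, Nat.cast_zero, zero_mul]
          have := weight_nonneg Q hf 0
          positivity
        have hcard := card_exactDivisor_le Q (a := a) W (q a)
          (M := K * (N / (a : ℝ) ^ 2) * (sieveProduct Q w * correction d a)) (by positivity)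
          (fun v₀ => h N W Q hN hW hd a v₀ w ha0 (h𝒜 a ha) hw hwN)
        have hsub : ((V.filter fun v => IsExactDivisor Q a v ∧ q a v).card : ℝ) ≤
            ((W.filter fun v => IsExactDivisor Q a v ∧ q a v).card : ℝ) :=
          Nat.cast_le.2 (Finset.card_le_card (Finset.filter_subset_filter _ hVW))
        calc _ ≤ rhoTilde Q a * (K * (N / (a : ℝ) ^ 2) * (sieveProduct Q w * correction d a)) *
              (L * f a) := by gcongr; exact hsub.trans hcard
          _ = _ := by unfold weight; ring
    _ = _ := by rw [← Finset.mul_sum]; ring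

/-! ### Splitting a value, and comparing sieve levels. -/

/-- The largest product of full prime powers of `n`, taken in increasing order of the primes, that
does not exceed `Z`. -/
lemma le_or_exists_coprime_mul {n : ℕ} (hn : n ≠ 0) {Z : ℝ} (hZ : 1 ≤ Z) :
    (n : ℝ) ≤ Z ∨ ∃ a b q e : ℕ, q.Prime ∧ a * b = n ∧ a.Coprime b ∧ (a : ℝ) ≤ Z ∧ q ^ e ∣ b ∧
      Z < a * (q : ℝ) ^ e ∧ (∀ p : ℕ, p.Prime → p ∣ a → p < q) ∧
      ∀ p : ℕ, p.Prime → p ∣ b → q ≤ p := by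
  rcases le_or_gt (n : ℝ) Z with h | h
  · exact Or.inl h
  right
  set F : ℕ → ℕ := fun m => ∏ p ∈ n.primeFactors.filter (fun p => p < m), p ^ n.factorization p
    with hF
  have hFn : F (n + 1) = n := by
    rw [hF]
    dsimp only
    rw [Finset.filter_true_of_mem fun p hp =>
      Nat.lt_succ_of_le (Nat.le_of_mem_primeFactors hp)]
    exact Nat.prod_factorization_pow_eq_self hn
  have hex : ∃ m, Z < F m := ⟨n + 1, by rwa [hFn]⟩
  classical
  obtain ⟨m, hm⟩ : ∃ m, m = Nat.find hex := ⟨_, rfl⟩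
  have hm1 : Z < F m := hm ▸ Nat.find_spec hex
  have hm0 : m ≠ 0 := by
    rintro rfl
    have : F 0 = 1 := by simp [hF]
    rw [this, Nat.cast_one] at hm1
    linarith
  -- The product over primes below `m` first exceeds `Z` at `m = q + 1`, so the step from `q` to `q
  -- + 1` must bring in a new prime power. Hence `q` is a prime factor of `n`.
  obtain ⟨q, rfl⟩ := Nat.exists_eq_succ_of_ne_zero hm0
  have hq1 : (F q : ℝ) ≤ Z := by
    by_contra hlt
    have := Nat.find_min' hex (not_le.1 hlt)
    omega
  have hqmem : q ∈ n.primeFactors := by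
    by_contra hq
    have : F (q + 1) = F q := by
      rw [hF]
      dsimp only
      congr 1
      ext p
      simp only [Finset.mem_filter]
      refine and_congr_right fun hp => ?_
      have : p ≠ q := fun h => hq (h ▸ hp)
      omega
    rw [Nat.succ_eq_add_one, this] at hm1
    linarith
  have hqp := Nat.prime_of_mem_primeFactors hqmem
  have hstep : F (q + 1) = F q * q ^ n.factorization q := by
    rw [hF]
    dsimp only
    have : n.primeFactors.filter (fun p => p < q + 1) =
        insert q (n.primeFactors.filter (fun p => p < q)) := by
      ext p
      simp only [Finset.mem_filter, Finset.mem_insert]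
      constructor
      · rintro ⟨h1, h2⟩
        rcases Nat.lt_or_ge p q with h3 | h3
        · exact Or.inr ⟨h1, h3⟩
        · left; omega
      · rintro (rfl | ⟨h1, h2⟩)
        · exact ⟨hqmem, Nat.lt_succ_self _⟩
        · exact ⟨h1, by omega⟩
    rw [this, Finset.prod_insert (by simp), mul_comm]
  set b := ∏ p ∈ n.primeFactors.filter (fun p => ¬ p < q), p ^ n.factorization p with hb
  have hdiv : ∀ (S : Finset ℕ) (p : ℕ), S ⊆ n.primeFactors → p.Prime →
      p ∣ ∏ p ∈ S, p ^ n.factorization p → p ∈ S := by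
    intro S p hS hp hpS
    obtain ⟨p', hp', h1⟩ := (Prime.dvd_finsetProd_iff hp.prime _).1 hpS
    have h2 := hp.dvd_of_dvd_pow h1
    rwa [(Nat.prime_dvd_prime_iff_eq hp (Nat.prime_of_mem_primeFactors (hS hp'))).1 h2]
  have ha' : ∀ p : ℕ, p.Prime → p ∣ F q → p < q := fun p hp hpa =>
    (Finset.mem_filter.1 (hdiv _ p (Finset.filter_subset _ _) hp hpa)).2
  have hb' : ∀ p : ℕ, p.Prime → p ∣ b → q ≤ p := fun p hp hpa =>
    not_lt.1 (Finset.mem_filter.1 (hdiv _ p (Finset.filter_subset _ _) hp hpa)).2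
  refine ⟨F q, b, q, n.factorization q, hqp, ?_, ?_, hq1, ?_, ?_, ha', hb'⟩
  · rw [hF, hb]
    dsimp only
    rw [Finset.prod_filter_mul_prod_filter_not]
    exact Nat.prod_factorization_pow_eq_self hn
  · refine Nat.Coprime.symm (Nat.coprime_of_dvd fun p hp h1 h2 => ?_)
    exact absurd (hb' p hp h1) (not_le.2 (ha' p hp h2))
  · exact Finset.dvd_prod_of_mem (fun p => p ^ n.factorization p)
      (Finset.mem_filter.2 ⟨hqmem, lt_irrefl q⟩)
  · rw [Nat.succ_eq_add_one, hstep] at hm1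
    exact_mod_cast hm1

lemma pow_cardFactors_le {b : ℕ} (hb : b ≠ 0) {y : ℝ} (hy : 0 ≤ y)
    (h : ∀ p : ℕ, p.Prime → p ∣ b → y ≤ p) : y ^ ArithmeticFunction.cardFactors b ≤ b := by
  induction b using Nat.recOnMul with
  | zero => exact absurd rfl hb
  | one => simp
  | prime p hp =>
    rw [ArithmeticFunction.cardFactors_apply_prime hp, pow_one]
    exact h p hp dvd_rfl
  | mul m n hm hn =>
    have hm0 : m ≠ 0 := left_ne_zero_of_mul hb
    have hn0 : n ≠ 0 := right_ne_zero_of_mul hb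
    rw [ArithmeticFunction.cardFactors_mul hm0 hn0, pow_add, Nat.cast_mul]
    exact mul_le_mul (hm hm0 fun p hp hpm => h p hp (hpm.mul_right n))
      (hn hn0 fun p hp hpn => h p hp (hpn.mul_left m)) (by positivity) (by positivity)

/-- `f(b) ≤ A ^ (s / t)` if `b ≤ N ^ s` has no prime factor below `N ^ t`. -/
lemma IsOfClassM.le_rpow_of_primes_ge {A B ε : ℝ} {f : ArithmeticFunction ℝ}
    (hf : IsOfClassM A B ε f) (hA : 1 ≤ A) {b : ℕ} (hb : b ≠ 0) {N s t : ℝ} (hN : 1 < N)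
    (ht : 0 < t) (hbN : (b : ℝ) ≤ N ^ s)
    (h : ∀ p : ℕ, p.Prime → p ∣ b → N ^ t ≤ p) : f b ≤ A ^ (s / t) := by
  have hN0 : 0 < N := by linarith
  have h1 := (hf.le_min b (Nat.pos_of_ne_zero hb)).trans (min_le_left _ _)
  refine h1.trans ?_
  rw [← Real.rpow_natCast]
  refine Real.rpow_le_rpow_of_exponent_le hA ?_
  have h2 := (pow_cardFactors_le hb (by positivity) h).trans hbN
  rw [← Real.rpow_natCast, ← Real.rpow_mul hN0.le, Real.rpow_le_rpow_left_iff hN] at h2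
  rw [le_div_iff₀ ht]
  linarith

/-- Lowering the level of the sieve. -/
lemma exists_sieveProduct_le (d : ℕ) : ∃ Λ : ℝ, 1 ≤ Λ ∧
    ∀ (Q : MvPolynomial (Fin 2) ℤ), Q.totalDegree = d → ∀ (i : ℕ) (w X : ℝ), 1 ≤ w → w ≤ X →
      1 + Real.log X ≤ 2 ^ i * (1 + Real.log w) →
      sieveProduct Q w ≤ Λ ^ i * sieveProduct Q X := by
  obtain ⟨Λ, hΛ, h⟩ := exists_one_le_prod_mul_pow d
  refine ⟨Λ, hΛ, fun Q hd i w X hw hwX hi => ?_⟩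
  have hsplit := Finset.prod_filter_mul_prod_filter_not (sievePrimes Q X)
    (fun p : ℕ => (p : ℝ) ≤ w) (fun p => 1 - density Q p)
  have hw' : (sievePrimes Q X).filter (fun p : ℕ => (p : ℝ) ≤ w) = sievePrimes Q w := by
    ext p
    simp only [Finset.mem_filter, mem_sievePrimes]
    constructor
    · rintro ⟨⟨h1, h2, h3, h4⟩, h5⟩
      exact ⟨h1, h2, h5, h4⟩
    · rintro ⟨h1, h2, h3, h4⟩
      exact ⟨⟨h1, h2, h3.trans hwX, h4⟩, h3⟩
  have h1 := h Q hd i w X hw (hw.trans hwX) hi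
    ((sievePrimes Q X).filter fun p : ℕ => ¬ (p : ℝ) ≤ w) (Finset.filter_subset _ _)
    (fun p hp => not_le.1 (Finset.mem_filter.1 hp).2)
  rw [hw', ← sieveProduct_eq, ← sieveProduct_eq] at hsplit
  rw [← hsplit]
  calc sieveProduct Q w = sieveProduct Q w * 1 := (mul_one _).symm
    _ ≤ sieveProduct Q w * _ := mul_le_mul_of_nonneg_left h1 (sieveProduct_pos Q w).le
    _ = _ := by ring

/-- By `x ^ m / m! ≤ e ^ x` at `x = 2 ^ j`, with `2 ^ m > 2Λ`, the terms are at most `m! 2 ^ (-j)`.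
The bound does not depend on `J`, which will grow with `N`. -/
lemma exists_sum_pow_mul_exp_le (Λ : ℝ) (hΛ : 1 ≤ Λ) : ∃ K : ℝ, 0 < K ∧ ∀ J : ℕ,
    ∑ j ∈ Finset.range J, Λ ^ j * Real.exp (-(2 : ℝ) ^ j) ≤ K := by
  obtain ⟨m, hm⟩ := pow_unbounded_of_one_lt (2 * Λ) (one_lt_two (α := ℝ))
  refine ⟨m.factorial * 2, by positivity, fun J => ?_⟩
  calc ∑ j ∈ Finset.range J, Λ ^ j * Real.exp (-(2 : ℝ) ^ j)
      ≤ ∑ j ∈ Finset.range J, m.factorial * (1 / 2 : ℝ) ^ j := by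
        refine Finset.sum_le_sum fun j _ => ?_
        have h1 := Real.pow_div_factorial_le_exp ((2 : ℝ) ^ j) (by positivity) m
        have h2 : (2 * Λ) ^ j ≤ ((2 : ℝ) ^ j) ^ m := by
          rw [← pow_mul, mul_comm j m, pow_mul]
          exact pow_le_pow_left₀ (by positivity) hm.le j
        rw [div_le_iff₀ (by positivity)] at h1
        have h3 : Λ ^ j * 2 ^ j ≤ Real.exp (2 ^ j) * m.factorial := by
          rw [← mul_pow, mul_comm Λ 2]
          exact h2.trans h1
        rw [Real.exp_neg, ← div_eq_mul_inv, div_le_iff₀ (Real.exp_pos _), div_pow, one_pow,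
          mul_one_div, div_mul_eq_mul_div, le_div_iff₀ (by positivity)]
        linarith
    _ = m.factorial * ∑ j ∈ Finset.range J, (1 / 2 : ℝ) ^ j := by rw [Finset.mul_sum]
    _ ≤ m.factorial * 2 := by
        gcongr
        exact sum_geometric_two_le J

/-! ### The sparse exceptional sets. -/

open Classical in
lemma EquiDist.card_dvd_le {N Cl η : ℝ} {W : Finset (ℤ × ℤ)}
    (hW : EquiDist N (Cl * N ^ (1 - 3 * η)) W) (hN : 1 ≤ N) (hCl : 0 < Cl) (hη0 : 0 < η)
    (hη : η < 1 / 2) (Q : MvPolynomial (Fin 2) ℤ) {m : ℕ} (hm : 0 < m) (hmN : (m : ℝ) ≤ N ^ η) :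
    ((W.filter fun v => (m : ℤ) ∣ value Q v).card : ℝ) ≤ (1 + Cl) * N * density Q m := by
  have : NeZero m := ⟨hm.ne'⟩
  set S := W.filter fun v => (m : ℤ) ∣ value Q v with hS
  rw [Finset.card_eq_sum_card_image (red m) S]
  push_cast
  calc ∑ c ∈ S.image (red m), ((S.filter fun v => red m v = c).card : ℝ)
      ≤ ∑ c ∈ S.image (red m), (1 + Cl) * (N / (m : ℝ) ^ 2) := by
        refine Finset.sum_le_sum fun c hc => ?_
        obtain ⟨v₀, -, rfl⟩ := Finset.mem_image.1 hc
        exact le_trans (Nat.cast_le.2 (Finset.card_le_card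
          (Finset.filter_subset_filter _ (Finset.filter_subset _ _))))
          (hW.card_le hN hCl hη0 hη hm hmN v₀)
    _ = (S.image (red m)).card * ((1 + Cl) * (N / (m : ℝ) ^ 2)) := by
        rw [Finset.sum_const, nsmul_eq_mul]
    _ ≤ rho Q m * ((1 + Cl) * (N / (m : ℝ) ^ 2)) := by
        rw [rho_eq]
        gcongr
        intro c hc
        obtain ⟨v, hv, rfl⟩ := Finset.mem_image.1 hc
        exact Finset.mem_filter.2 ⟨Finset.mem_univ _, isPoint_red.2 (Finset.mem_filter.1 hv).2⟩
    _ = _ := by unfold density; ring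

open Classical in
/-- Few values of `Q` are divisible by a large power of a small prime. -/
lemma exists_card_primePow_le (Cl C r η : ℝ) (hCl : 0 < Cl) (hC : 0 < C) (hr : 0 < r)
    (hη0 : 0 < η) (hη : η < 1 / 2) :
    ∃ K : ℝ, 0 < K ∧ ∀ (N τ : ℝ) (W : Finset (ℤ × ℤ)) (Q : MvPolynomial (Fin 2) ℤ),
      1 ≤ N → τ ≤ 3 * η / 8 → EquiDist N (Cl * N ^ (1 - 3 * η)) W → Q ≠ 0 → RhoBound C r Q →
      ((W.filter fun v => ∃ q e : ℕ, q.Prime ∧ (q : ℝ) ≤ N ^ τ ∧ N ^ (3 * η / 8) < (q : ℝ) ^ e ∧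
        q ^ e ∣ (value Q v).natAbs).card : ℝ) ≤ K * N ^ (1 + τ - 3 * η * r / 8) := by
  have h2r : 0 < (1 - (2 : ℝ) ^ (-r))⁻¹ := by
    have : (2 : ℝ) ^ (-r) < 1 := Real.rpow_lt_one_of_one_lt_of_neg one_lt_two (by linarith)
    exact inv_pos.2 (by linarith)
  refine ⟨(1 + Cl) * (C * (1 - (2 : ℝ) ^ (-r))⁻¹), by positivity, ?_⟩
  intro N τ W Q hN hτ hW hQ hrho
  have hN0 : 0 < N := by linarith
  set D := C * (1 - (2 : ℝ) ^ (-r))⁻¹ with hD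
  set Z := N ^ (3 * η / 8) with hZ
  have hZ1 : 1 ≤ Z := Real.one_le_rpow hN (by positivity)
  set S := (Finset.Icc 1 ⌊N ^ τ⌋₊).filter Nat.Prime with hS
  have hbound : ∀ q ∈ S, ((W.filter fun v => ∃ e : ℕ, Z < (q : ℝ) ^ e ∧
      q ^ e ∣ (value Q v).natAbs).card : ℝ) ≤ (1 + Cl) * N * (D * Z ^ (-r)) := by
    intro q hq
    obtain ⟨h1, hqp⟩ := Finset.mem_filter.1 hq
    have hqN : (q : ℝ) ≤ N ^ τ := (Nat.le_floor_iff (by positivity)).1 (Finset.mem_Icc.1 h1).2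
    have hq1 : (1 : ℝ) < q := by exact_mod_cast hqp.one_lt
    -- The least such power serves for all `e` at once. It is at most `Z N ^ τ ≤ N ^ η`, so
    -- equidistribution modulo `q ^ k` is available.
    have hex : ∃ k : ℕ, Z < (q : ℝ) ^ k := pow_unbounded_of_one_lt Z hq1
    obtain ⟨k, hk⟩ : ∃ k, k = Nat.find hex := ⟨_, rfl⟩
    have hk1 : Z < (q : ℝ) ^ k := hk ▸ Nat.find_spec hex
    have hmin : ∀ e : ℕ, Z < (q : ℝ) ^ e → k ≤ e := fun e he => hk ▸ Nat.find_min' hex he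
    have hk0 : k ≠ 0 := by
      rintro rfl
      rw [pow_zero] at hk1
      linarith
    have hk2 : (q : ℝ) ^ (k - 1) ≤ Z := by
      by_contra hlt
      have := hmin _ (not_le.1 hlt)
      omega
    have hkN : ((q ^ k : ℕ) : ℝ) ≤ N ^ η := by
      rw [← Nat.sub_add_cancel (Nat.one_le_iff_ne_zero.2 hk0), pow_succ]
      push_cast
      calc (q : ℝ) ^ (k - 1) * q ≤ Z * N ^ τ := by gcongr
        _ = N ^ (3 * η / 8 + τ) := by rw [hZ, ← Real.rpow_add hN0]
        _ ≤ N ^ η := Real.rpow_le_rpow_of_exponent_le hN (by linarith)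
    have h3 := hW.card_dvd_le hN hCl hη0 hη Q (pow_pos hqp.pos k) hkN
    have h4 := hrho.density_le hC.le hr hQ hqp (Nat.one_le_iff_ne_zero.2 hk0)
    have h5 : (q : ℝ) ^ (-(r * k)) ≤ Z ^ (-r) := by
      have : (q : ℝ) ^ (-(r * k)) = ((q : ℝ) ^ k) ^ (-r) := by
        rw [← Real.rpow_natCast, ← Real.rpow_mul (by positivity)]
        ring_nf
      rw [this]
      exact Real.rpow_le_rpow_of_nonpos (by linarith) hk1.le (by linarith)
    calc ((W.filter fun v => ∃ e : ℕ, Z < (q : ℝ) ^ e ∧ q ^ e ∣ (value Q v).natAbs).card : ℝ)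
        ≤ ((W.filter fun v => ((q ^ k : ℕ) : ℤ) ∣ value Q v).card : ℝ) := by
          refine Nat.cast_le.2 (Finset.card_le_card fun v hv => ?_)
          obtain ⟨h6, e, h7, h8⟩ := Finset.mem_filter.1 hv
          exact Finset.mem_filter.2
            ⟨h6, Int.natCast_dvd.2 ((pow_dvd_pow q (hmin e h7)).trans h8)⟩
      _ ≤ (1 + Cl) * N * density Q (q ^ k) := h3
      _ ≤ (1 + Cl) * N * (D * Z ^ (-r)) := by
          gcongr
          exact h4.trans (mul_le_mul_of_nonneg_left h5 (by positivity))
  calc ((W.filter fun v => ∃ q e : ℕ, q.Prime ∧ (q : ℝ) ≤ N ^ τ ∧ Z < (q : ℝ) ^ e ∧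
        q ^ e ∣ (value Q v).natAbs).card : ℝ)
      ≤ ((S.biUnion fun q => W.filter fun v => ∃ e : ℕ, Z < (q : ℝ) ^ e ∧
          q ^ e ∣ (value Q v).natAbs).card : ℝ) := by
        refine Nat.cast_le.2 (Finset.card_le_card fun v hv => ?_)
        obtain ⟨h1, q, e, h2, h3, h4, h5⟩ := Finset.mem_filter.1 hv
        exact Finset.mem_biUnion.2 ⟨q, Finset.mem_filter.2
          ⟨Finset.mem_Icc.2 ⟨h2.one_le, Nat.le_floor h3⟩, h2⟩,
          Finset.mem_filter.2 ⟨h1, e, h4, h5⟩⟩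
    _ ≤ ∑ q ∈ S, ((W.filter fun v => ∃ e : ℕ, Z < (q : ℝ) ^ e ∧
          q ^ e ∣ (value Q v).natAbs).card : ℝ) := by
        rw [← Nat.cast_sum]
        exact Nat.cast_le.2 Finset.card_biUnion_le
    _ ≤ S.card * ((1 + Cl) * N * (D * Z ^ (-r))) := by
        rw [← nsmul_eq_mul]
        exact Finset.sum_le_card_nsmul _ _ _ hbound
    _ ≤ N ^ τ * ((1 + Cl) * N * (D * Z ^ (-r))) := by
        gcongr
        calc (S.card : ℝ) ≤ (Finset.Icc 1 ⌊N ^ τ⌋₊).card :=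
              Nat.cast_le.2 (Finset.card_filter_le _ _)
          _ = ⌊N ^ τ⌋₊ := by rw [Nat.card_Icc, Nat.add_sub_cancel]
          _ ≤ N ^ τ := Nat.floor_le (by positivity)
    _ = (1 + Cl) * D * (N ^ τ * N ^ (1 : ℝ) * Z ^ (-r)) := by rw [Real.rpow_one]; ring
    _ = _ := by
        rw [hZ, ← Real.rpow_mul hN0.le, ← Real.rpow_add hN0, ← Real.rpow_add hN0]
        ring_nf

open Classical in
lemma EquiDist.card_exactDivisor_le {N Cl η : ℝ} {W : Finset (ℤ × ℤ)}
    (hW : EquiDist N (Cl * N ^ (1 - 3 * η)) W) (hN : 1 ≤ N) (hCl : 0 < Cl) (hη0 : 0 < η)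
    (hη : η < 1 / 2) (Q : MvPolynomial (Fin 2) ℤ) {a : ℕ} (ha : 0 < a) (haN : (a : ℝ) ≤ N ^ η) :
    ((W.filter fun v => IsExactDivisor Q a v).card : ℝ) ≤
      (1 + Cl) * N * (rhoTilde Q a / (a : ℝ) ^ 2) := by
  have h := PlaneSieve.card_exactDivisor_le Q (a := a) W (fun _ => True)
    (M := (1 + Cl) * (N / (a : ℝ) ^ 2)) (by positivity) (fun v₀ => by
      have := hW.card_le hN hCl hη0 hη ha haN v₀
      simpa only [and_true] using this)
  simp only [and_true] at h
  refine h.trans (le_of_eq ?_)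
  ring

open Classical in
/-- Few values of `Q` have a large smooth unitary divisor. -/
lemma exists_card_smooth_le (Cl C r η y : ℝ) (hCl : 0 < Cl) (hC : 0 < C) (hr : 0 < r)
    (hη0 : 0 < η) (hη : η < 1 / 2) :
    ∃ K : ℝ, 0 < K ∧ ∀ (N : ℝ) (W : Finset (ℤ × ℤ)) (Q : MvPolynomial (Fin 2) ℤ),
      1 ≤ N → EquiDist N (Cl * N ^ (1 - 3 * η)) W → RhoBound C r Q →
      ((W.filter fun v => ∃ a : ℕ, IsExactDivisor Q a v ∧ N ^ (3 * η / 8) ≤ a ∧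
        (a : ℝ) ≤ N ^ η ∧ ∀ p : ℕ, p.Prime → p ∣ a → (p : ℝ) ≤ y).card : ℝ) ≤
        K * N ^ (1 - 9 * η * r / 32) := by
  -- The exponent `3r/4` saves `N ^ (9ηr/32)`, which exceeds the trivial loss `N ^ (δε)`, where `δε
  -- < ηr/4`, by a margin of `ηr/32`.
  obtain ⟨K, hK, h⟩ := exists_sum_smooth_le C r (3 * r / 4) y hC (by positivity) (by linarith)
  refine ⟨(1 + Cl) * K, by positivity, fun N W Q hN hW hrho => ?_⟩
  have hN0 : 0 < N := by linarith
  set S := (Finset.Icc 1 ⌊N ^ η⌋₊).filter fun a : ℕ => N ^ (3 * η / 8) ≤ a ∧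
    ∀ p : ℕ, p.Prime → p ∣ a → (p : ℝ) ≤ y with hS
  have hSmem : ∀ a ∈ S, a ≠ 0 ∧ (a : ℝ) ≤ N ^ η ∧ N ^ (3 * η / 8) ≤ a ∧
      ∀ p : ℕ, p.Prime → p ∣ a → (p : ℝ) ≤ y := by
    intro a ha
    obtain ⟨h1, h2, h3⟩ := Finset.mem_filter.1 ha
    obtain ⟨h4, h5⟩ := Finset.mem_Icc.1 h1
    exact ⟨by omega, (Nat.le_floor_iff (by positivity)).1 h5, h2, h3⟩
  have hsum := h Q hrho (N ^ (3 * η / 8)) (by positivity) S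
    (fun a ha => ⟨(hSmem a ha).1, (hSmem a ha).2.2⟩)
  calc _ ≤ ((S.biUnion fun a => W.filter fun v => IsExactDivisor Q a v).card : ℝ) := by
        refine Nat.cast_le.2 (Finset.card_le_card fun v hv => ?_)
        obtain ⟨h1, a, h2, h3, h4, h5⟩ := Finset.mem_filter.1 hv
        exact Finset.mem_biUnion.2 ⟨a, Finset.mem_filter.2
          ⟨Finset.mem_Icc.2 ⟨h2.pos, Nat.le_floor h4⟩, h3, h5⟩,
          Finset.mem_filter.2 ⟨h1, h2⟩⟩
    _ ≤ ∑ a ∈ S, ((W.filter fun v => IsExactDivisor Q a v).card : ℝ) := by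
        rw [← Nat.cast_sum]
        exact Nat.cast_le.2 Finset.card_biUnion_le
    _ ≤ ∑ a ∈ S, (1 + Cl) * N * (rhoTilde Q a / (a : ℝ) ^ 2) :=
        Finset.sum_le_sum fun a ha => hW.card_exactDivisor_le hN hCl hη0 hη Q
          (Nat.pos_of_ne_zero (hSmem a ha).1) (hSmem a ha).2.1
    _ = (1 + Cl) * N * ∑ a ∈ S, rhoTilde Q a / (a : ℝ) ^ 2 := by
        rw [Finset.mul_sum]
    _ ≤ (1 + Cl) * N * (K * (N ^ (3 * η / 8)) ^ (-(3 * r / 4))) := by gcongr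
    _ = (1 + Cl) * K * (N ^ (1 : ℝ) * (N ^ (3 * η / 8)) ^ (-(3 * r / 4))) := by
        rw [Real.rpow_one]; ring
    _ = _ := by
        rw [← Real.rpow_mul hN0.le, ← Real.rpow_add hN0]
        ring_nf

/-! ### The case distinction and the main estimate. -/

/-- A set `W` of `≈ N` lattice points, equidistributed in residue classes, together with a
polynomial of size at most `X ≤ N ^ δ` on `W` and a multiplicative function. -/
structure IsSieveSetting (Cl A B ε C r η δ : ℝ) (d : ℕ) (N X : ℝ) (W : Finset (ℤ × ℤ))
    (Q : MvPolynomial (Fin 2) ℤ) (f : ArithmeticFunction ℝ) : Prop where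
  one_le : 1 ≤ N
  equiDist : EquiDist N (Cl * N ^ (1 - 3 * η)) W
  totalDegree : Q.totalDegree = d
  ne_zero : Q ≠ 0
  rhoBound : RhoBound C r Q
  one_le_X : 1 ≤ X
  X_le : X ≤ N ^ δ
  natAbs_le : ∀ v ∈ W, ((value Q v).natAbs : ℝ) ≤ X
  isOfClassM : IsOfClassM A B ε f

/-- The sieve bound for each `a` is summed by Rankin's trick, the correction factor is removed
inside the Euler product, and this product is converted back to a sum up to `X`. The exponent `τ`
must be fixed before `M`, since `M` will be chosen in terms of `τ`. -/
lemma exists_sum_carried_le (Cl A B ε C r η δ : ℝ) (d : ℕ) (hCl : 0 < Cl) (hA : 1 ≤ A)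
    (hB : 0 < B) (hC : 0 < C) (hr : 0 < r) (hη0 : 0 < η) (hη : η < 1 / 2) (hε : ε < r) :
    ∃ τ : ℝ, 0 < τ ∧ ∀ M : ℝ, 0 ≤ M → ∃ K : ℝ, 0 < K ∧
      ∀ (N X : ℝ) (W : Finset (ℤ × ℤ)) (Q : MvPolynomial (Fin 2) ℤ) (f : ArithmeticFunction ℝ),
      IsSieveSetting Cl A B ε C r η δ d N X W Q f →
      ∀ (β y T w L : ℝ) (V : Finset (ℤ × ℤ)), 1 ≤ y → y ≤ X → 0 ≤ β → β ≤ (r - ε) / 2 →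
      β * Real.log y ≤ M → 0 < T → 0 ≤ L → 1 ≤ w → w ≤ N ^ τ → V ⊆ W →
      (∀ v ∈ V, ∃ a : ℕ, IsExactDivisor Q a v ∧ (a : ℝ) ≤ N ^ (3 * η / 4) ∧ T ≤ a ∧
        (∀ p : ℕ, p.Prime → p ∣ a → (p : ℝ) ≤ y) ∧ f (value Q v).natAbs ≤ L * f a ∧
        ∀ p : ℕ, p.Prime → (p : ℝ) ≤ w → (p : ℤ) ∣ value Q v → p ∣ a) →
      ∑ v ∈ V, f (value Q v).natAbs ≤
        K * (L * T ^ (-β) * N * sieveProduct Q w * ∑ a ∈ Finset.Icc 1 ⌊X⌋₊, weight Q f a) := by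
  classical
  obtain ⟨τ, K₁, hτ, hK₁, hblock⟩ := exists_sum_block_le Cl η d hCl hη0 hη
  obtain ⟨c, hc, htame⟩ := exists_tame_weight A B ε C r d hA hB hC hr hε
  have hγ : 0 < r - ε := sub_pos.2 hε
  refine ⟨τ, hτ, fun M hM => ?_⟩
  obtain ⟨K₂, hK₂, hrankin⟩ := exists_sum_le_rankin (c * (1 + d * (d + 1))) (r - ε) M
    (by positivity) hγ hM
  obtain ⟨K₃, hK₃, hcorr⟩ := exists_eulerProd_mul_correction_le c (r - ε) d hc hγ
  obtain ⟨K₄, hK₄, heuler⟩ := exists_eulerProd_le_sum c (r - ε) hc hγ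
  refine ⟨K₁ * (K₂ * (K₃ * K₄)), by positivity, ?_⟩
  intro N X W Q f hs β y T w L V hy hyX hβ hβ2 hβM hT hL hw hwN hVW hV
  have hN0 : 0 < N := by linarith [hs.one_le]
  have ht := htame Q f hs.ne_zero hs.totalDegree hs.rhoBound hs.isOfClassM
  set 𝒜 := (Finset.Icc 1 ⌊N ^ (3 * η / 4)⌋₊).filter fun a : ℕ => T ≤ a ∧
    ∀ p : ℕ, p.Prime → p ∣ a → (p : ℝ) ≤ y with h𝒜
  have hmem : ∀ a ∈ 𝒜, a ≠ 0 ∧ (a : ℝ) ≤ N ^ (3 * η / 4) ∧ T ≤ a ∧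
      ∀ p : ℕ, p.Prime → p ∣ a → (p : ℝ) ≤ y := by
    intro a ha
    obtain ⟨h1, h2, h3⟩ := Finset.mem_filter.1 ha
    obtain ⟨h4, h5⟩ := Finset.mem_Icc.1 h1
    exact ⟨by omega, (Nat.le_floor_iff (by positivity)).1 h5, h2, h3⟩
  have h1 := hblock N W Q hs.one_le hs.equiDist hs.totalDegree f 𝒜 L w V hs.isOfClassM.nonneg hL
    hw hwN (fun a ha => (hmem a ha).2.1) hVW (by
      intro v hv
      obtain ⟨a, h1, h2, h3, h4, h5, h6⟩ := hV v hv
      exact ⟨a, Finset.mem_filter.2 ⟨Finset.mem_Icc.2 ⟨h1.pos, Nat.le_floor h2⟩, h3, h4⟩,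
        h1, h5, h6⟩)
  have h2 : ∑ a ∈ 𝒜, weight Q f a * correction d a ≤
      K₂ * (K₃ * K₄) * T ^ (-β) * ∑ a ∈ Finset.Icc 1 ⌊X⌋₊, weight Q f a := by
    calc ∑ a ∈ 𝒜, weight Q f a * correction d a
        ≤ K₂ * T ^ (-β) * eulerProd (fun a => weight Q f a * correction d a) y :=
          hrankin _ (ht.mul_correction d) β y T hy hβ hβ2 hβM hT 𝒜
            (fun a ha => ⟨(hmem a ha).1, (hmem a ha).2.2⟩)
      _ ≤ K₂ * T ^ (-β) * (K₃ * eulerProd (weight Q f) y) := by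
          gcongr
          exact hcorr _ ht y
      _ ≤ K₂ * T ^ (-β) * (K₃ * (K₄ * ∑ a ∈ Finset.Icc 1 ⌊X⌋₊, weight Q f a)) := by
          gcongr
          exact (ht.eulerProd_mono hγ (by linarith) hyX).trans (heuler _ ht X hs.one_le_X)
      _ = _ := by ring
  have h3 := (sieveProduct_pos Q w).le
  refine h1.trans ?_
  calc K₁ * (L * N * sieveProduct Q w * ∑ a ∈ 𝒜, weight Q f a * correction d a)
      ≤ K₁ * (L * N * sieveProduct Q w *
        (K₂ * (K₃ * K₄) * T ^ (-β) * ∑ a ∈ Finset.Icc 1 ⌊X⌋₊, weight Q f a)) := by gcongr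
    _ = _ := by ring

/-- Every nonzero value either has a divisor carrying `f` with a sifted codivisor, or a large power
of a small prime, or a large smooth unitary divisor. -/
lemma IsSieveSetting.cases {Cl A B ε C r η δ : ℝ} {d : ℕ} {N X : ℝ} {W : Finset (ℤ × ℤ)}
    {Q : MvPolynomial (Fin 2) ℤ} {f : ArithmeticFunction ℝ}
    (hs : IsSieveSetting Cl A B ε C r η δ d N X W Q f) (hA : 1 ≤ A) (hη0 : 0 < η) (hδ : 0 < δ)
    {τ K₀ : ℝ} (hτ : 0 < τ) (hτη : τ ≤ 3 * η / 8) {J : ℕ} (hJ : N ^ (τ / 2 ^ J) < 2)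
    {v : ℤ × ℤ} (hv : v ∈ W) (hv0 : value Q v ≠ 0) :
    (∃ a : ℕ, IsExactDivisor Q a v ∧ (a : ℝ) ≤ N ^ (3 * η / 4) ∧ (1 : ℝ) ≤ a ∧
      (∀ p : ℕ, p.Prime → p ∣ a → (p : ℝ) ≤ X) ∧
      f (value Q v).natAbs ≤ A ^ (δ / τ) * f a ∧
      ∀ p : ℕ, p.Prime → (p : ℝ) ≤ min X (N ^ τ) → (p : ℤ) ∣ value Q v → p ∣ a) ∨
    (∃ q e : ℕ, q.Prime ∧ (q : ℝ) ≤ N ^ τ ∧ N ^ (3 * η / 8) < (q : ℝ) ^ e ∧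
      q ^ e ∣ (value Q v).natAbs) ∨
    (∃ a : ℕ, IsExactDivisor Q a v ∧ N ^ (3 * η / 8) ≤ a ∧ (a : ℝ) ≤ N ^ η ∧
      ∀ p : ℕ, p.Prime → p ∣ a → (p : ℝ) ≤ K₀) ∨
    ∃ j < J, K₀ ≤ N ^ (τ / 2 ^ j) ∧ N ^ (τ / 2 ^ j) ≤ X ∧ 1 < N ∧
      ∃ a : ℕ, IsExactDivisor Q a v ∧ (a : ℝ) ≤ N ^ (3 * η / 4) ∧ N ^ (3 * η / 8) ≤ a ∧
      (∀ p : ℕ, p.Prime → p ∣ a → (p : ℝ) ≤ N ^ (τ / 2 ^ j)) ∧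
      f (value Q v).natAbs ≤ A ^ (δ / (τ / 2 ^ (j + 1))) * f a ∧
      ∀ p : ℕ, p.Prime → (p : ℝ) ≤ N ^ (τ / 2 ^ (j + 1)) → (p : ℤ) ∣ value Q v → p ∣ a := by
  have hN := hs.one_le
  have hN0 : 0 < N := by linarith
  have hf := hs.isOfClassM
  set n := (value Q v).natAbs with hn
  have hn0 : n ≠ 0 := Int.natAbs_ne_zero.2 hv0
  have hnX : (n : ℝ) ≤ X := hs.natAbs_le v hv
  have hZ1 : 1 ≤ N ^ (3 * η / 4) := Real.one_le_rpow hN (by positivity)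
  -- For a small value take `a = n`: it carries all of `f`, and nothing remains to be sifted.
  by_cases hnZ : (n : ℝ) ≤ N ^ (3 * η / 4)
  · left
    refine ⟨n, ⟨hv0, dvd_rfl, ?_⟩, hnZ, ?_, ?_, ?_, ?_⟩
    · rw [← hn, Nat.div_self (Nat.pos_of_ne_zero hn0)]
      exact Nat.coprime_one_right n
    · exact_mod_cast Nat.one_le_iff_ne_zero.2 hn0
    · intro p _ hpn
      exact le_trans (Nat.cast_le.2 (Nat.le_of_dvd (Nat.pos_of_ne_zero hn0) hpn)) hnX
    · exact le_mul_of_one_le_left (hf.nonneg n) (Real.one_le_rpow hA (by positivity))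
    · intro p _ _ hp
      exact Int.natCast_dvd.1 hp
  have hN1 : 1 < N := by
    rcases hN.lt_or_eq with h | h
    · exact h
    · have h1 := hs.X_le
      rw [← h, Real.one_rpow] at h1
      rw [← h, Real.one_rpow] at hnZ
      exact absurd (hnX.trans h1) hnZ
  obtain ⟨a, b, q, e, hq, hab, hcop, haZ, hqb, hZ, ha, hb⟩ :=
    (le_or_exists_coprime_mul hn0 hZ1).resolve_left hnZ
  have ha0 : a ≠ 0 := by rintro rfl; exact hn0 (by rw [← hab, zero_mul])
  have hb0 : b ≠ 0 := by rintro rfl; exact hn0 (by rw [← hab, mul_zero])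
  have hex : IsExactDivisor Q a v := by
    refine ⟨hv0, ⟨b, hab.symm⟩, ?_⟩
    rw [← hn, ← hab, Nat.mul_div_cancel_left _ (Nat.pos_of_ne_zero ha0)]
    exact hcop
  have hfn : f n = f b * f a := by
    rw [← hab, hf.isMultiplicative.map_mul_of_coprime hcop, mul_comm]
  have hbX : (b : ℝ) ≤ N ^ δ := by
    refine le_trans (Nat.cast_le.2 ?_) (hnX.trans hs.X_le)
    exact Nat.le_of_dvd (Nat.pos_of_ne_zero hn0) ⟨a, by rw [← hab, mul_comm]⟩
  have haX : (a : ℝ) ≤ X := by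
    refine le_trans (Nat.cast_le.2 ?_) hnX
    exact Nat.le_of_dvd (Nat.pos_of_ne_zero hn0) ⟨b, hab.symm⟩
  have hcarry : ∀ t : ℝ, 0 < t → N ^ t ≤ q → f n ≤ A ^ (δ / t) * f a := by
    intro t ht hqt
    rw [hfn]
    refine mul_le_mul_of_nonneg_right ?_ (hf.nonneg a)
    exact hf.le_rpow_of_primes_ge hA hb0 hN1 ht hbX
      fun p hp hpb => hqt.trans (Nat.cast_le.2 (hb p hp hpb))
  have hsift : ∀ p : ℕ, p.Prime → (p : ℝ) < q → (p : ℤ) ∣ value Q v → p ∣ a := by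
    intro p hp hpq hpv
    have h1 := Int.natCast_dvd.1 hpv
    rw [← hn, ← hab] at h1
    rcases hp.dvd_mul.1 h1 with h2 | h2
    · exact h2
    · exact absurd (hb p hp h2) (not_le.2 (by exact_mod_cast hpq))
  rcases lt_or_ge (N ^ τ) (q : ℝ) with hqy | hqy
  · left
    refine ⟨a, hex, haZ, by exact_mod_cast Nat.one_le_iff_ne_zero.2 ha0, ?_,
      hcarry τ hτ hqy.le, fun p hp hpw => hsift p hp ((hpw.trans (min_le_right _ _)).trans_lt hqy)⟩
    intro p _ hpa
    exact le_trans (Nat.cast_le.2 (Nat.le_of_dvd (Nat.pos_of_ne_zero ha0) hpa)) haX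
  right
  rcases lt_or_ge (N ^ (3 * η / 8)) ((q : ℝ) ^ e) with hqe | hqe
  · left
    exact ⟨q, e, hq, hqy, hqe, hqb.trans ⟨a, by rw [← hab, mul_comm]⟩⟩
  right
  -- The overshooting product `a q ^ e` exceeds `N ^ (3η/4)` while `q ^ e` is at most the square
  -- root of that threshold.
  have haZ' : N ^ (3 * η / 8) < a := by
    have h1 : N ^ (3 * η / 4) = N ^ (3 * η / 8) * N ^ (3 * η / 8) := by
      rw [← Real.rpow_add hN0]
      ring_nf
    rw [h1] at hZ
    exact lt_of_mul_lt_mul_right (hZ.trans_le (mul_le_mul_of_nonneg_left hqe (by positivity)))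
      (by positivity)
  rcases le_or_gt (q : ℝ) K₀ with hqK | hqK
  · left
    refine ⟨a, hex, haZ'.le, haZ.trans (Real.rpow_le_rpow_of_exponent_le hN (by linarith)), ?_⟩
    intro p hp hpa
    exact le_trans (Nat.cast_le.2 (ha p hp hpa).le) hqK
  right
  classical
  have hq2 : (2 : ℝ) ≤ q := by exact_mod_cast hq.two_le
  -- Locates `q` on the scale obtained by repeatedly halving the exponent. Since `q ≥ 2`, at most
  -- `J` halvings are needed.
  have hexj : ∃ j : ℕ, N ^ (τ / 2 ^ j) < q := ⟨J, hJ.trans_le hq2⟩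
  obtain ⟨m, hm⟩ : ∃ m, m = Nat.find hexj := ⟨_, rfl⟩
  have hm1 : N ^ (τ / 2 ^ m) < q := hm ▸ Nat.find_spec hexj
  have hmJ : m ≤ J := hm ▸ Nat.find_min' hexj (hJ.trans_le hq2)
  have hm0 : m ≠ 0 := by
    rintro rfl
    rw [pow_zero, div_one] at hm1
    linarith
  obtain ⟨j, rfl⟩ := Nat.exists_eq_succ_of_ne_zero hm0
  have hj : (q : ℝ) ≤ N ^ (τ / 2 ^ j) := by
    by_contra hlt
    have := Nat.find_min' hexj (not_le.1 hlt)
    omega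
  refine ⟨j, hmJ, (hqK.trans_le hj).le, ?_, hN1, a, hex, haZ, haZ'.le, ?_, ?_, ?_⟩
  · calc N ^ (τ / 2 ^ j) ≤ N ^ (3 * η / 8) := by
          refine Real.rpow_le_rpow_of_exponent_le hN (le_trans ?_ hτη)
          exact div_le_self hτ.le (one_le_pow₀ one_le_two)
      _ ≤ X := haZ'.le.trans haX
  · intro p hp hpa
    exact le_trans (Nat.cast_le.2 (ha p hp hpa).le) hj
  · exact hcarry _ (by positivity) hm1.le
  · exact fun p hp hpw => hsift p hp (hpw.trans_lt hm1)

lemma exists_rpow_le_two (N τ : ℝ) (hN : 1 ≤ N) : ∃ J : ℕ, N ^ (τ / 2 ^ J) < 2 := by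
  have hN0 : 0 < N := by linarith
  obtain ⟨J, hJ⟩ := pow_unbounded_of_one_lt (Real.log N * τ / Real.log 2) (one_lt_two (α := ℝ))
  refine ⟨J, ?_⟩
  have hl2 : 0 < Real.log 2 := Real.log_pos one_lt_two
  rw [Real.rpow_def_of_pos hN0, ← Real.lt_log_iff_exp_lt two_pos, ← mul_div_assoc,
    div_lt_iff₀ (by positivity)]
  rw [div_lt_iff₀ hl2] at hJ
  linarith

/-- `A ^ (δ / (τ / 2 ^ (j + 1)))` is beaten by Rankin's saving for suitable `M`. -/
lemma rpow_mul_rpow_neg_eq {A N δ τ η : ℝ} (hA : 1 ≤ A) (hN : 1 < N) (hτ : 0 < τ) (hη : 0 < η)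
    (j : ℕ) :
    A ^ (δ / (τ / 2 ^ (j + 1))) * (N ^ (3 * η / 8)) ^
      (-(8 * τ / (3 * η) * (2 * (δ / τ) * Real.log A + 1) / Real.log (N ^ (τ / 2 ^ j)))) =
      Real.exp (-(2 : ℝ) ^ j) := by
  have hN0 : 0 < N := by linarith
  have hl : 0 < Real.log N := Real.log_pos hN
  have h2 : (0 : ℝ) < 2 ^ j := by positivity
  rw [← Real.rpow_mul hN0.le, Real.log_rpow hN0, Real.rpow_def_of_pos (by linarith),
    Real.rpow_def_of_pos hN0, ← Real.exp_add]
  congr 1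
  rw [pow_succ]
  field_simp
  ring

/-- At most `i + j` doublings of the logarithm lead from the `j`-th scale up to `X`. This is the
exponent of `Λ` lost by sieving only to that scale. -/
lemma one_add_log_le {N X δ τ : ℝ} {i : ℕ} (hN : 1 ≤ N) (hX : 1 ≤ X) (hXN : X ≤ N ^ δ)
    (hτ : 0 < τ) (hi : δ / τ ≤ 2 ^ i) (j : ℕ) :
    1 + Real.log X ≤ 2 ^ (i + j) * (1 + Real.log (N ^ (τ / 2 ^ j))) := by
  have hN0 : 0 < N := by linarith
  have hl : 0 ≤ Real.log N := Real.log_nonneg hN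
  have h1 : Real.log X ≤ δ * Real.log N := by
    rw [← Real.log_rpow hN0]
    exact Real.log_le_log (by linarith) hXN
  rw [div_le_iff₀ hτ] at hi
  have h2 : (2 : ℝ) ^ (i + j) * (τ / 2 ^ j * Real.log N) = 2 ^ i * τ * Real.log N := by
    rw [pow_add]
    field_simp
  have h3 : (1 : ℝ) ≤ 2 ^ (i + j) := one_le_pow₀ one_le_two
  rw [Real.log_rpow hN0, mul_add, h2, mul_one]
  have h4 := mul_le_mul_of_nonneg_right hi hl
  linarith

lemma IsSieveSetting.apply_le {Cl A B ε C r η δ : ℝ} {d : ℕ} {N X : ℝ} {W : Finset (ℤ × ℤ)}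
    {Q : MvPolynomial (Fin 2) ℤ} {f : ArithmeticFunction ℝ}
    (hs : IsSieveSetting Cl A B ε C r η δ d N X W Q f) (hB : 0 < B) (hε : 0 < ε) {v : ℤ × ℤ}
    (hv : v ∈ W) : f (value Q v).natAbs ≤ B * N ^ (δ * ε) := by
  have hN0 : 0 < N := by linarith [hs.one_le]
  rcases Nat.eq_zero_or_pos (value Q v).natAbs with h | h
  · rw [h, ArithmeticFunction.map_zero]
    positivity
  · refine ((hs.isOfClassM.le_min _ h).trans (min_le_right _ _)).trans ?_
    rw [Real.rpow_mul hN0.le]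
    gcongr
    exact (hs.natAbs_le v hv).trans hs.X_le

/-- The Nair-Tenenbaum bound for an equidistributed set of lattice points. -/
theorem exists_sum_le (Cl A B ε C r η δ : ℝ) (d : ℕ) (hCl : 0 < Cl) (hA : 1 ≤ A)
    (hB : 0 < B) (hC : 0 < C) (hr : 0 < r) (hr1 : r ≤ 1) (hη0 : 0 < η) (hη : η < 1 / 2)
    (hδ : 0 < δ) (hε0 : 0 < ε) (hε : ε < min r (η * r / (4 * δ))) :
    ∃ K : ℝ, 0 < K ∧
      ∀ (N X : ℝ) (W : Finset (ℤ × ℤ)) (Q : MvPolynomial (Fin 2) ℤ) (f : ArithmeticFunction ℝ),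
      IsSieveSetting Cl A B ε C r η δ d N X W Q f →
      ∑ v ∈ W, f (value Q v).natAbs ≤
        K * (N * sieveProduct Q X * ∑ a ∈ Finset.Icc 1 ⌊X⌋₊, weight Q f a) := by
  classical
  obtain ⟨hεr, hεη⟩ := lt_min_iff.1 hε
  have hδε : δ * ε < η * r / 4 := by
    rw [lt_div_iff₀ (by positivity)] at hεη
    linarith
  have hγ : 0 < r - ε := sub_pos.2 hεr
  have hηr : 0 < η * r := by positivity
  obtain ⟨τ₀, hτ₀, hcarried⟩ := exists_sum_carried_le Cl A B ε C r η δ d hCl hA hB hC hr hη0 hη hεr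
  -- The cap makes the set of points with a large prime power sparse enough: `τ - 3ηr/8 + δε <
  -- -ηr/16`.
  set τ := min τ₀ (η * r / 16) with hτdef
  have hτ : 0 < τ := by positivity
  have hττ₀ : τ ≤ τ₀ := min_le_left _ _
  have hτr : τ ≤ η * r / 16 := min_le_right _ _
  have hηr1 : η * r ≤ η := mul_le_of_le_one_right hη0.le hr1
  have hτη : τ ≤ 3 * η / 8 := by linarith
  have hlA : 0 ≤ Real.log A := Real.log_nonneg hA
  -- With `β = M / log y`, `y = N ^ (τ/2^j)` and `T = N ^ (3η/8)`, Rankin's saving is `A ^ (-2δ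
  -- 2^j/τ) exp(-2^j)`, which cancels the loss from `f(b)` and leaves `exp(-2^j)`.
  set M := 8 * τ / (3 * η) * (2 * (δ / τ) * Real.log A + 1) with hM
  have hM0 : 0 ≤ M := by positivity
  obtain ⟨K₁, hK₁, hcarried⟩ := hcarried M hM0
  -- For `y ≥ K₀` the choice `β = M / log y` is at most `(r - ε)/2`, as Rankin's trick requires.
  -- Primes below `K₀` are left to the smooth exceptional set.
  set K₀ := Real.exp (2 * M / (r - ε)) with hK₀
  obtain ⟨K₂, hK₂, hprime⟩ := exists_card_primePow_le Cl C r η hCl hC hr hη0 hη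
  obtain ⟨K₃, hK₃, hsmooth⟩ := exists_card_smooth_le Cl C r η K₀ hCl hC hr hη0 hη
  obtain ⟨Λ, hΛ, hlevel⟩ := exists_sieveProduct_le d
  obtain ⟨K₄, hK₄, hgeom⟩ := exists_sum_pow_mul_exp_le Λ hΛ
  obtain ⟨K₅, hK₅, hpow⟩ := exists_pow_le_rpow Λ δ (η * r / 32) hΛ hδ.le (by positivity)
  obtain ⟨i, hi⟩ := pow_unbounded_of_one_lt (δ / τ) (one_lt_two (α := ℝ))
  refine ⟨K₁ * A ^ (δ / τ) * Λ ^ i + B * K₂ * K₅ + B * K₃ * K₅ + K₁ * Λ ^ (i + 1) * K₄,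
    by positivity, ?_⟩
  intro N X W Q f hs
  have hN := hs.one_le
  have hN0 : 0 < N := by linarith
  have hX1 := hs.one_le_X
  have hlN : 0 ≤ Real.log N := Real.log_nonneg hN
  have hf := hs.isOfClassM
  have hd := hs.totalDegree
  set G := ∑ a ∈ Finset.Icc 1 ⌊X⌋₊, weight Q f a with hG
  have hG1 : 1 ≤ G := by
    have h1 : weight Q f 1 = 1 := (nonnegMul_weight Q hf.nonnegMul).one
    rw [← h1]
    refine Finset.single_le_sum (fun a _ => weight_nonneg Q hf.nonneg a)
      (Finset.mem_Icc.2 ⟨le_rfl, Nat.le_floor (by simpa using hX1)⟩)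
  have hG0 : 0 < G := by linarith
  have hsX := sieveProduct_pos Q X
  set F : ℤ × ℤ → ℝ := fun v => f (value Q v).natAbs with hF
  have hF0 : ∀ v, 0 ≤ F v := fun v => hf.nonneg _
  -- On a sparse set the pointwise bound for `f` suffices: the remaining saving `N ^ (-ηr/32)` pays
  -- for the sieve product, which is bounded below by a power of `1 / log N`, and the sum over `a`
  -- is at least `1`.
  have herr : ∀ V ⊆ W, ∀ K s : ℝ, 0 < K → s + δ * ε ≤ 1 - η * r / 32 → (V.card : ℝ) ≤ K * N ^ s →
      ∑ v ∈ V, F v ≤ B * K * K₅ * (N * sieveProduct Q X * G) := by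
    intro V hVW K s hK hsε hV
    obtain ⟨l, hl1, hl2⟩ := hpow N hN
    have h1 : sieveProduct Q 1 = 1 := by
      rw [sieveProduct_eq]
      refine Finset.prod_eq_one fun p hp => absurd (mem_sievePrimes.1 hp).2.2.1 ?_
      exact not_le.2 (by exact_mod_cast (mem_sievePrimes.1 hp).1.one_lt)
    have h2 := hlevel Q hd l 1 X le_rfl hX1 (by
      have : Real.log X ≤ δ * Real.log N := by
        rw [← Real.log_rpow hN0]
        exact Real.log_le_log (by linarith) hs.X_le
      rw [Real.log_one, add_zero, mul_one]
      linarith)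
    rw [h1] at h2
    have h3 : 1 ≤ K₅ * N ^ (η * r / 32) * (sieveProduct Q X * G) := by
      calc (1 : ℝ) ≤ Λ ^ l * sieveProduct Q X := h2
        _ ≤ K₅ * N ^ (η * r / 32) * sieveProduct Q X := by gcongr
        _ ≤ K₅ * N ^ (η * r / 32) * (sieveProduct Q X * G) := by
            gcongr
            exact le_mul_of_one_le_right hsX.le hG1
    calc ∑ v ∈ V, F v ≤ V.card • (B * N ^ (δ * ε)) :=
          Finset.sum_le_card_nsmul _ _ _ fun v hv => hs.apply_le hB hε0 (hVW hv)
      _ ≤ K * N ^ s * (B * N ^ (δ * ε)) := by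
          rw [nsmul_eq_mul]
          gcongr
      _ = B * K * N ^ (s + δ * ε) := by rw [Real.rpow_add hN0]; ring
      _ ≤ B * K * N ^ (1 - η * r / 32) * (K₅ * N ^ (η * r / 32) * (sieveProduct Q X * G)) := by
          refine le_trans ?_ (le_mul_of_one_le_right (by positivity) h3)
          gcongr
      _ = B * K * K₅ * ((N ^ (1 - η * r / 32) * N ^ (η * r / 32)) * sieveProduct Q X * G) := by ring
      _ = _ := by rw [← Real.rpow_add hN0, sub_add_cancel, Real.rpow_one]
  obtain ⟨J, hJ⟩ := exists_rpow_le_two N τ hN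
  set P₁ : ℤ × ℤ → Prop := fun v => ∃ a : ℕ, IsExactDivisor Q a v ∧ (a : ℝ) ≤ N ^ (3 * η / 4) ∧
      (1 : ℝ) ≤ a ∧ (∀ p : ℕ, p.Prime → p ∣ a → (p : ℝ) ≤ X) ∧
      f (value Q v).natAbs ≤ A ^ (δ / τ) * f a ∧
      ∀ p : ℕ, p.Prime → (p : ℝ) ≤ min X (N ^ τ) → (p : ℤ) ∣ value Q v → p ∣ a with hP₁
  set P₂ : ℤ × ℤ → Prop := fun v => ∃ q e : ℕ, q.Prime ∧ (q : ℝ) ≤ N ^ τ ∧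
      N ^ (3 * η / 8) < (q : ℝ) ^ e ∧ q ^ e ∣ (value Q v).natAbs with hP₂
  set P₃ : ℤ × ℤ → Prop := fun v => ∃ a : ℕ, IsExactDivisor Q a v ∧ N ^ (3 * η / 8) ≤ a ∧
      (a : ℝ) ≤ N ^ η ∧ ∀ p : ℕ, p.Prime → p ∣ a → (p : ℝ) ≤ K₀ with hP₃
  set P₄ : ℕ → ℤ × ℤ → Prop := fun j v => K₀ ≤ N ^ (τ / 2 ^ j) ∧ N ^ (τ / 2 ^ j) ≤ X ∧ 1 < N ∧
      ∃ a : ℕ, IsExactDivisor Q a v ∧ (a : ℝ) ≤ N ^ (3 * η / 4) ∧ N ^ (3 * η / 8) ≤ a ∧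
      (∀ p : ℕ, p.Prime → p ∣ a → (p : ℝ) ≤ N ^ (τ / 2 ^ j)) ∧
      f (value Q v).natAbs ≤ A ^ (δ / (τ / 2 ^ (j + 1))) * f a ∧
      ∀ p : ℕ, p.Prime → (p : ℝ) ≤ N ^ (τ / 2 ^ (j + 1)) → (p : ℤ) ∣ value Q v → p ∣ a with hP₄
  have hcover : ∑ v ∈ W, F v ≤ ∑ v ∈ W.filter P₁, F v + ∑ v ∈ W.filter P₂, F v +
      ∑ v ∈ W.filter P₃, F v + ∑ j ∈ Finset.range J, ∑ v ∈ W.filter (P₄ j), F v := by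
    simp only [Finset.sum_filter]
    rw [Finset.sum_comm, ← Finset.sum_add_distrib, ← Finset.sum_add_distrib,
      ← Finset.sum_add_distrib]
    refine Finset.sum_le_sum fun v hv => ?_
    have hite : ∀ (P : Prop) [Decidable P], 0 ≤ if P then F v else 0 := by
      intro P _
      split_ifs
      · exact hF0 v
      · exact le_rfl
    have h1 := hite (P₁ v)
    have h2 := hite (P₂ v)
    have h3 := hite (P₃ v)
    have h4 : 0 ≤ ∑ j ∈ Finset.range J, if P₄ j v then F v else 0 :=
      Finset.sum_nonneg fun j _ => hite _
    by_cases hv0 : value Q v = 0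
    · have : F v = 0 := by simp [hF, hv0]
      linarith
    rcases hs.cases hA hη0 hδ (K₀ := K₀) hτ hτη hJ hv hv0 with h | h | h | ⟨j, hj, h⟩
    · have h : P₁ v := h
      rw [if_pos h]
      linarith
    · have h : P₂ v := h
      rw [if_pos h]
      linarith
    · have h : P₃ v := h
      rw [if_pos h]
      linarith
    · have h : P₄ j v := h
      have h5 := Finset.single_le_sum (f := fun j => if P₄ j v then F v else 0)
        (fun j _ => hite _) (Finset.mem_range.2 hj)
      rw [if_pos h] at h5
      linarith
  have hyτ : N ^ τ ≤ N ^ τ₀ := Real.rpow_le_rpow_of_exponent_le hN hττ₀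
  have hy1 : 1 ≤ N ^ τ := Real.one_le_rpow hN hτ.le
  have hbound₁ : ∑ v ∈ W.filter P₁, F v ≤
      K₁ * A ^ (δ / τ) * Λ ^ i * (N * sieveProduct Q X * G) := by
    -- No Rankin saving is needed here: `β = 0`, `T = 1`, and the primes of `a` range up to `X`.
    have h1 := hcarried N X W Q f hs 0 X 1 (min X (N ^ τ)) (A ^ (δ / τ)) (W.filter P₁) hX1 le_rfl
      le_rfl (by positivity) (by rwa [zero_mul]) one_pos (by positivity) (le_min hX1 hy1)
      ((min_le_right _ _).trans hyτ) (Finset.filter_subset _ _)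
      (fun v hv => (Finset.mem_filter.1 hv).2)
    have h2 : sieveProduct Q (min X (N ^ τ)) ≤ Λ ^ i * sieveProduct Q X := by
      refine hlevel Q hd i _ X (le_min hX1 hy1) (min_le_left _ _) ?_
      rcases min_choice X (N ^ τ) with h | h
      · rw [h]
        exact le_mul_of_one_le_left (by linarith [Real.log_nonneg hX1]) (one_le_pow₀ one_le_two)
      · rw [h]
        simpa using one_add_log_le hN hX1 hs.X_le hτ hi.le 0
    refine h1.trans ?_
    rw [neg_zero, Real.rpow_zero, mul_one]
    calc K₁ * (A ^ (δ / τ) * N * sieveProduct Q (min X (N ^ τ)) * G)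
        ≤ K₁ * (A ^ (δ / τ) * N * (Λ ^ i * sieveProduct Q X) * G) := by gcongr
      _ = _ := by ring
  have hbound₂ := herr (W.filter P₂) (Finset.filter_subset _ _) K₂ (1 + τ - 3 * η * r / 8) hK₂
    (by linarith) (hprime N τ W Q hN hτη hs.equiDist hs.ne_zero hs.rhoBound)
  have hbound₃ := herr (W.filter P₃) (Finset.filter_subset _ _) K₃ (1 - 9 * η * r / 32) hK₃
    (by linarith) (hsmooth N W Q hN hs.equiDist hs.rhoBound)
  have hbound₄ : ∀ j, ∑ v ∈ W.filter (P₄ j), F v ≤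
      K₁ * Λ ^ (i + 1) * (N * sieveProduct Q X * G) * (Λ ^ j * Real.exp (-(2 : ℝ) ^ j)) := by
    intro j
    -- Any point of the set supplies the inequalities `K₀ ≤ y ≤ X` and `1 < N`, which do not depend
    -- on the point.
    rcases (W.filter (P₄ j)).eq_empty_or_nonempty with h | ⟨v₀, hv₀⟩
    · rw [h, Finset.sum_empty]
      positivity
    obtain ⟨hKy, hyX, hN1, -⟩ := (Finset.mem_filter.1 hv₀).2
    set y := N ^ (τ / 2 ^ j) with hy
    have hK₀1 : 1 ≤ K₀ := Real.one_le_exp (by positivity)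
    have hly : 0 < Real.log y := by
      rw [hy, Real.log_rpow hN0]
      have := Real.log_pos hN1
      positivity
    have hlog : 2 * M / (r - ε) ≤ Real.log y := by
      rw [Real.le_log_iff_exp_le (by positivity)]
      exact hKy
    have hw1 : 1 ≤ N ^ (τ / 2 ^ (j + 1)) := Real.one_le_rpow hN (by positivity)
    have hwy : N ^ (τ / 2 ^ (j + 1)) ≤ y := by
      refine Real.rpow_le_rpow_of_exponent_le hN ?_
      gcongr
      · exact one_le_two
      · omega
    have hyy : y ≤ N ^ τ :=
      Real.rpow_le_rpow_of_exponent_le hN (div_le_self hτ.le (one_le_pow₀ one_le_two))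
    have h1 := hcarried N X W Q f hs (M / Real.log y) y (N ^ (3 * η / 8)) (N ^ (τ / 2 ^ (j + 1)))
      (A ^ (δ / (τ / 2 ^ (j + 1)))) (W.filter (P₄ j)) (hK₀1.trans hKy) hyX (by positivity)
      (by
        rw [div_le_iff₀ hγ] at hlog
        rw [div_le_div_iff₀ hly two_pos]
        linarith)
      (by rw [div_mul_cancel₀ _ hly.ne']) (by positivity) (by positivity) hw1
      (hwy.trans (hyy.trans hyτ)) (Finset.filter_subset _ _)
      (fun v hv => (Finset.mem_filter.1 hv).2.2.2.2)
    have h2 : sieveProduct Q (N ^ (τ / 2 ^ (j + 1))) ≤ Λ ^ (i + (j + 1)) * sieveProduct Q X :=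
      hlevel Q hd _ _ X hw1 (hwy.trans hyX) (one_add_log_le hN hX1 hs.X_le hτ hi.le (j + 1))
    rw [hM, hy, rpow_mul_rpow_neg_eq hA hN1 hτ hη0 j] at h1
    refine h1.trans ?_
    calc K₁ * (Real.exp (-(2 : ℝ) ^ j) * N * sieveProduct Q (N ^ (τ / 2 ^ (j + 1))) * G)
        ≤ K₁ * (Real.exp (-(2 : ℝ) ^ j) * N * (Λ ^ (i + (j + 1)) * sieveProduct Q X) * G) := by
          gcongr
      _ = _ := by ring
  have hsum₄ : ∑ j ∈ Finset.range J, ∑ v ∈ W.filter (P₄ j), F v ≤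
      K₁ * Λ ^ (i + 1) * K₄ * (N * sieveProduct Q X * G) := by
    calc _ ≤ ∑ j ∈ Finset.range J,
          K₁ * Λ ^ (i + 1) * (N * sieveProduct Q X * G) * (Λ ^ j * Real.exp (-(2 : ℝ) ^ j)) :=
          Finset.sum_le_sum fun j _ => hbound₄ j
      _ = K₁ * Λ ^ (i + 1) * (N * sieveProduct Q X * G) *
          ∑ j ∈ Finset.range J, Λ ^ j * Real.exp (-(2 : ℝ) ^ j) := (Finset.mul_sum _ _ _).symm
      _ ≤ K₁ * Λ ^ (i + 1) * (N * sieveProduct Q X * G) * K₄ := by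
          gcongr
          exact hgeom J
      _ = _ := by ring
  calc ∑ v ∈ W, F v ≤ _ := hcover
    _ ≤ K₁ * A ^ (δ / τ) * Λ ^ i * (N * sieveProduct Q X * G) +
        B * K₂ * K₅ * (N * sieveProduct Q X * G) + B * K₃ * K₅ * (N * sieveProduct Q X * G) +
        K₁ * Λ ^ (i + 1) * K₄ * (N * sieveProduct Q X * G) :=
        add_le_add (add_le_add (add_le_add hbound₁ hbound₂) hbound₃) hsum₄
    _ = _ := by ring

/-! ### From the convex domain to an equidistributed finite set. -/

lemma latticePoints_finite {E : Set (ℝ × ℝ)} (hE : Bornology.IsBounded E) :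
    (latticePoints E).Finite := by
  obtain ⟨R, hR⟩ := hE.subset_closedBall 0
  refine ((Set.finite_Icc (-⌈R⌉) ⌈R⌉).prod (Set.finite_Icc (-⌈R⌉) ⌈R⌉)).subset fun v hv => ?_
  have h1 : ‖((v.1 : ℝ), (v.2 : ℝ))‖ ≤ R := mem_closedBall_zero_iff.1 (hR hv)
  have hcoord : ∀ z : ℤ, |(z : ℝ)| ≤ R → z ∈ Set.Icc (-⌈R⌉) ⌈R⌉ := by
    intro z hz
    have h2 : |(z : ℝ)| ≤ ((⌈R⌉ : ℤ) : ℝ) := hz.trans (Int.le_ceil R)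
    exact abs_le.1 (by exact_mod_cast h2)
  exact ⟨hcoord _ ((norm_fst_le _).trans h1), hcoord _ ((norm_snd_le _).trans h1)⟩

lemma mem_latticePoints_rescale {E : Set (ℝ × ℝ)} {a : ℕ} (ha : 0 < a) {v₀ v : ℤ × ℤ} :
    v ∈ latticePoints (rescale E a v₀) ↔ (a : ℤ) • v + v₀ ∈ latticePoints E := by
  have ha0 : (a : ℝ) ≠ 0 := by positivity
  have hcast : ((((a : ℤ) • v + v₀).1 : ℝ), (((a : ℤ) • v + v₀).2 : ℝ)) =
      (a : ℝ) • ((v.1 : ℝ), (v.2 : ℝ)) + ((v₀.1 : ℝ), (v₀.2 : ℝ)) := by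
    simp
  unfold latticePoints rescale
  rw [Set.mem_ofPred_eq, Set.mem_ofPred_eq, hcast]
  constructor
  · rintro ⟨e, he, h⟩
    dsimp only at h
    rw [← h, smul_inv_smul₀ ha0, sub_add_cancel]
    exact he
  · intro h
    exact ⟨_, h, by dsimp only; rw [add_sub_cancel_right, inv_smul_smul₀ ha0]⟩

open Classical in
lemma ncard_latticePoints_rescale {E : Set (ℝ × ℝ)} (hE : (latticePoints E).Finite) {a : ℕ}
    (ha : 0 < a) (v₀ : ℤ × ℤ) : (latticePoints (rescale E a v₀)).ncard =
      (hE.toFinset.filter fun v => red a v = red a v₀).card := by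
  have ha0 : (a : ℤ) ≠ 0 := by positivity
  have hinj : Function.Injective fun v : ℤ × ℤ => (a : ℤ) • v + v₀ := fun v w h =>
    smul_right_injective _ ha0 (add_right_cancel h)
  rw [← Set.ncard_image_of_injective _ hinj, ← Set.ncard_coe_finset]
  congr 1
  ext u
  simp only [Set.mem_image, Finset.coe_filter, Set.Finite.mem_toFinset, Set.mem_ofPred_eq]
  constructor
  · rintro ⟨v, hv, rfl⟩
    refine ⟨(mem_latticePoints_rescale ha).1 hv, red_eq_red_iff.2 ⟨?_, ?_⟩⟩ <;> simp
  · rintro ⟨hu, hred⟩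
    obtain ⟨⟨x, hx⟩, ⟨y, hy⟩⟩ := red_eq_red_iff.1 hred
    have huv : (a : ℤ) • ((x, y) : ℤ × ℤ) + v₀ = u := by
      ext
      · simp; linarith
      · simp; linarith
    exact ⟨(x, y), (mem_latticePoints_rescale ha).2 (huv ▸ hu), huv⟩

/-- The integral points of `a⁻¹ (E - v₀)` correspond to the points of `E` congruent to `v₀` modulo
`a`. The saving `a ^ (-θ)` in the discrepancy is discarded, so `θ` disappears and cannot enter the
final constant. -/
lemma IsOfClassL.equiDist {Cl θ η : ℝ} {E : Set (ℝ × ℝ)} (hE : IsOfClassL Cl θ E)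
    (hCl : 0 ≤ Cl) (hθ : 0 ≤ θ) (hR : Rmax E ^ θ ≤ ENNReal.ofReal (area E ^ (1 - 3 * η)))
    (hfin : (latticePoints E).Finite) :
    EquiDist (area E) (Cl * area E ^ (1 - 3 * η)) hfin.toFinset := by
  intro a v₀ ha haE
  have harea : 0 ≤ area E := measureReal_nonneg
  have h1 := hE.discrepancy a v₀ ha haE
  have h2 : (Rmax E / (a : ℝ≥0∞)) ^ θ ≤ Rmax E ^ θ := by
    refine ENNReal.rpow_le_rpow (ENNReal.div_le_of_le_mul ?_) hθ
    exact le_mul_of_one_le_right' (by exact_mod_cast ha)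
  have h3 := h1.trans (mul_le_mul_right (h2.trans hR) _)
  rw [← ENNReal.ofReal_mul hCl, ENNReal.ofReal_le_ofReal_iff (by positivity),
    ncard_latticePoints_rescale hfin ha] at h3
  convert h3

end PlaneSieve

theorem theorem8p5 (Cl A B ε C r η δ : ℝ) (d : ℕ)
    (hCl : 0 < Cl) (hA : 1 ≤ A) (hB : 0 < B) (hC : 0 < C) (hr0 : 0 < r) (hr1 : r ≤ 1)
    (hη0 : 0 < η) (hη : η < 1 / 2) (hδ : 0 < δ)
    (hε0 : 0 < ε) (hε : ε < min r (η * r / (4 * δ))) :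
    ∃ K : ℝ, 0 < K ∧
      ∀ (θ : ℝ) (E : Set (ℝ × ℝ)) (Q : MvPolynomial (Fin 2) ℤ) (X : ℝ)
        (f : ArithmeticFunction ℝ),
        0 < θ →
        PlaneSieve.IsOfClassL Cl θ E →
        PlaneSieve.Rmax E ^ θ ≤ ENNReal.ofReal (PlaneSieve.area E ^ (1 - 3 * η)) →
        Q.totalDegree = d →
        (∀ p k : ℕ, p.Prime → 1 ≤ k →
          (PlaneSieve.rhoTilde Q (p ^ k) : ℝ) ≤ C * (p : ℝ) ^ ((k : ℝ) * (2 - r))) →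
        1 ≤ X →
        (∀ v ∈ PlaneSieve.latticePoints E, |(PlaneSieve.value Q v : ℝ)| ≤ X) →
        X ≤ PlaneSieve.area E ^ δ →
        PlaneSieve.IsOfClassM A B ε f →
        ∑ᶠ v ∈ PlaneSieve.latticePoints E, f (PlaneSieve.value Q v).natAbs ≤
          K * (PlaneSieve.area E * PlaneSieve.sieveProduct Q X *
            ∑ a ∈ Finset.Icc 1 ⌊X⌋₊,
              f a * (PlaneSieve.rhoTilde Q a : ℝ) / (a : ℝ) ^ 2) := by
  obtain ⟨K, hK, h⟩ :=
    PlaneSieve.exists_sum_le Cl A B ε C r η δ d hCl hA hB hC hr0 hr1 hη0 hη hδ hε0 hε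
  refine ⟨K, hK, fun θ E Q X f hθ hE hR hd hrho hX hQX hXE hf => ?_⟩
  have harea : 0 ≤ PlaneSieve.area E := measureReal_nonneg
  have hfin := PlaneSieve.latticePoints_finite hE.isC2ConvexDomain.bounded
  rw [finsum_mem_eq_finite_toFinset_sum _ hfin]
  -- An arithmetic function vanishes at `0`. This disposes of the zero polynomial, and it also means
  -- that zeros of `Q` contribute nothing to the sum over all points.
  by_cases hQ : Q = 0
  · have hzero : ∀ v ∈ hfin.toFinset, f (PlaneSieve.value Q v).natAbs = 0 := by
      intro v _
      simp [hQ, PlaneSieve.value]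
    rw [Finset.sum_eq_zero hzero]
    have h1 := (PlaneSieve.sieveProduct_pos Q X).le
    have h2 : 0 ≤ ∑ a ∈ Finset.Icc 1 ⌊X⌋₊, f a * (PlaneSieve.rhoTilde Q a : ℝ) / (a : ℝ) ^ 2 :=
      Finset.sum_nonneg fun a _ => PlaneSieve.weight_nonneg Q hf.nonneg a
    positivity
  -- Forced by `1 ≤ X ≤ area E ^ δ`.
  have hN : 1 ≤ PlaneSieve.area E := by
    by_contra hlt
    have := Real.rpow_lt_one harea (not_le.1 hlt) hδ
    linarith
  exact h (PlaneSieve.area E) X hfin.toFinset Q f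
    { one_le := hN
      equiDist := hE.equiDist hCl.le hθ.le hR hfin
      totalDegree := hd
      ne_zero := hQ
      rhoBound := hrho
      one_le_X := hX
      X_le := hXE
      natAbs_le := fun v hv => by
        rw [Nat.cast_natAbs, Int.cast_abs]
        exact hQX v (hfin.mem_toFinset.1 hv)
      isOfClassM := hf }
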